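/- For a partition $\lambda$ let $|\lambda|$ be its size, $\lambda_1$ its largest part, $\ell(\lambda)$ its number of parts, and $s_\lambda$ its Schur function (the generating function of the semistandard Young tableaux of shape $\lambda$, a formal power series in countably many variables). For all partitions $\mu,\nu$ the product $s_\mu s_\nu$ has a unique expansion $s_\mu s_\nu=\sum_\lambda c^\lambda_{\mu\nu}\, s_\lambda$ as a finite linear combination of Schur functions with non-negative integer coefficients; these are the Littlewood–Richardson coefficients $c^\lambda_{\mu\nu}$. There are one algorithm and one constant $C$ such that for all integers $n\ge 1$ and $0\le k\le n$ and all partitions $\lambda\vdash n$, $\mu\vdash k$, $\nu\vdash n-k$, the algorithm computes $c^\lambda_{\mu\nu}$ from $(\lambda,\mu,\nu)$ in at most $$C\cdot\Big(\big(\lfloor\log_2\lambda_1\rfloor+1\big)\,\ell(\lambda)+2^k k^{k+2}\Big)$$ elementary steps. Here an algorithm is a Turing machine with finitely many stacks (a multi-tape Turing machine); its input is the concatenation of the lists of parts of $\lambda,\mu,\nu$, in this order, each part written in binary, and its output is $c^\lambda_{\mu\nu}$ in binary. -/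

import Mathlib

/-! Partitions are Young diagrams: `lam.card` is the size, `lam.rowLens` the list of parts in weakly
decreasing order, `lam.rowLen 0` the largest part and `lam.colLen 0` the number of parts. -/

/-- The weight (type) of a semistandard tableau: the multiplicity of each value among its cells. -/
noncomputable def ssytWeight {shape : YoungDiagram} (T : SemistandardYoungTableau shape) : ℕ →₀ ℕ :=
  ∑ c ∈ shape.cells, Finsupp.single (T c.1 c.2) 1

/-- The Schur function of a shape, as a formal power series in the variables `x₀, x₁, x₂, …`: the
coefficient at the monomial `x ^ α` is the number of semistandard tableaux of this shape and
weight `α` (a finite number, since all entries of such a tableau lie in the support of `α`). -/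
noncomputable def schur (shape : YoungDiagram) : MvPowerSeries ℕ ℚ :=
  fun α => (Nat.card {T : SemistandardYoungTableau shape // ssytWeight T = α} : ℚ)

/-- `c` lists the coefficients of an expansion of `f` as a finite linear combination of Schur
functions with non-negative integer coefficients. -/
def IsSchurExpansion (f : MvPowerSeries ℕ ℚ) (c : YoungDiagram →₀ ℕ) : Prop :=
  f = c.sum fun shape m => m • schur shape

open Classical in
/-- The Littlewood-Richardson coefficient `c^lam_{mu nu}`: the coefficient at the Schur function of
`lam` in the expansion of the product of the Schur functions of `mu` and `nu`. -/
noncomputable def lrCoeff (lam mu nu : YoungDiagram) : ℕ :=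
  if h : ∃ c, IsSchurExpansion (schur mu * schur nu) c then h.choose lam else 0

/-- Binary encoding of a partition: its parts in weakly decreasing order, each one written in binary
(least significant bit first) and followed by a comma; the end of the list is marked by `ket`. -/
def encodePartition (lam : YoungDiagram) : List Computability.Γ' :=
  (lam.rowLens.flatMap fun p => Computability.encodingNatΓ'.encode p ++ [Computability.Γ'.comma]) ++
    [Computability.Γ'.ket]

/-- The input string for the triple `(lam, mu, nu)`. -/
def encodeTriple (lam mu nu : YoungDiagram) : List Computability.Γ' :=
  encodePartition lam ++ encodePartition mu ++ encodePartition nu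

/-- The multi-stack Turing machine `M`, started on the input `w`, halts after at most `t` steps with
exactly `out` on its output stack. What it leaves on its other stacks (such as unread input) does
not matter, as is usual for multi-tape machines. -/
def ComputesWithin {Γ₀ Γ₁ : Type} (M : Turing.TM2ComputableAux Γ₀ Γ₁)
    (w : List Γ₀) (out : List Γ₁) (t : ℕ) : Prop :=
  ∃ c : M.tm.Cfg,
    Nonempty (StateTransition.EvalsToInTime M.tm.step
      (Turing.initList M.tm (w.map M.inputAlphabet.symm)) (some c) t) ∧
    c.l = none ∧ c.stk M.tm.k₁ = out.map M.outputAlphabet.symm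

/-! The proof combines the Littlewood–Richardson rule, obtained from Stembridge's sign-reversing
involution, with a machine whose exhaustive search depends on `k = |μ|` only.

Tableaux are replaced by Gelfand–Tsetlin patterns. The Bender–Knuth toggle makes `schurPoly n μ`
symmetric, so the alternant of `ν + ρ` times `schurPoly n μ` is the sum, over all patterns, of the
alternants of `ν + weight + ρ`. Suppose that for some `j` the weight of the columns `≥ j` does not
give a partition when added to `ν`, and take the last such `j`. Column strictness makes the defect
there exactly one, so toggling only the columns `< j` exchanges two exponents: the alternant changes
sign and the bad position is kept. Hence only the good patterns survive
(`alternant_mul_schurPoly_eq_sum_good`). For `ν = ∅` a single one survives, which is the bialternant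
formula; cancelling the Vandermonde alternant gives `schurPoly_mul`. Leading coefficients of
alternants give linear independence, and setting variables to zero transfers everything to power
series. The outcome is `lrCoeff_eq_card`.

For the computation, a good pattern becomes a matrix counting the letters in each row, and the
condition by columns becomes a ballot condition by rows (`IsGT.goodPattern_iff`). If the ballot
slack of each letter is truncated at its capacity `λ_m - ν_m`, the letters of capacity zero can be
deleted (`ncard_lrMat_compress`), and at most `k` letters remain. When the `k` cells of `μ` are
listed row by row and each letter is recorded by its advance over the preceding one, the matrices
correspond to those among the `(k+1)^k` words with digits at most `k` which pass a local test at
every cell (`wordSum_eq_ncard_lrMat`).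

The machine subtracts `ν` from `λ` in binary, at a cost of the order of `ℓ(λ) (log λ_1 + 1)`. Only
the differences, whose sum is `k`, are written in unary. It then runs through all words with an
odometer, checks each with unary counters in `O(k^3)` steps and increments the output for the valid
ones. The total `(k+1)^k (k+1)^3` is bounded using `(k+1)^k ≤ 3 k^k` and `(k+1)^3 ≤ 8 k^2 2^k`. The
programs are written in a structured language with a cost semantics that compiles to `TM2` machines
step for step (`Exec.simulate`). -/

open Computability Turing

/-! ### Structured stack programs and their cost -/

/-- Structured programs acting on finitely many stacks: simultaneous edits of the tops of the
stacks, sequencing, branching and loops, all tests reading only the tops of the stacks. -/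
inductive StackProg (K : Type) : Type
  | act (f : (K → Option Γ') → K → Bool × Option Γ')
  | seq (p q : StackProg K)
  | ite (c : (K → Option Γ') → Bool) (p q : StackProg K)
  | loop (c : (K → Option Γ') → Bool) (p : StackProg K)

/-- Contents of the stacks. -/
abbrev Stacks (K : Type) := K → List Γ'

namespace StackProg

variable {K : Type}

/-- The tops of all stacks. -/
def tops (S : Stacks K) : K → Option Γ' := fun k => (S k).head?

/-- Edit one stack: possibly pop, then possibly push. -/
def edit (e : Bool × Option Γ') (l : List Γ') : List Γ' :=
  e.2.toList ++ (if e.1 then l.tail else l)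

/-- Simultaneous edit of all stacks. -/
def applyAct (f : (K → Option Γ') → K → Bool × Option Γ') (S : Stacks K) : Stacks K :=
  fun k => edit (f (tops S) k) (S k)

/-- Big-step semantics with step counting. -/
inductive Exec : StackProg K → Stacks K → Stacks K → ℕ → Prop
  | act (f S) : Exec (act f) S (applyAct f S) 1
  | seq {p q S S₁ S₂ t₁ t₂} : Exec p S S₁ t₁ → Exec q S₁ S₂ t₂ → Exec (seq p q) S S₂ (t₁ + t₂)
  | iteTrue {c p q S S₁ t} : c (tops S) = true → Exec p S S₁ t → Exec (ite c p q) S S₁ (t + 1)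
  | iteFalse {c p q S S₁ t} : c (tops S) = false → Exec q S S₁ t → Exec (ite c p q) S S₁ (t + 1)
  | loopDone {c p S} : c (tops S) = false → Exec (loop c p) S S 1
  | loopStep {c p S S₁ S₂ t₁ t₂} : c (tops S) = true → Exec p S S₁ t₁ →
      Exec (loop c p) S₁ S₂ t₂ → Exec (loop c p) S S₂ (t₁ + t₂ + 1)

/-- `p` transforms `S` to `S'` in at most `t` steps. -/
def Runs (p : StackProg K) (S S' : Stacks K) (t : ℕ) : Prop := ∃ s ≤ t, Exec p S S' s

theorem Runs.mono {p : StackProg K} {S S' : Stacks K} {t t' : ℕ} (h : Runs p S S' t)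
    (ht : t ≤ t') : Runs p S S' t' :=
  let ⟨s, hs, e⟩ := h; ⟨s, hs.trans ht, e⟩

theorem Runs.act' {f : (K → Option Γ') → K → Bool × Option Γ'} {S S' : Stacks K}
    (h : ∀ k, edit (f (tops S) k) (S k) = S' k) : Runs (act f) S S' 1 := by
  obtain rfl : applyAct f S = S' := funext h
  exact ⟨1, le_rfl, .act f S⟩

theorem Runs.seq' {p q : StackProg K} {S S₁ S₂ : Stacks K} {t₁ t₂ : ℕ} (h₁ : Runs p S S₁ t₁)
    (h₂ : Runs q S₁ S₂ t₂) : Runs (seq p q) S S₂ (t₁ + t₂) :=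
  let ⟨_, l₁, e₁⟩ := h₁; let ⟨_, l₂, e₂⟩ := h₂; ⟨_, add_le_add l₁ l₂, .seq e₁ e₂⟩

theorem Runs.iteT {c : (K → Option Γ') → Bool} {p q : StackProg K} {S S' : Stacks K} {t : ℕ}
    (hc : c (tops S) = true) (h : Runs p S S' t) : Runs (ite c p q) S S' (t + 1) :=
  let ⟨_, l, e⟩ := h; ⟨_, Nat.succ_le_succ l, .iteTrue hc e⟩

theorem Runs.iteF {c : (K → Option Γ') → Bool} {p q : StackProg K} {S S' : Stacks K} {t : ℕ}
    (hc : c (tops S) = false) (h : Runs q S S' t) : Runs (ite c p q) S S' (t + 1) :=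
  let ⟨_, l, e⟩ := h; ⟨_, Nat.succ_le_succ l, .iteFalse hc e⟩

theorem Runs.done {c : (K → Option Γ') → Bool} {p : StackProg K} {S : Stacks K}
    (hc : c (tops S) = false) : Runs (loop c p) S S 1 := ⟨1, le_rfl, .loopDone hc⟩

theorem Runs.step {c : (K → Option Γ') → Bool} {p : StackProg K} {S S₁ S₂ : Stacks K} {t₁ t₂ : ℕ}
    (hc : c (tops S) = true) (h₁ : Runs p S S₁ t₁) (h₂ : Runs (loop c p) S₁ S₂ t₂) :
    Runs (loop c p) S S₂ (t₁ + t₂ + 1) :=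
  let ⟨_, l₁, e₁⟩ := h₁; let ⟨_, l₂, e₂⟩ := h₂
  ⟨_, Nat.succ_le_succ (add_le_add l₁ l₂), .loopStep hc e₁ e₂⟩

/-! ### Compilation to Turing machines with stacks -/

/-- Program points. -/
def Label : StackProg K → Type
  | act _ => Unit
  | seq p q => p.Label ⊕ q.Label
  | ite _ p q => Option (p.Label ⊕ q.Label)
  | loop _ p => Option p.Label

/-- There are finitely many program points. -/
@[reducible] def labelFintype : (p : StackProg K) → Fintype p.Label
  | act _ => inferInstanceAs (Fintype Unit)
  | seq p q => @instFintypeSum _ _ p.labelFintype q.labelFintype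
  | ite _ p q => @instFintypeOption _ (@instFintypeSum _ _ p.labelFintype q.labelFintype)
  | loop _ p => @instFintypeOption _ p.labelFintype

/-- The first program point. -/
def entry : (p : StackProg K) → p.Label
  | act _ => ()
  | seq p _ => Sum.inl p.entry
  | ite _ _ _ => (none : Option _)
  | loop _ _ => (none : Option _)

section compile

variable [DecidableEq K] {Λ : Type}

/-- Statements of the target machine; its register holds the tops of the stacks. -/
abbrev Target (K Λ : Type) [DecidableEq K] := TM2.Stmt (fun _ : K => Γ') Λ (K → Option Γ')

/-- Load the tops of the stacks `ks` into the register. -/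
def readTops (ks : List K) (q : Target K Λ) : Target K Λ :=
  ks.foldr (fun k q => .peek k (fun v x => Function.update v k x) q) q

/-- Perform the edits prescribed by the register on the stacks `ks`. -/
def performEdits (f : (K → Option Γ') → K → Bool × Option Γ') (ks : List K) (q : Target K Λ) :
    Target K Λ :=
  ks.foldr (fun k q =>
    let r : Target K Λ := .branch (fun v => (f v k).2.isSome)
      (.push k (fun v => (f v k).2.getD Γ'.blank) q) q
    .branch (fun v => (f v k).1) (.pop k (fun v _ => v) r) r) q

theorem stepAux_readTops (ks : List K) (q : Target K Λ) (v : K → Option Γ') (S : Stacks K) :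
    TM2.stepAux (readTops ks q) v S =
      TM2.stepAux q (fun k => if k ∈ ks then tops S k else v k) S := by
  induction ks generalizing v with
  | nil => simp [readTops]
  | cons a ks ih =>
    have h : readTops (a :: ks) q = .peek a (fun v x => Function.update v a x) (readTops ks q) :=
      rfl
    rw [h, TM2.stepAux, ih]
    congr 1
    funext k
    by_cases hk : k ∈ ks
    · simp [hk]
    · by_cases hka : k = a
      · subst hka
        simp [hk, tops]
      · simp [hk, hka]

/-- The decisions depend only on the register `v`, which none of these pops and pushes changes.
Editing the stacks one after another therefore amounts to a simultaneous edit, provided each stack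
is listed once. -/
theorem stepAux_performEdits (f : (K → Option Γ') → K → Bool × Option Γ') (ks : List K)
    (hks : ks.Nodup) (q : Target K Λ) (v : K → Option Γ') (S : Stacks K) :
    TM2.stepAux (performEdits f ks q) v S =
      TM2.stepAux q v (fun k => if k ∈ ks then edit (f v k) (S k) else S k) := by
  induction ks generalizing S with
  | nil => simp [performEdits]
  | cons a ks ih =>
    obtain ⟨ha, hks⟩ := List.nodup_cons.1 hks
    have key : TM2.stepAux (performEdits f (a :: ks) q) v S =
        TM2.stepAux (performEdits f ks q) v (Function.update S a (edit (f v a) (S a))) := by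
      have h : performEdits f (a :: ks) q =
        (let r : Target K Λ := .branch (fun v => (f v a).2.isSome)
          (.push a (fun v => (f v a).2.getD Γ'.blank) (performEdits f ks q)) (performEdits f ks q)
        .branch (fun v => (f v a).1) (.pop a (fun v _ => v) r) r) := rfl
      rw [h]
      rcases hfa : f v a with ⟨b, o⟩
      cases b <;> cases o <;> simp [TM2.stepAux, hfa, edit]
    rw [key, ih hks]
    congr 1
    funext k
    by_cases hka : k = a
    · subst hka
      simp [ha]
    · simp [hka]

/-- The statement at a program point. -/
def code (ks : List K) : (p : StackProg K) → (p.Label → Λ) → Λ → p.Label → Target K Λ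
  | act f, _, exit, _ => readTops ks (performEdits f ks (.goto fun _ => exit))
  | seq p q, emb, exit, l =>
    match l with
    | Sum.inl l => code ks p (fun x => emb (Sum.inl x)) (emb (Sum.inr q.entry)) l
    | Sum.inr l => code ks q (fun x => emb (Sum.inr x)) exit l
  | ite c p q, emb, exit, l =>
    match l with
    | none => readTops ks (.goto fun v =>
        if c v then emb (some (Sum.inl p.entry)) else emb (some (Sum.inr q.entry)))
    | some (Sum.inl l) => code ks p (fun x => emb (some (Sum.inl x))) exit l
    | some (Sum.inr l) => code ks q (fun x => emb (some (Sum.inr x))) exit l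
  | loop c p, emb, exit, l =>
    match l with
    | none => readTops ks (.goto fun v => if c v then emb (some p.entry) else exit)
    | some l => code ks p (fun x => emb (some x)) (emb none) l

/-- A single statement may read and edit all stacks, so one unit of program time is exactly one
machine step. The embedding `emb` and the label `exit` are arbitrary so that the induction covers
subprograms of a larger machine; the body of a loop exits to the test of that loop. -/
theorem Exec.simulate {ks : List K} (hks : ∀ k, k ∈ ks) (hnd : ks.Nodup) {p : StackProg K}
    {S S' : Stacks K} {t : ℕ} (h : Exec p S S' t) (M : Λ → Target K Λ) :
    ∀ (emb : p.Label → Λ) (exit : Λ), (∀ l, M (emb l) = code ks p emb exit l) →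
      ∀ v, ∃ v', (flip bind (TM2.step M))^[t] (some ⟨some (emb p.entry), v, S⟩) =
        some ⟨some exit, v', S'⟩ := by
  have one : ∀ (l : Λ) (v : K → Option Γ') (S : Stacks K),
      flip bind (TM2.step M) (some ⟨some l, v, S⟩) = some (TM2.stepAux (M l) v S) :=
    fun l v S => rfl
  have rd : ∀ (q : Target K Λ) (v : K → Option Γ') (S : Stacks K),
      TM2.stepAux (readTops ks q) v S = TM2.stepAux q (tops S) S := by
    intro q v S
    rw [stepAux_readTops]
    simp [hks]
  induction h with
  | act f S =>
    intro emb exit hM v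
    refine ⟨tops S, ?_⟩
    rw [Function.iterate_one, one, hM]
    simp only [code]
    rw [rd, stepAux_performEdits _ _ hnd]
    simp [TM2.stepAux, hks]
    rfl
  | @seq p q S S₁ S₂ t₁ t₂ _ _ ih₁ ih₂ =>
    intro emb exit hM v
    obtain ⟨v₁, h₁⟩ := ih₁ (fun x => emb (Sum.inl x)) (emb (Sum.inr q.entry))
      (fun l => hM (Sum.inl l)) v
    obtain ⟨v₂, h₂⟩ := ih₂ (fun x => emb (Sum.inr x)) exit (fun l => hM (Sum.inr l)) v₁
    refine ⟨v₂, ?_⟩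
    rw [add_comm, Function.iterate_add_apply]
    exact (congrArg _ h₁).trans h₂
  | @iteTrue c p q S S₁ t hc _ ih =>
    intro emb exit hM v
    obtain ⟨v₁, h₁⟩ := ih (fun x => emb (some (Sum.inl x))) exit
      (fun l => hM (some (Sum.inl l))) (tops S)
    refine ⟨v₁, ?_⟩
    rw [Function.iterate_succ_apply, one, hM]
    simp only [code, entry]
    rw [rd]
    simpa [TM2.stepAux, hc] using h₁
  | @iteFalse c p q S S₁ t hc _ ih =>
    intro emb exit hM v
    obtain ⟨v₁, h₁⟩ := ih (fun x => emb (some (Sum.inr x))) exit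
      (fun l => hM (some (Sum.inr l))) (tops S)
    refine ⟨v₁, ?_⟩
    rw [Function.iterate_succ_apply, one, hM]
    simp only [code, entry]
    rw [rd]
    simpa [TM2.stepAux, hc] using h₁
  | @loopDone c p S hc =>
    intro emb exit hM v
    refine ⟨tops S, ?_⟩
    rw [Function.iterate_one, one, hM]
    simp only [code, entry]
    rw [rd]
    simp [TM2.stepAux, hc]
  | @loopStep c p S S₁ S₂ t₁ t₂ hc _ _ ih₁ ih₂ =>
    intro emb exit hM v
    obtain ⟨v₁, h₁⟩ := ih₁ (fun x => emb (some x)) (emb none) (fun l => hM (some l)) (tops S)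
    obtain ⟨v₂, h₂⟩ := ih₂ emb exit hM v₁
    refine ⟨v₂, ?_⟩
    rw [Function.iterate_succ_apply, one, hM]
    have : TM2.stepAux (code ks (loop c p) emb exit (loop c p).entry) v S =
        ⟨some (emb (some p.entry)), tops S, S⟩ := by
      simp only [code, entry]
      rw [rd]
      simp [TM2.stepAux, hc]
    rw [this, add_comm, Function.iterate_add_apply]
    exact (congrArg _ h₁).trans h₂

end compile

/-- The Turing machine running `p` with input stack `inp` and output stack `out`. -/
noncomputable def machine [DecidableEq K] [Fintype K] (p : StackProg K) (inp out : K) :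
    TM2ComputableAux Γ' Γ' where
  tm :=
    { K := K
      k₀ := inp
      k₁ := out
      Γ := fun _ => Γ'
      Λ := Option p.Label
      main := some p.entry
      ΛFin := @instFintypeOption _ p.labelFintype
      σ := K → Option Γ'
      initialState := fun _ => none
      m := fun l => match l with
        | none => .halt
        | some l => code Finset.univ.toList p some none l
      Γk₀Fin := inferInstanceAs (Fintype Γ') }
  inputAlphabet := Equiv.refl _
  outputAlphabet := Equiv.refl _

/-- The additional step executes `halt` at the label `none`. -/
theorem Runs.computesWithin [DecidableEq K] [Fintype K] {p : StackProg K} {inp out : K}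
    {w o : List Γ'} {S' : Stacks K} {t : ℕ}
    (h : Runs p (Function.update (fun _ => []) inp w) S' t) (ho : S' out = o) :
    ComputesWithin (p.machine inp out) w o (t + 1) := by
  obtain ⟨s, hs, hx⟩ := h
  obtain ⟨v', hv⟩ := hx.simulate (ks := Finset.univ.toList) (by simp) (Finset.nodup_toList _)
    (p.machine inp out).tm.m some none (fun l => rfl) (fun _ => none)
  have h0 : initList (p.machine inp out).tm (w.map (p.machine inp out).inputAlphabet.symm) =
      (⟨some (some p.entry), fun _ => none, Function.update (fun _ => []) inp w⟩ :
        TM2.Cfg (fun _ : K => Γ') (Option p.Label) (K → Option Γ')) := by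
    simp only [initList, machine]
    congr 1
    funext k
    by_cases hk : k = inp
    · subst hk
      rw [Function.update_self]
      exact (dif_pos rfl).trans (List.map_id w)
    · simp [hk]
  have h1 : (flip bind (p.machine inp out).tm.step)^[s + 1]
      (some (initList (p.machine inp out).tm (w.map (p.machine inp out).inputAlphabet.symm))) =
      some (⟨none, v', S'⟩ : TM2.Cfg (fun _ : K => Γ') (Option p.Label) (K → Option Γ')) := by
    rw [h0, add_comm, Function.iterate_add_apply]
    exact (congrArg _ hv).trans rfl
  refine ⟨_, ⟨⟨⟨s + 1, h1⟩, Nat.succ_le_succ hs⟩⟩, rfl, ?_⟩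
  exact ho.trans (List.map_id o).symm

end StackProg

/-! ### Gelfand–Tsetlin patterns and their column counts -/

open Finset

/-- A Gelfand-Tsetlin pattern of shape `μ` with `n` levels: `p m i` is the number of cells in row
`i` of a semistandard tableau of shape `μ` whose entry is less than `m`. -/
structure IsGT (μ : ℕ → ℕ) (n : ℕ) (p : ℕ → ℕ → ℕ) : Prop where
  zero : ∀ i, p 0 i = 0
  mono : ∀ m i, p m i ≤ p (m + 1) i
  inter : ∀ m i, p (m + 1) (i + 1) ≤ p m i
  top : ∀ m i, n ≤ m → p m i = μ i

/-- The number of cells in columns `≥ j` with entry less than `m`. -/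
def colCount (L : ℕ) (p : ℕ → ℕ → ℕ) (j m : ℕ) : ℕ := ∑ i ∈ range L, (p m i - j)

/-- The weight of a pattern. -/
def wt (L : ℕ) (p : ℕ → ℕ → ℕ) (m : ℕ) : ℕ := colCount L p 0 (m + 1) - colCount L p 0 m

/-- Stembridge's condition: for all `j`, adding the weight of the columns `≥ j` to `ν` gives a
partition. -/
def GoodPattern (L : ℕ) (ν : ℕ → ℕ) (p : ℕ → ℕ → ℕ) : Prop :=
  ∀ j m, ν (m + 1) + colCount L p j (m + 2) + colCount L p j m ≤ ν m + 2 * colCount L p j (m + 1)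

namespace IsGT

variable {μ : ℕ → ℕ} {n L : ℕ} {p : ℕ → ℕ → ℕ}

theorem monotone (h : IsGT μ n p) (i : ℕ) : Monotone fun m => p m i :=
  monotone_nat_of_le_succ fun m => h.mono m i

theorem le_top (h : IsGT μ n p) (m i : ℕ) : p m i ≤ μ i := by
  rw [← h.top (max m n) i (le_max_right _ _)]
  exact h.monotone i (le_max_left _ _)

theorem anti (h : IsGT μ n p) (m i : ℕ) : p m (i + 1) ≤ p m i := (h.mono m _).trans (h.inter m i)

theorem antitone (h : IsGT μ n p) (m : ℕ) : Antitone (p m) :=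
  antitone_nat_of_succ_le fun i => h.anti m i

theorem antitone_shape (h : IsGT μ n p) : Antitone μ := by
  have := h.antitone n
  rwa [show p n = μ from funext fun i => h.top n i le_rfl] at this

theorem eq_zero (h : IsGT μ n p) (hL : ∀ i, L ≤ i → μ i = 0) {m i : ℕ} (hi : L ≤ i) :
    p m i = 0 := Nat.le_zero.1 ((h.le_top m i).trans_eq (hL i hi))

theorem levels_mono (h : IsGT μ n p) {n' : ℕ} (hn : n ≤ n') : IsGT μ n' p :=
  ⟨h.zero, h.mono, h.inter, fun m i hm => h.top m i (hn.trans hm)⟩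

theorem colCount_mono (h : IsGT μ n p) (j m : ℕ) : colCount L p j m ≤ colCount L p j (m + 1) :=
  sum_le_sum fun i _ => Nat.sub_le_sub_right (h.mono m i) j

theorem colCount_add_wt (h : IsGT μ n p) (m : ℕ) :
    colCount L p 0 m + wt L p m = colCount L p 0 (m + 1) := by
  have := h.colCount_mono (L := L) 0 m
  simp only [wt]
  omega

end IsGT

/-! ### The Bender-Knuth involution in the columns `< j` -/

/-- Lower bounds for the entries of level `m + 1`. -/
def gtLo (p : ℕ → ℕ → ℕ) (m i : ℕ) : ℕ := max (p (m + 2) (i + 1)) (p m i)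

/-- Upper bounds for the entries of level `m + 1`. -/
def gtHi (p : ℕ → ℕ → ℕ) (m : ℕ) : ℕ → ℕ
  | 0 => p (m + 2) 0
  | i + 1 => min (p (m + 2) (i + 1)) (p m i)

/-- The Bender-Knuth involution exchanging the numbers of entries `m` and `m + 1` in the columns
`< j`. -/
def gtToggle (j m : ℕ) (p : ℕ → ℕ → ℕ) : ℕ → ℕ → ℕ := fun m' i =>
  if m' = m + 1 then
    min (gtLo p m i) j + min (gtHi p m i) j - min (p (m + 1) i) j + (p (m + 1) i - j)
  else p m' i

/-- Column `j` does not contain the entry `m` just above an entry `m + 1`. -/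
def Toggleable (j m : ℕ) (p : ℕ → ℕ → ℕ) : Prop :=
  ∀ i, gtLo p m i < j → j < gtHi p m i → p (m + 1) i ≤ j

section toggle

variable {μ : ℕ → ℕ} {n L : ℕ} {p : ℕ → ℕ → ℕ} {j m : ℕ}

theorem gtToggle_of_ne {m' : ℕ} (h : m' ≠ m + 1) (i : ℕ) : gtToggle j m p m' i = p m' i := by
  simp [gtToggle, h]

theorem gtToggle_self (i : ℕ) : gtToggle j m p (m + 1) i =
    min (gtLo p m i) j + min (gtHi p m i) j - min (p (m + 1) i) j + (p (m + 1) i - j) := by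
  simp [gtToggle]

theorem gtLo_toggle (i : ℕ) : gtLo (gtToggle j m p) m i = gtLo p m i := by
  simp [gtLo, gtToggle]

theorem gtHi_toggle (i : ℕ) : gtHi (gtToggle j m p) m i = gtHi p m i := by
  cases i <;> simp [gtHi, gtToggle]

theorem IsGT.lo_le (h : IsGT μ n p) (m i : ℕ) : gtLo p m i ≤ p (m + 1) i :=
  max_le (h.inter (m + 1) i) (h.mono m i)

theorem IsGT.le_hi (h : IsGT μ n p) (m i : ℕ) : p (m + 1) i ≤ gtHi p m i := by
  cases i with
  | zero => exact h.mono (m + 1) 0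
  | succ i => exact le_min (h.mono (m + 1) _) (h.inter m i)

/-- Below column `j` the entry is reflected in the interval from `gtLo` to `gtHi` truncated at `j`,
and a reflection maps an interval to itself. -/
theorem IsGT.toggle_bounds (h : IsGT μ n p) (ht : Toggleable j m p) (i : ℕ) :
    gtLo p m i ≤ gtToggle j m p (m + 1) i ∧ gtToggle j m p (m + 1) i ≤ gtHi p m i := by
  have h1 := h.lo_le m i
  have h2 := h.le_hi m i
  have h3 := ht i
  rw [gtToggle_self]
  omega

theorem IsGT.isGT_toggle (h : IsGT μ n p) (ht : Toggleable j m p) (hm : m + 2 ≤ n) :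
    IsGT μ n (gtToggle j m p) := by
  have hb := h.toggle_bounds ht
  refine ⟨fun i => ?_, fun m' i => ?_, fun m' i => ?_, fun m' i hm' => ?_⟩
  · rw [gtToggle_of_ne (by omega), h.zero]
  · by_cases h1 : m' = m + 1
    · subst h1
      rw [gtToggle_of_ne (m' := m + 1 + 1) (by omega)]
      refine (hb i).2.trans ?_
      cases i with
      | zero => exact le_rfl
      | succ i => exact min_le_left _ _
    · rw [gtToggle_of_ne h1]
      by_cases h2 : m' = m
      · subst h2
        exact (le_max_right _ _).trans (hb i).1
      · rw [gtToggle_of_ne (by omega)]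
        exact h.mono m' i
  · by_cases h1 : m' = m + 1
    · subst h1
      rw [gtToggle_of_ne (m' := m + 1 + 1) (by omega)]
      exact (le_max_left _ _).trans (hb i).1
    · rw [gtToggle_of_ne h1]
      by_cases h2 : m' = m
      · subst h2
        exact (hb (i + 1)).2.trans (min_le_right _ _)
      · rw [gtToggle_of_ne (by omega)]
        exact h.inter m' i
  · rw [gtToggle_of_ne (by omega), h.top m' i hm']

/-- If `j` lies strictly between the bounds of a row and the entry exceeds `j`, the reflected part
no longer reaches column `j` and the remainder would slide to the left. This is the case that
`Toggleable` excludes. -/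
theorem IsGT.toggle_sub (h : IsGT μ n p) (ht : Toggleable j m p) {j' : ℕ} (hj : j ≤ j')
    (m' i : ℕ) : gtToggle j m p m' i - j' = p m' i - j' := by
  by_cases h1 : m' = m + 1
  · subst h1
    have h1 := h.lo_le m i
    have h2 := h.le_hi m i
    have h3 := ht i
    rw [gtToggle_self]
    omega
  · rw [gtToggle_of_ne h1]

theorem IsGT.colCount_toggle (h : IsGT μ n p) (ht : Toggleable j m p) {j' : ℕ} (hj : j ≤ j')
    (m' : ℕ) : colCount L (gtToggle j m p) j' m' = colCount L p j' m' :=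
  sum_congr rfl fun i _ => h.toggle_sub ht hj m' i

/-- The bounds involve the levels `m` and `m + 2` only, which the toggle leaves alone, so the same
reflection is applied twice. -/
theorem IsGT.toggle_toggle (h : IsGT μ n p) (ht : Toggleable j m p) :
    gtToggle j m (gtToggle j m p) = p := by
  funext m' i
  by_cases h1 : m' = m + 1
  · subst h1
    have h1 := h.lo_le m i
    have h2 := h.le_hi m i
    have h3 := ht i
    have h4 := h.toggle_sub ht le_rfl (m + 1) i
    rw [gtToggle_self, gtLo_toggle, gtHi_toggle, h4, gtToggle_self]
    omega
  · rw [gtToggle_of_ne h1, gtToggle_of_ne h1]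

theorem sum_min_add_sub (f : ℕ → ℕ) (L j : ℕ) :
    ∑ i ∈ range L, min (f i) j + ∑ i ∈ range L, (f i - j) = ∑ i ∈ range L, f i := by
  rw [← sum_add_distrib]
  exact sum_congr rfl fun i _ => by omega

/-- The lower bound of row `i` is the maximum, and the upper bound of row `i + 1` the minimum, of
the same two entries; hence `max a b + min a b = a + b`, summed over the rows. -/
theorem sum_lo_hi (p : ℕ → ℕ → ℕ) (m j : ℕ) (L : ℕ) :
    ∑ i ∈ range L, min (gtLo p m i) j + ∑ i ∈ range L, min (gtHi p m i) j + min (gtHi p m L) j =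
      ∑ i ∈ range (L + 1), min (p (m + 2) i) j + ∑ i ∈ range L, min (p m i) j := by
  induction L with
  | zero => simp [gtHi]
  | succ L ih =>
    rw [sum_range_succ, sum_range_succ, sum_range_succ _ (L + 1), sum_range_succ (fun i => min (p m i) j)]
    have : min (gtLo p m L) j + min (gtHi p m (L + 1)) j =
        min (p (m + 2) (L + 1)) j + min (p m L) j := by
      simp only [gtLo, gtHi]
      omega
    omega

/-- Over the columns `< j` the reflected entries sum to `∑ lo + ∑ hi - ∑ p (m + 1)`, and `sum_lo_hi`
evaluates the bounds. The counts at `j` account for the columns left alone. -/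
theorem IsGT.colCount_zero_toggle (h : IsGT μ n p) (hL : ∀ i, L ≤ i → μ i = 0) :
    colCount L (gtToggle j m p) 0 (m + 1) + colCount L p 0 (m + 1) + colCount L p j (m + 2) +
      colCount L p j m =
      colCount L p 0 (m + 2) + colCount L p 0 m + 2 * colCount L p j (m + 1) := by
  have hz : ∀ m, p m L = 0 := fun m => h.eq_zero hL le_rfl
  have hhi : gtHi p m L = 0 := by
    cases L with
    | zero => exact hz _
    | succ L => simp [gtHi, hz]
  have e := sum_lo_hi p m j L
  rw [hhi, sum_range_succ _ L, hz] at e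
  have e1 : ∑ i ∈ range L, gtToggle j m p (m + 1) i + ∑ i ∈ range L, min (p (m + 1) i) j =
      ∑ i ∈ range L, min (gtLo p m i) j + ∑ i ∈ range L, min (gtHi p m i) j +
        ∑ i ∈ range L, (p (m + 1) i - j) := by
    simp only [← sum_add_distrib]
    refine sum_congr rfl fun i _ => ?_
    have h1 := h.lo_le m i
    have h2 := h.le_hi m i
    rw [gtToggle_self]
    omega
  have e2 := sum_min_add_sub (p (m + 2)) L j
  have e3 := sum_min_add_sub (p m) L j
  have e4 := sum_min_add_sub (p (m + 1)) L j
  simp only [colCount, Nat.sub_zero]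
  omega

/-- Without truncation every pattern can be toggled. -/
theorem IsGT.toggleable_of_le (h : IsGT μ n p) (hj : μ 0 ≤ j) : Toggleable j m p := by
  intro i _ h2
  have h3 := (h.le_top (m + 1) i).trans (h.antitone_shape (Nat.zero_le i))
  omega

theorem colCount_eq_zero_of_le (h : IsGT μ n p) (hj : μ 0 ≤ j) (m : ℕ) : colCount L p j m = 0 :=
  sum_eq_zero fun i _ => by
    have h3 := (h.le_top m i).trans (h.antitone_shape (Nat.zero_le i))
    omega

/-- With `j` beyond all columns nothing is truncated, and the toggle is the classical Bender–Knuth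
involution. -/
theorem IsGT.wt_toggle (h : IsGT μ n p) (hL : ∀ i, L ≤ i → μ i = 0) (hj : μ 0 ≤ j)
    (hm : m + 2 ≤ n) (x : ℕ) :
    wt L (gtToggle j m p) x = wt L p (Equiv.swap m (m + 1) x) := by
  have ht := h.toggleable_of_le (m := m) hj
  have e := h.colCount_zero_toggle (j := j) (m := m) hL
  simp only [colCount_eq_zero_of_le h hj] at e
  have hq := h.isGT_toggle ht hm
  have hne : ∀ m', m' ≠ m + 1 → colCount L (gtToggle j m p) 0 m' = colCount L p 0 m' :=
    fun m' h1 => sum_congr rfl fun i _ => by rw [gtToggle_of_ne h1]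
  have a0 := h.colCount_add_wt (L := L) m
  have a1 := h.colCount_add_wt (L := L) (m + 1)
  have b0 := hq.colCount_add_wt (L := L) m
  have b1 := hq.colCount_add_wt (L := L) (m + 1)
  rw [hne m (by omega)] at b0
  rw [hne (m + 1 + 1) (by omega)] at b1
  rw [show m + 1 + 1 = m + 2 from rfl] at a1 b1
  by_cases h1 : x = m
  · subst h1
    rw [Equiv.swap_apply_left]
    omega
  · by_cases h2 : x = m + 1
    · subst h2
      rw [Equiv.swap_apply_right]
      omega
    · rw [Equiv.swap_apply_of_ne_of_ne h1 h2]
      simp only [wt]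
      rw [hne _ (by omega), hne _ (by omega)]

end toggle

/-! ### Columns violating the condition -/

section bad

variable {μ ν : ℕ → ℕ} {n L : ℕ} {p : ℕ → ℕ → ℕ} {j m : ℕ}

/-- The condition fails at column `j` and level `m`. -/
def BadAt (L : ℕ) (ν : ℕ → ℕ) (p : ℕ → ℕ → ℕ) (j m : ℕ) : Prop :=
  ν m + 2 * colCount L p j (m + 1) < ν (m + 1) + colCount L p j (m + 2) + colCount L p j m

/-- The number of cells of column `j` with entry less than `m`. -/
def colHeight (L : ℕ) (p : ℕ → ℕ → ℕ) (j m : ℕ) : ℕ := #{i ∈ range L | j < p m i}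

theorem colCount_succ (L : ℕ) (p : ℕ → ℕ → ℕ) (j m : ℕ) :
    colCount L p j m = colCount L p (j + 1) m + colHeight L p j m := by
  simp only [colCount, colHeight, card_filter, ← sum_add_distrib]
  refine sum_congr rfl fun i _ => ?_
  split_ifs <;> omega

/-- Each level of a pattern is antitone in the row, so the rows reaching beyond column `j` form an
initial segment, whose length is the height. -/
theorem IsGT.lt_colHeight_iff (h : IsGT μ n p) (hL : ∀ i, L ≤ i → μ i = 0) (i : ℕ) :
    i < colHeight L p j m ↔ j < p m i := by
  have key : ∀ N, ({i ∈ range L | j < p m i} = range N) →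
      (i < colHeight L p j m ↔ j < p m i) := by
    intro N hN
    have : i ∈ ({i ∈ range L | j < p m i}) ↔ i ∈ range N := by rw [hN]
    rw [colHeight, hN, card_range, ← mem_range, ← this, mem_filter, mem_range]
    refine ⟨fun h => h.2, fun h' => ⟨?_, h'⟩⟩
    by_contra hi
    have := h.eq_zero hL (m := m) (not_lt.1 hi)
    omega
  have hex : ∃ N, p m N ≤ j := ⟨L, by rw [h.eq_zero hL le_rfl]; exact Nat.zero_le _⟩
  classical
  refine key (Nat.find hex) ?_
  ext x
  simp only [mem_filter, mem_range, Nat.lt_find_iff, not_le]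
  constructor
  · rintro ⟨_, h2⟩ y hy
    exact h2.trans_le (h.antitone m hy)
  · intro h2
    refine ⟨?_, h2 x le_rfl⟩
    by_contra hi
    have := h2 x le_rfl
    rw [h.eq_zero hL (not_lt.1 hi)] at this
    omega

theorem IsGT.colHeight_mono (h : IsGT μ n p) (hL : ∀ i, L ≤ i → μ i = 0) (j m : ℕ) :
    colHeight L p j m ≤ colHeight L p j (m + 1) := by
  by_contra! hc
  rw [h.lt_colHeight_iff hL] at hc
  have h1 : ¬ colHeight L p j (m + 1) < colHeight L p j (m + 1) := lt_irrefl _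
  rw [h.lt_colHeight_iff hL] at h1
  exact h1 (hc.trans_le (h.mono m _))

/-- Column strictness: by interlacing a column contains at most one entry `m`. -/
theorem IsGT.colHeight_succ_le (h : IsGT μ n p) (hL : ∀ i, L ≤ i → μ i = 0) (j m : ℕ) :
    colHeight L p j (m + 1) ≤ colHeight L p j m + 1 := by
  by_contra! hc
  rw [h.lt_colHeight_iff hL] at hc
  have h1 : ¬ colHeight L p j m < colHeight L p j m := lt_irrefl _
  rw [h.lt_colHeight_iff hL] at h1
  exact h1 (hc.trans_le (h.inter m _))

/-- At the last bad column the defect is exactly one. -/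
theorem IsGT.last_bad (h : IsGT μ n p) (hL : ∀ i, L ≤ i → μ i = 0) (hb : BadAt L ν p j m)
    (hl : ¬ BadAt L ν p (j + 1) m) :
    ν m + 2 * colCount L p j (m + 1) + 1 = ν (m + 1) + colCount L p j (m + 2) + colCount L p j m ∧
    colHeight L p j (m + 1) = colHeight L p j m ∧
    colHeight L p j (m + 2) = colHeight L p j m + 1 := by
  -- From column `j + 1` to column `j` the defect changes by `(h (m+2) - h (m+1)) - (h (m+1) - h
  -- m)`, where `h` is the height of column `j` and both differences are 0 or 1. As the defect rises
  -- from at most 0 to at least 1, it rises from 0 to 1, and column `j` contains `m + 1` but not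
  -- `m`.
  have h0 := colCount_succ L p j m
  have h1 := colCount_succ L p j (m + 1)
  have h2 := colCount_succ L p j (m + 2)
  have a0 := h.colHeight_mono hL j m
  have a1 := h.colHeight_succ_le hL j m
  have b0 := h.colHeight_mono hL j (m + 1)
  have b1 := h.colHeight_succ_le hL j (m + 1)
  simp only [BadAt, not_lt] at hb hl
  rw [show m + 1 + 1 = m + 2 from rfl] at b0 b1
  omega

/-- Column `j` contains no entry `m`, so no row satisfies `p m i ≤ j < p (m + 1) i`. -/
theorem IsGT.toggleable_last_bad (h : IsGT μ n p) (hL : ∀ i, L ≤ i → μ i = 0)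
    (hb : BadAt L ν p j m) (hl : ¬ BadAt L ν p (j + 1) m) : Toggleable j m p := by
  obtain ⟨-, h1, h2⟩ := h.last_bad hL hb hl
  intro i hlo hhi
  by_contra! hp
  rw [← h.lt_colHeight_iff hL, h1, h.lt_colHeight_iff hL] at hp
  have : p m i ≤ gtLo p m i := le_max_right _ _
  omega

/-- From level `n` on a pattern is constant, so a higher letter `m + 1` does not occur and cannot
violate the condition. Hence the toggle of a bad level never touches the shape. -/
theorem IsGT.badAt_lt (h : IsGT μ n p) (hν : Antitone ν)
    (hb : BadAt L ν p j m) : m + 2 ≤ n := by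
  by_contra! hc
  have e1 : colCount L p j (m + 2) = colCount L p j (m + 1) :=
    sum_congr rfl fun i _ => by rw [h.top _ i (by omega), h.top _ i (by omega)]
  have e2 := h.colCount_mono (L := L) j m
  have e3 := hν (Nat.le_succ m)
  simp only [BadAt] at hb
  simp only [Nat.succ_eq_add_one] at e3
  omega

theorem IsGT.not_badAt_of_le (h : IsGT μ n p) (hν : Antitone ν) (hj : μ 0 ≤ j) :
    ¬ BadAt L ν p j m := by
  have := hν (Nat.le_succ m)
  simp only [Nat.succ_eq_add_one] at this
  simp [BadAt, colCount_eq_zero_of_le h hj, this]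

/-- The weight after toggling the last bad column. -/
theorem IsGT.wt_toggle_last_bad (h : IsGT μ n p) (hL : ∀ i, L ≤ i → μ i = 0)
    (hb : BadAt L ν p j m) (hl : ¬ BadAt L ν p (j + 1) m) (hm : m + 2 ≤ n) :
    (ν m + wt L (gtToggle j m p) m + 1 = ν (m + 1) + wt L p (m + 1)) ∧
    (ν (m + 1) + wt L (gtToggle j m p) (m + 1) = ν m + wt L p m + 1) ∧
    ∀ x, x ≠ m → x ≠ m + 1 → wt L (gtToggle j m p) x = wt L p x := by
  have ht := h.toggleable_last_bad hL hb hl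
  obtain ⟨hd, -, -⟩ := h.last_bad hL hb hl
  have e := h.colCount_zero_toggle (j := j) (m := m) hL
  have hq := h.isGT_toggle ht hm
  have hne : ∀ m', m' ≠ m + 1 → colCount L (gtToggle j m p) 0 m' = colCount L p 0 m' :=
    fun m' h1 => sum_congr rfl fun i _ => by rw [gtToggle_of_ne h1]
  have a0 := h.colCount_add_wt (L := L) m
  have a1 := h.colCount_add_wt (L := L) (m + 1)
  have b0 := hq.colCount_add_wt (L := L) m
  have b1 := hq.colCount_add_wt (L := L) (m + 1)
  rw [hne m (by omega)] at b0
  rw [hne (m + 1 + 1) (by omega)] at b1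
  rw [show m + 1 + 1 = m + 2 from rfl] at a1 b1
  -- The `+ 1` is the defect of the last bad column. It is also the difference of two consecutive
  -- staircase exponents, so the shifted exponents at `m` and `m + 1` trade places.
  refine ⟨by omega, by omega, fun x h1 h2 => ?_⟩
  simp only [wt]
  rw [hne _ (by omega), hne _ (by omega)]

end bad

/-- The last bad column and the first bad level in it. -/
structure IsLastBad (L : ℕ) (ν : ℕ → ℕ) (p : ℕ → ℕ → ℕ) (j m : ℕ) : Prop where
  bad : BadAt L ν p j m
  last : ∀ j' m', j < j' → ¬ BadAt L ν p j' m'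
  first : ∀ m', m' < m → ¬ BadAt L ν p j m'

theorem IsLastBad.unique {L : ℕ} {ν : ℕ → ℕ} {p : ℕ → ℕ → ℕ} {j m j' m' : ℕ}
    (h : IsLastBad L ν p j m) (h' : IsLastBad L ν p j' m') : j = j' ∧ m = m' := by
  obtain h1 | rfl | h1 := lt_trichotomy j j'
  · exact absurd h'.bad (h.last _ _ h1)
  · obtain h2 | rfl | h2 := lt_trichotomy m m'
    · exact absurd h.bad (h'.first _ h2)
    · exact ⟨rfl, rfl⟩
    · exact absurd h'.bad (h.first _ h2)
  · exact absurd h.bad (h'.last _ _ h1)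

/-- Beyond column `μ 0` all counts vanish and the condition says that `ν` is a partition; so the bad
columns are bounded and there is a last one. -/
theorem IsGT.exists_isLastBad {μ ν : ℕ → ℕ} {n L : ℕ} {p : ℕ → ℕ → ℕ} (h : IsGT μ n p)
    (hν : Antitone ν) (hb : ¬ GoodPattern L ν p) : ∃ j m, IsLastBad L ν p j m := by
  classical
  simp only [GoodPattern, not_forall, not_le] at hb
  obtain ⟨j₀, m₀, h₀⟩ := hb
  let P : ℕ → Prop := fun j => ∃ m, BadAt L ν p j m
  have hP : ∀ j, P j → j ≤ μ 0 := by
    rintro j ⟨m, hm⟩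
    by_contra! hj
    exact h.not_badAt_of_le hν hj.le hm
  have hs := Nat.findGreatest_spec (P := P) (hP j₀ ⟨m₀, h₀⟩) ⟨m₀, h₀⟩
  refine ⟨Nat.findGreatest P (μ 0), Nat.find hs, Nat.find_spec hs, fun j' m' hj' hbad => ?_,
    fun m' hm' => Nat.find_min hs hm'⟩
  exact Nat.findGreatest_is_greatest hj' (hP j' ⟨m', hbad⟩) ⟨m', hbad⟩

/-- Badness in the columns `≥ j` is read off counts that the toggle preserves. The pattern and its
image thus select the same position, which makes the toggle at the selected position an involution.
-/
theorem IsLastBad.toggle {μ ν : ℕ → ℕ} {n L : ℕ} {p : ℕ → ℕ → ℕ} {j m : ℕ} (h : IsGT μ n p)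
    (hL : ∀ i, L ≤ i → μ i = 0) (hb : IsLastBad L ν p j m) :
    IsLastBad L ν (gtToggle j m p) j m := by
  have ht := h.toggleable_last_bad hL hb.bad (hb.last _ _ (Nat.lt_succ_self j))
  have key : ∀ j' m', j ≤ j' → (BadAt L ν (gtToggle j m p) j' m' ↔ BadAt L ν p j' m') := by
    intro j' m' hj
    simp only [BadAt, h.colCount_toggle ht hj]
  exact ⟨(key _ _ le_rfl).2 hb.bad, fun j' m' hj hx => hb.last j' m' hj ((key _ _ hj.le).1 hx),
    fun m' hm hx => hb.first m' hm ((key _ _ le_rfl).1 hx)⟩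

/-! ### Alternants -/

section alternant

variable {n : ℕ}

/-- The monomial with exponents `g`. -/
noncomputable def mono (g : Fin n → ℕ) : MvPolynomial (Fin n) ℚ :=
  MvPolynomial.monomial (Finsupp.equivFunOnFinite.symm g) 1

theorem mono_mul (g h : Fin n → ℕ) : mono g * mono h = mono (g + h) := by
  rw [mono, mono, MvPolynomial.monomial_mul, mul_one, mono]
  congr 2
  ext i
  simp

theorem coeff_mono (g h : Fin n → ℕ) :
    MvPolynomial.coeff (Finsupp.equivFunOnFinite.symm g) (mono h) = if h = g then 1 else 0 := by
  rw [mono, MvPolynomial.coeff_monomial]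
  simp

theorem rename_mono (σ : Equiv.Perm (Fin n)) (g : Fin n → ℕ) :
    MvPolynomial.rename σ (mono g) = mono (g ∘ σ.symm) := by
  rw [mono, MvPolynomial.rename_monomial, mono]
  congr 2
  ext i
  rw [show i = σ (σ.symm i) by simp, Finsupp.mapDomain_apply σ.injective]
  simp

/-- The alternant with exponents `g`. -/
noncomputable def alternant (g : Fin n → ℕ) : MvPolynomial (Fin n) ℚ :=
  ∑ σ : Equiv.Perm (Fin n), ((Equiv.Perm.sign σ : ℤ) : ℚ) • mono (g ∘ σ)

theorem alternant_comp (g : Fin n → ℕ) (τ : Equiv.Perm (Fin n)) :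
    alternant (g ∘ τ) = ((Equiv.Perm.sign τ : ℤ) : ℚ) • alternant g := by
  rw [alternant, alternant, smul_sum, ← Equiv.sum_comp (Equiv.mulLeft τ⁻¹)]
  refine sum_congr rfl fun σ _ => ?_
  simp only [Equiv.coe_mulLeft, Function.comp_assoc, ← Equiv.Perm.coe_mul, mul_inv_cancel_left,
    Equiv.Perm.sign_mul, Equiv.Perm.sign_inv, smul_smul]
  push_cast
  rfl

theorem alternant_swap (g : Fin n → ℕ) {i j : Fin n} (hij : i ≠ j) :
    alternant (g ∘ Equiv.swap i j) = -alternant g := by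
  rw [alternant_comp, Equiv.Perm.sign_swap hij]
  simp

/-- The exponents of a strictly decreasing alternant are determined by it. -/
theorem coeff_alternant {g h : Fin n → ℕ} (hg : StrictAnti g) (hh : StrictAnti h) :
    MvPolynomial.coeff (Finsupp.equivFunOnFinite.symm g) (alternant h) =
      if h = g then 1 else 0 := by
  -- A permutation carrying one strictly decreasing sequence to another is increasing, hence the
  -- identity: only the leading term of the alternant has strictly decreasing exponents.
  have key : ∀ σ : Equiv.Perm (Fin n), h ∘ σ = g → σ = 1 := by
    intro σ hσ
    have hm : StrictMono σ := by
      intro a b hab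
      have := hg hab
      rw [← hσ] at this
      exact hh.lt_iff_gt.1 this
    ext i
    have : (⟨σ, hm.monotone⟩ : Fin n →o Fin n) = OrderHom.id := by
      have h2 := Subsingleton.elim (hm.orderIsoOfSurjective σ σ.surjective) (OrderIso.refl _)
      ext i
      have h3 := congrArg (fun f : Fin n ≃o Fin n => f i) h2
      simpa using congrArg Fin.val h3
    simpa using congrArg (fun f : Fin n →o Fin n => (f i : ℕ)) this
  rw [alternant, MvPolynomial.coeff_sum, sum_eq_single (1 : Equiv.Perm (Fin n))]
  · simp [coeff_mono]
  · intro σ _ hσ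
    rw [MvPolynomial.coeff_smul, coeff_mono, if_neg fun e => hσ (key σ e), smul_zero]
  · simp

/-- The exponents of the Vandermonde determinant. -/
def staircase (n : ℕ) : Fin n → ℕ := fun i => n - 1 - i

theorem strictAnti_add_staircase {f : ℕ → ℕ} (hf : Antitone f) :
    StrictAnti ((fun i : Fin n => f i) + staircase n) := by
  intro a b hab
  have := hf (le_of_lt (show (a : ℕ) < b from hab))
  have h2 : (a : ℕ) < b := hab
  have h3 := b.2
  simp only [Pi.add_apply, staircase]
  omega

theorem alternant_staircase_ne_zero : alternant (staircase n) ≠ 0 := by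
  intro h
  have hs : StrictAnti (staircase n) := by
    have := strictAnti_add_staircase (n := n) (f := fun _ => 0) (fun _ _ _ => le_rfl)
    simpa [funext_iff, StrictAnti] using this
  have := coeff_alternant hs hs
  rw [h] at this
  simp at this

end alternant

/-! ### Young diagrams as antitone functions -/

theorem YoungDiagram.rowLen_eq_zero (μ : YoungDiagram) {i : ℕ} (hi : μ.colLen 0 ≤ i) :
    μ.rowLen i = 0 := by
  by_contra h
  have : (i, 0) ∈ μ := YoungDiagram.mem_iff_lt_rowLen.2 (Nat.pos_of_ne_zero h)
  rw [YoungDiagram.mem_iff_lt_colLen] at this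
  omega

theorem YoungDiagram.rowLen_antitone (μ : YoungDiagram) : Antitone μ.rowLen :=
  fun _ _ h => μ.rowLen_anti _ _ h

theorem YoungDiagram.rowLen_injective : Function.Injective YoungDiagram.rowLen := by
  intro μ ν h
  ext ⟨i, j⟩
  rw [YoungDiagram.mem_cells, YoungDiagram.mem_cells, YoungDiagram.mem_iff_lt_rowLen,
    YoungDiagram.mem_iff_lt_rowLen, h]

theorem YoungDiagram.exists_rowLen_eq {f : ℕ → ℕ} (hf : Antitone f) {n : ℕ} (hn : f n = 0) :
    ∃ D : YoungDiagram, D.rowLen = f := by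
  classical
  let s : Finset (ℕ × ℕ) := {c ∈ range n ×ˢ range (f 0) | c.2 < f c.1}
  have hs : ∀ c : ℕ × ℕ, c ∈ s ↔ c.2 < f c.1 := by
    rintro ⟨i, j⟩
    simp only [s, mem_filter, mem_product, mem_range, and_iff_right_iff_imp]
    intro h
    refine ⟨?_, h.trans_le (hf (Nat.zero_le i))⟩
    by_contra hi
    have := hf (not_lt.1 hi)
    omega
  refine ⟨⟨s, ?_⟩, ?_⟩
  · rintro ⟨i, j⟩ ⟨i', j'⟩ ⟨h1, h2⟩ h
    simp only [mem_coe, hs] at h ⊢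
    exact lt_of_le_of_lt h2 (h.trans_le (hf h1))
  · funext i
    refine eq_of_forall_lt_iff fun j => ?_
    rw [← YoungDiagram.mem_iff_lt_rowLen]
    exact hs (i, j)

theorem YoungDiagram.sum_cells (μ : YoungDiagram) {L : ℕ} (hL : μ.colLen 0 ≤ L)
    (f : ℕ → ℕ → ℕ) :
    ∑ c ∈ μ.cells, f c.1 c.2 = ∑ i ∈ range L, ∑ j ∈ range (μ.rowLen i), f i j := by
  rw [sum_sigma']
  refine sum_bij' (fun c _ => ⟨c.1, c.2⟩) (fun x _ => (x.1, x.2)) ?_ ?_ ?_ ?_ ?_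
  · rintro ⟨i, j⟩ h
    rw [YoungDiagram.mem_cells, YoungDiagram.mem_iff_lt_rowLen] at h
    simp only [mem_sigma, mem_range]
    refine ⟨?_, h⟩
    by_contra hi
    rw [μ.rowLen_eq_zero (hL.trans (not_lt.1 hi))] at h
    omega
  · rintro ⟨i, j⟩ h
    simp only [mem_sigma, mem_range] at h
    rw [YoungDiagram.mem_cells, YoungDiagram.mem_iff_lt_rowLen]
    exact h.2
  all_goals exact fun _ _ => rfl

theorem YoungDiagram.card_eq_sum (μ : YoungDiagram) {L : ℕ} (hL : μ.colLen 0 ≤ L) :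
    μ.card = ∑ i ∈ range L, μ.rowLen i := by
  have := μ.sum_cells hL fun _ _ => 1
  simpa using this

/-! ### Schur polynomials as sums over patterns -/

section schurPoly

/-- A pattern is determined by its levels below `n` and its rows inside the shape, where its entries
are bounded. -/
theorem finite_isGT (μ : YoungDiagram) (n : ℕ) : {p | IsGT μ.rowLen n p}.Finite := by
  let F : {p | IsGT μ.rowLen n p} → (Fin n → Fin (μ.colLen 0) → Fin (μ.rowLen 0 + 1)) :=
    fun p m i => ⟨p.1 m i, Nat.lt_succ_of_le ((p.2.le_top m i).trans
      (μ.rowLen_antitone (Nat.zero_le _)))⟩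
  have hF : Function.Injective F := by
    rintro ⟨p, hp⟩ ⟨q, hq⟩ h
    apply Subtype.ext
    funext m i
    by_cases hm : n ≤ m
    · exact (hp.top m i hm).trans (hq.top m i hm).symm
    · by_cases hi : μ.colLen 0 ≤ i
      · exact (hp.eq_zero (fun _ => μ.rowLen_eq_zero) hi).trans
          (hq.eq_zero (fun _ => μ.rowLen_eq_zero) hi).symm
      · have := congrFun (congrFun h ⟨m, not_le.1 hm⟩) ⟨i, not_le.1 hi⟩
        exact congrArg Fin.val this
  exact Set.finite_coe_iff.1 (Finite.of_injective F hF)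

/-- All patterns of shape `μ` with `n` levels. -/
noncomputable def gtPatterns (μ : YoungDiagram) (n : ℕ) : Finset (ℕ → ℕ → ℕ) :=
  (finite_isGT μ n).toFinset

theorem mem_gtPatterns {μ : YoungDiagram} {n : ℕ} {p : ℕ → ℕ → ℕ} :
    p ∈ gtPatterns μ n ↔ IsGT μ.rowLen n p := by simp [gtPatterns]

/-- The weight of a pattern of shape `μ`. -/
def YoungDiagram.gtWeight (μ : YoungDiagram) (p : ℕ → ℕ → ℕ) : ℕ → ℕ := wt (μ.colLen 0) p

/-- The Schur polynomial in `n` variables. -/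
noncomputable def schurPoly (n : ℕ) (μ : YoungDiagram) : MvPolynomial (Fin n) ℚ :=
  ∑ p ∈ gtPatterns μ n, mono fun i => μ.gtWeight p i

variable {n : ℕ}

/-- The untruncated toggle permutes the patterns and swaps two neighbouring exponents of the weight.
-/
theorem rename_schurPoly_swap (μ : YoungDiagram) (i : Fin n) :
    MvPolynomial.rename (Equiv.swap i.castSucc i.succ) (schurPoly (n + 1) μ) =
      schurPoly (n + 1) μ := by
  rw [schurPoly, map_sum]
  have hm : (i : ℕ) + 2 ≤ n + 1 := by have := i.2; omega
  refine sum_nbij' (gtToggle (μ.rowLen 0) i) (gtToggle (μ.rowLen 0) i) ?_ ?_ ?_ ?_ ?_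
  · intro p hp
    rw [mem_gtPatterns] at hp ⊢
    exact hp.isGT_toggle (hp.toggleable_of_le le_rfl) hm
  · intro p hp
    rw [mem_gtPatterns] at hp ⊢
    exact hp.isGT_toggle (hp.toggleable_of_le le_rfl) hm
  · intro p hp
    rw [mem_gtPatterns] at hp
    exact hp.toggle_toggle (hp.toggleable_of_le le_rfl)
  · intro p hp
    rw [mem_gtPatterns] at hp
    exact hp.toggle_toggle (hp.toggleable_of_le le_rfl)
  · intro p hp
    rw [mem_gtPatterns] at hp
    rw [rename_mono]
    congr 1
    funext x
    simp only [Function.comp, YoungDiagram.gtWeight]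
    rw [hp.wt_toggle (fun _ => μ.rowLen_eq_zero) le_rfl hm]
    congr 1
    rw [Equiv.symm_swap]
    have h1 : ((i.castSucc : Fin (n + 1)) : ℕ) = i := rfl
    have h2 : ((i.succ : Fin (n + 1)) : ℕ) = i + 1 := rfl
    rw [← h2, ← h1]
    rw [Equiv.swap_apply_def, Equiv.swap_apply_def]
    simp only [← Fin.ext_iff]
    split_ifs <;> rfl

theorem rename_schurPoly (μ : YoungDiagram) (σ : Equiv.Perm (Fin n)) :
    MvPolynomial.rename σ (schurPoly n μ) = schurPoly n μ := by
  cases n with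
  | zero =>
    rw [Subsingleton.elim σ 1]
    simp
  | succ n =>
    let H : Submonoid (Equiv.Perm (Fin (n + 1))) :=
      { carrier := {σ | MvPolynomial.rename σ (schurPoly (n + 1) μ) = schurPoly (n + 1) μ}
        one_mem' := by simp
        mul_mem' := by
          intro a b ha hb
          simp only [Set.mem_ofPred_eq] at ha hb ⊢
          rw [Equiv.Perm.coe_mul, ← MvPolynomial.rename_rename, hb, ha] }
    have : H = ⊤ := by
      rw [eq_top_iff, ← Equiv.Perm.mclosure_swap_castSucc_succ n, Submonoid.closure_le]
      rintro _ ⟨i, rfl⟩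
      exact rename_schurPoly_swap μ i
    have h2 : σ ∈ H := this ▸ Submonoid.mem_top σ
    exact h2

/-- In the term of the alternant indexed by `σ`, the symmetric factor is replaced by its copy
permuted in the same way; then both monomials carry the same `σ` and their exponents add. -/
theorem alternant_mul_schurPoly (g : Fin n → ℕ) (μ : YoungDiagram) :
    alternant g * schurPoly n μ =
      ∑ p ∈ gtPatterns μ n, alternant (g + fun i : Fin n => μ.gtWeight p i) := by
  simp only [alternant, sum_mul]
  rw [sum_comm]
  refine sum_congr rfl fun σ _ => ?_
  rw [← rename_schurPoly μ σ.symm, schurPoly, map_sum, smul_mul_assoc, mul_sum, smul_sum]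
  refine sum_congr rfl fun p _ => ?_
  rw [rename_mono, mono_mul]
  rfl

/-- Toggling the last bad column changes the sign of the alternant. -/
theorem alternant_toggle {μ : YoungDiagram} {ν : ℕ → ℕ} {p : ℕ → ℕ → ℕ} {j m : ℕ}
    (hg : IsGT μ.rowLen n p) (hb : IsLastBad (μ.colLen 0) ν p j m) (hm : m + 2 ≤ n) :
    alternant ((fun i : Fin n => ν i + μ.gtWeight (gtToggle j m p) i) + staircase n) =
      -alternant ((fun i : Fin n => ν i + μ.gtWeight p i) + staircase n) := by
  obtain ⟨w1, w2, w3⟩ := hg.wt_toggle_last_bad (fun _ => μ.rowLen_eq_zero) hb.bad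
    (hb.last _ _ (Nat.lt_succ_self _)) hm
  have hne : (⟨m, by omega⟩ : Fin n) ≠ ⟨m + 1, by omega⟩ := by simp
  rw [← alternant_swap _ hne]
  congr 1
  funext x
  simp only [Function.comp, Pi.add_apply, YoungDiagram.gtWeight, staircase]
  by_cases h1 : (x : ℕ) = m
  · rw [show x = ⟨m, by omega⟩ from Fin.ext h1, Equiv.swap_apply_left]
    simp only
    omega
  · by_cases h2 : (x : ℕ) = m + 1
    · rw [show x = ⟨m + 1, by omega⟩ from Fin.ext h2, Equiv.swap_apply_right]
      simp only
      omega
    · rw [Equiv.swap_apply_of_ne_of_ne (by simp [Fin.ext_iff, h1]) (by simp [Fin.ext_iff, h2]),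
        w3 _ h1 h2]

/-- The terms violating Stembridge's condition cancel. -/
theorem alternant_mul_schurPoly_eq_sum_good {ν : ℕ → ℕ} (hν : Antitone ν) (μ : YoungDiagram) :
    alternant ((fun i : Fin n => ν i) + staircase n) * schurPoly n μ =
      open Classical in
      ∑ p ∈ gtPatterns μ n with GoodPattern (μ.colLen 0) ν p,
        alternant ((fun i : Fin n => ν i + μ.gtWeight p i) + staircase n) := by
  classical
  rw [alternant_mul_schurPoly, ← sum_filter_add_sum_filter_not _ (GoodPattern (μ.colLen 0) ν)]
  have hadd : ∀ p : ℕ → ℕ → ℕ, (((fun i : Fin n => ν i) + staircase n) + fun i : Fin n =>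
      μ.gtWeight p i) = ((fun i : Fin n => ν i + μ.gtWeight p i) + staircase n) := by
    intro p
    funext i
    simp only [Pi.add_apply]
    ring
  simp only [hadd]
  convert add_zero _ using 2
  have ex : ∀ p ∈ {p ∈ gtPatterns μ n | ¬ GoodPattern (μ.colLen 0) ν p},
      ∃ jm : ℕ × ℕ, IsLastBad (μ.colLen 0) ν p jm.1 jm.2 := by
    intro p hp
    rw [mem_filter, mem_gtPatterns] at hp
    obtain ⟨j, m, h⟩ := hp.1.exists_isLastBad hν hp.2
    exact ⟨(j, m), h⟩
  choose! f hf using ex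
  have hmem : ∀ p ∈ {p ∈ gtPatterns μ n | ¬ GoodPattern (μ.colLen 0) ν p},
      IsGT μ.rowLen n p ∧ (f p).2 + 2 ≤ n ∧ Toggleable (f p).1 (f p).2 p := by
    intro p hp
    have hp' := hp
    rw [mem_filter, mem_gtPatterns] at hp
    exact ⟨hp.1, hp.1.badAt_lt hν (hf p hp').bad, hp.1.toggleable_last_bad
      (fun _ => μ.rowLen_eq_zero) (hf p hp').bad ((hf p hp').last _ _ (Nat.lt_succ_self _))⟩
  have htog : ∀ p ∈ {p ∈ gtPatterns μ n | ¬ GoodPattern (μ.colLen 0) ν p},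
      IsLastBad (μ.colLen 0) ν (gtToggle (f p).1 (f p).2 p) (f p).1 (f p).2 :=
    fun p hp => (hf p hp).toggle (hmem p hp).1 (fun _ => μ.rowLen_eq_zero)
  have hinv : ∀ p ∈ {p ∈ gtPatterns μ n | ¬ GoodPattern (μ.colLen 0) ν p},
      gtToggle (f p).1 (f p).2 p ∈ {p ∈ gtPatterns μ n | ¬ GoodPattern (μ.colLen 0) ν p} := by
    intro p hp
    rw [mem_filter, mem_gtPatterns]
    refine ⟨(hmem p hp).1.isGT_toggle (hmem p hp).2.2 (hmem p hp).2.1, fun hg => ?_⟩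
    exact absurd (hg _ _) (not_le.2 (htog p hp).bad)
  refine sum_involution (fun p _ => gtToggle (f p).1 (f p).2 p) ?_ ?_ hinv ?_
  · intro p hp
    rw [alternant_toggle (hmem p hp).1 (hf p hp) (hmem p hp).2.1, add_neg_cancel]
  · intro p hp hne heq
    have h := alternant_toggle (hmem p hp).1 (hf p hp) (hmem p hp).2.1
    -- At a fixed point the alternant equals its own negative, so the summand vanishes.
    rw [heq, self_eq_neg] at h
    exact hne h
  · intro p hp
    have hu := (hf _ (hinv p hp)).unique (htog p hp)
    simp only [hu.1, hu.2]
    exact (hmem p hp).1.toggle_toggle (hmem p hp).2.2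

end schurPoly

/-! ### The ballot condition by rows; the highest pattern -/

section ballot

variable {μ ν : ℕ → ℕ} {n L : ℕ} {p : ℕ → ℕ → ℕ}

/-- The ballot condition for the reading word, taken row by row. -/
def RowBallot (ν : ℕ → ℕ) (p : ℕ → ℕ → ℕ) : Prop :=
  ∀ i m, ν (m + 1) + ∑ x ∈ range (i + 1), (p (m + 2) x - p (m + 1) x) ≤
    ν m + ∑ x ∈ range i, (p (m + 1) x - p m x)

theorem IsGT.colCount_eq_of_le (h : IsGT μ n p) (hL : ∀ i, L ≤ i → μ i = 0) {L' : ℕ}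
    (hL' : L ≤ L') (j m : ℕ) : colCount L p j m = colCount L' p j m :=
  sum_subset (range_mono hL') fun i _ hi => by
    rw [h.eq_zero hL (not_lt.1 fun hh => hi (mem_range.2 hh)), Nat.zero_sub]

theorem IsGT.colCount_add_sum (h : IsGT μ n p) (j m : ℕ) :
    colCount L p j m + ∑ i ∈ range L, (p (m + 1) i - j - (p m i - j)) =
      colCount L p j (m + 1) := by
  simp only [colCount, ← sum_add_distrib]
  refine sum_congr rfl fun i _ => ?_
  have := h.mono m i
  omega

/-- For `j = p (m + 1) i` all entries `m + 1` of the rows `≤ i` lie in columns `≥ j`, while entries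
`m` in these columns lie in rows `< i`; so the column condition at `j` gives the row condition at
`i`. Conversely, let `j` be the last bad column and `i` the number of its entries below `m`. All
entries `m` of the rows `< i` lie in columns `≥ j`, and entries `m + 1` in these columns lie in rows
`≤ i`, so the defect contradicts the row condition at `i`. -/
theorem IsGT.goodPattern_iff (h : IsGT μ n p) (hL : ∀ i, L ≤ i → μ i = 0) (hν : Antitone ν) :
    GoodPattern L ν p ↔ RowBallot ν p := by
  constructor
  · intro hg i m
    have e := hg (p (m + 1) i) m
    set j := p (m + 1) i with hj
    -- Row `i` may lie outside the shape; enlarging the range makes it part of the sums without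
    -- changing them.
    have hle : L ≤ max L (i + 1) := le_max_left _ _
    rw [h.colCount_eq_of_le hL hle, h.colCount_eq_of_le hL hle, h.colCount_eq_of_le hL hle] at e
    have a1 := h.colCount_add_sum (L := max L (i + 1)) j m
    have a2 := h.colCount_add_sum (L := max L (i + 1)) j (m + 1)
    have b2 : ∑ x ∈ range (i + 1), (p (m + 2) x - p (m + 1) x) ≤
        ∑ x ∈ range (max L (i + 1)), (p (m + 2) x - j - (p (m + 1) x - j)) := by
      refine le_trans ?_ (sum_le_sum_of_subset (range_mono (le_max_right L (i + 1))))
      refine sum_le_sum fun x hx => ?_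
      have h1 : j ≤ p (m + 1) x := h.antitone (m + 1) (Nat.lt_succ_iff.1 (mem_range.1 hx))
      have h2 := h.mono (m + 1) x
      omega
    have b1 : ∑ x ∈ range (max L (i + 1)), (p (m + 1) x - j - (p m x - j)) ≤
        ∑ x ∈ range i, (p (m + 1) x - p m x) := by
      have hi : range i ⊆ range (max L (i + 1)) :=
        range_mono ((Nat.le_succ i).trans (le_max_right _ _))
      rw [← sum_subset hi]
      · refine sum_le_sum fun x hx => ?_
        omega
      · intro x _ hx
        have h1 : p (m + 1) x ≤ j := h.antitone (m + 1) (by simpa using hx)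
        omega
    rw [show m + 1 + 1 = m + 2 from rfl] at a2
    omega
  · intro hr
    by_contra hg
    obtain ⟨j, m, hb⟩ := h.exists_isLastBad hν hg
    obtain ⟨h0, h1, h2⟩ := h.last_bad hL hb.bad (hb.last _ _ (Nat.lt_succ_self _))
    set i := colHeight L p j m with hi
    have e := hr i m
    have hle : L ≤ max L (i + 1) := le_max_left _ _
    rw [h.colCount_eq_of_le hL hle, h.colCount_eq_of_le hL hle, h.colCount_eq_of_le hL hle] at h0
    have a1 := h.colCount_add_sum (L := max L (i + 1)) j m
    have a2 := h.colCount_add_sum (L := max L (i + 1)) j (m + 1)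
    have b2 : ∑ x ∈ range (max L (i + 1)), (p (m + 2) x - j - (p (m + 1) x - j)) ≤
        ∑ x ∈ range (i + 1), (p (m + 2) x - p (m + 1) x) := by
      rw [← sum_subset (range_mono (le_max_right L (i + 1)))]
      · refine sum_le_sum fun x _ => ?_
        omega
      · intro x _ hx
        have : ¬ x < colHeight L p j (m + 2) := by
          rw [h2]
          simpa using hx
        rw [h.lt_colHeight_iff hL] at this
        omega
    have b1 : ∑ x ∈ range i, (p (m + 1) x - p m x) ≤
        ∑ x ∈ range (max L (i + 1)), (p (m + 1) x - j - (p m x - j)) := by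
      refine le_trans ?_ (sum_le_sum_of_subset
        (range_mono ((Nat.le_succ i).trans (le_max_right L (i + 1)))))
      refine sum_le_sum fun x hx => ?_
      have : j < p m x := (h.lt_colHeight_iff hL x).1 (mem_range.1 hx)
      omega
    rw [show m + 1 + 1 = m + 2 from rfl] at a2
    omega

/-- The pattern of the tableau whose row `i` is filled with `i`. -/
def highestPattern (μ : ℕ → ℕ) : ℕ → ℕ → ℕ := fun m i => if i < m then μ i else 0

theorem isGT_highestPattern (hμ : Antitone μ) (hn : ∀ i, n ≤ i → μ i = 0) :
    IsGT μ n (highestPattern μ) := by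
  refine ⟨fun i => by simp [highestPattern], fun m i => ?_, fun m i => ?_, fun m i hm => ?_⟩
  · simp only [highestPattern]
    split_ifs <;> omega
  · have := hμ (Nat.le_succ i)
    simp only [highestPattern]
    split_ifs <;> omega
  · simp only [highestPattern]
    split_ifs with h
    · rfl
    · exact (hn i (hm.trans (not_lt.1 h))).symm

theorem highestPattern_sub (μ : ℕ → ℕ) (m i : ℕ) :
    highestPattern μ (m + 1) i - highestPattern μ m i = if i = m then μ m else 0 := by
  simp only [highestPattern]
  split_ifs <;> first | omega | (subst_vars; omega)

theorem rowBallot_highestPattern (hμ : Antitone μ) :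
    RowBallot (fun _ => 0) (highestPattern μ) := by
  intro i m
  have := hμ (Nat.le_succ m)
  simp only [highestPattern_sub, sum_ite_eq', mem_range]
  simp only [Nat.succ_eq_add_one] at this
  split_ifs <;> omega

/-- A letter greater than `i` in row `i` would need its predecessor in the rows above, which by
induction do not contain it. Interlacing excludes letters less than `i`. -/
theorem IsGT.eq_highestPattern (h : IsGT μ n p) (hr : RowBallot (fun _ => 0) p) :
    p = highestPattern μ := by
  have h1 : ∀ i m, i + 1 ≤ m → p (m + 1) i = p m i := by
    intro i
    induction i using Nat.strong_induction_on with
    | _ i ih =>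
      intro m hm
      obtain ⟨m, rfl⟩ : ∃ m', m = m' + 1 := ⟨m - 1, by omega⟩
      have e := hr i m
      have z : ∑ x ∈ range i, (p (m + 1) x - p m x) = 0 := sum_eq_zero fun x hx => by
        rw [mem_range] at hx
        rw [ih x hx m (by omega), Nat.sub_self]
      rw [z, sum_range_succ] at e
      beta_reduce at e
      have := h.mono (m + 1) i
      rw [show m + 1 + 1 = m + 2 from rfl] at this ⊢
      omega
  have h2 : ∀ m i, m ≤ i → p m i = 0 := by
    intro m
    induction m with
    | zero => exact fun i _ => h.zero i
    | succ m ih =>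
      intro i hi
      obtain ⟨i, rfl⟩ : ∃ i', i = i' + 1 := ⟨i - 1, by omega⟩
      have := h.inter m i
      have := ih i (by omega)
      omega
  have h3 : ∀ i m d, i + 1 ≤ m → p (m + d) i = p m i := by
    intro i m d hm
    induction d with
    | zero => rfl
    | succ d ih => rw [← ih, ← h1 i (m + d) (by omega)]; rfl
  funext m i
  simp only [highestPattern]
  split_ifs with hi
  · rw [← h3 i m n hi, h.top _ _ (Nat.le_add_left _ _)]
  · exact h2 m i (not_lt.1 hi)

theorem wt_highestPattern (hμ : Antitone μ) (hL : ∀ i, L ≤ i → μ i = 0) (m : ℕ) :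
    wt L (highestPattern μ) m = μ m := by
  have h := isGT_highestPattern hμ hL
  have e := h.colCount_add_sum (L := L) 0 m
  have e2 := h.colCount_add_wt (L := L) m
  simp only [Nat.sub_zero, highestPattern_sub, sum_ite_eq', mem_range] at e
  split_ifs at e with hm
  · omega
  · have := hL m (not_lt.1 hm)
    omega

end ballot

/-! ### Products of Schur polynomials -/

section product

variable {n : ℕ}

/-- The bialternant formula: for `ν = 0` the only surviving pattern is the highest one, of weight
`μ`. -/
theorem alternant_staircase_mul_schurPoly (μ : YoungDiagram) (hn : μ.colLen 0 ≤ n) :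
    alternant (staircase n) * schurPoly n μ =
      alternant ((fun i : Fin n => μ.rowLen i) + staircase n) := by
  classical
  have h := alternant_mul_schurPoly_eq_sum_good (n := n) (ν := fun _ => 0)
    (fun _ _ _ => le_rfl) μ
  have h0 : (fun _ : Fin n => 0) + staircase n = staircase n := by
    funext i
    simp
  rw [h0] at h
  rw [h, sum_eq_single (highestPattern μ.rowLen)]
  · simp only [YoungDiagram.gtWeight]
    congr 2
    funext i
    rw [wt_highestPattern μ.rowLen_antitone (fun _ => μ.rowLen_eq_zero), zero_add]
  · intro p hp hne
    rw [mem_filter, mem_gtPatterns] at hp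
    exact absurd (hp.1.eq_highestPattern
      ((hp.1.goodPattern_iff (fun _ => μ.rowLen_eq_zero) (fun _ _ _ => le_rfl)).1 hp.2)) hne
  · intro hne
    have hg := isGT_highestPattern (n := n) μ.rowLen_antitone
      (fun i hi => μ.rowLen_eq_zero (hn.trans hi))
    refine absurd ?_ hne
    rw [mem_filter, mem_gtPatterns]
    exact ⟨hg, (hg.goodPattern_iff (fun _ => μ.rowLen_eq_zero) (fun _ _ _ => le_rfl)).2
      (rowBallot_highestPattern μ.rowLen_antitone)⟩

open Classical in
/-- The diagram with row lengths `f`, if there is one. -/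
noncomputable def diagramOf (f : ℕ → ℕ) : YoungDiagram :=
  if h : ∃ D : YoungDiagram, D.rowLen = f then h.choose else ⊥

theorem rowLen_diagramOf {f : ℕ → ℕ} (hf : Antitone f) (hn : f n = 0) :
    (diagramOf f).rowLen = f := by
  have h := YoungDiagram.exists_rowLen_eq hf hn
  rw [diagramOf, dif_pos h]
  exact h.choose_spec

/-- This is the condition at column 0. -/
theorem GoodPattern.antitone {L : ℕ} {μ ν : ℕ → ℕ} {p : ℕ → ℕ → ℕ} (hg : GoodPattern L ν p)
    (h : IsGT μ n p) : Antitone fun m => ν m + wt L p m := by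
  refine antitone_nat_of_succ_le fun m => ?_
  have e := hg 0 m
  have a0 := h.colCount_add_wt (L := L) m
  have a1 := h.colCount_add_wt (L := L) (m + 1)
  rw [show m + 1 + 1 = m + 2 from rfl] at a1
  omega

theorem IsGT.wt_eq_zero {L : ℕ} {μ : ℕ → ℕ} {p : ℕ → ℕ → ℕ} (h : IsGT μ n p) {m : ℕ}
    (hm : n ≤ m) : wt L p m = 0 := by
  simp only [wt, colCount, h.top m _ hm, h.top (m + 1) _ (hm.trans (Nat.le_succ m)), Nat.sub_self]

theorem YoungDiagram.colLen_le {μ : YoungDiagram} (h : μ.rowLen n = 0) : μ.colLen 0 ≤ n := by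
  by_contra! hc
  rw [← YoungDiagram.mem_iff_lt_colLen, YoungDiagram.mem_iff_lt_rowLen] at hc
  omega

/-- The diagram obtained from `ν` by adding the weight of a pattern of shape `μ`. -/
noncomputable def addWeight (ν μ : YoungDiagram) (p : ℕ → ℕ → ℕ) : YoungDiagram :=
  diagramOf fun m => ν.rowLen m + μ.gtWeight p m

theorem rowLen_addWeight {ν μ : YoungDiagram} {p : ℕ → ℕ → ℕ} (h : IsGT μ.rowLen n p)
    (hg : GoodPattern (μ.colLen 0) ν.rowLen p) (hn : ν.colLen 0 ≤ n) :
    (addWeight ν μ p).rowLen = fun m => ν.rowLen m + μ.gtWeight p m :=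
  rowLen_diagramOf (n := n) (hg.antitone h) (by
    simp [YoungDiagram.gtWeight, h.wt_eq_zero le_rfl, ν.rowLen_eq_zero hn])

/-- Multiplied by the Vandermonde alternant, the first factor becomes the alternant of `ν + ρ`, the
second spreads it over the good patterns, and each summand is again the Vandermonde alternant times
a Schur polynomial. The nonzero common factor cancels. -/
theorem schurPoly_mul (ν μ : YoungDiagram) (hn : ν.colLen 0 ≤ n) :
    schurPoly n ν * schurPoly n μ =
      open Classical in
      ∑ p ∈ gtPatterns μ n with GoodPattern (μ.colLen 0) ν.rowLen p,
        schurPoly n (addWeight ν μ p) := by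
  classical
  apply mul_left_cancel₀ (alternant_staircase_ne_zero (n := n))
  rw [← mul_assoc, alternant_staircase_mul_schurPoly ν hn,
    alternant_mul_schurPoly_eq_sum_good ν.rowLen_antitone, mul_sum]
  refine sum_congr rfl fun p hp => ?_
  rw [mem_filter, mem_gtPatterns] at hp
  have h := rowLen_addWeight hp.1 hp.2 hn
  rw [alternant_staircase_mul_schurPoly, h]
  apply YoungDiagram.colLen_le
  simp [h, YoungDiagram.gtWeight, hp.1.wt_eq_zero le_rfl, ν.rowLen_eq_zero hn]

/-- Linear independence of Schur polynomials. -/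
theorem eq_of_sum_schurPoly_eq {c c' : YoungDiagram →₀ ℕ}
    (hc : ∀ D ∈ c.support, D.colLen 0 ≤ n) (hc' : ∀ D ∈ c'.support, D.colLen 0 ≤ n)
    (h : (c.sum fun D m => m • schurPoly n D) = c'.sum fun D m => m • schurPoly n D) :
    c = c' := by
  classical
  -- The Vandermonde alternant turns Schur polynomials into alternants, and the coefficient at the
  -- leading exponents of `D` isolates `c D`.
  have key : ∀ (c : YoungDiagram →₀ ℕ), (∀ D ∈ c.support, D.colLen 0 ≤ n) →
      ∀ D : YoungDiagram, D.colLen 0 ≤ n →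
      MvPolynomial.coeff (Finsupp.equivFunOnFinite.symm
        ((fun i : Fin n => D.rowLen i) + staircase n))
        (alternant (staircase n) * c.sum fun D m => m • schurPoly n D) = c D := by
    intro c hc D hD
    rw [Finsupp.sum, mul_sum, MvPolynomial.coeff_sum]
    have : ∀ E ∈ c.support, MvPolynomial.coeff (Finsupp.equivFunOnFinite.symm
        ((fun i : Fin n => D.rowLen i) + staircase n))
        (alternant (staircase n) * c E • schurPoly n E) = if E = D then (c E : ℚ) else 0 := by
      intro E hE
      rw [mul_smul_comm, alternant_staircase_mul_schurPoly E (hc E hE), MvPolynomial.coeff_smul,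
        coeff_alternant (strictAnti_add_staircase D.rowLen_antitone)
          (strictAnti_add_staircase E.rowLen_antitone)]
      by_cases hED : E = D
      · simp [hED]
      · rw [if_neg, if_neg hED, smul_zero]
        intro heq
        apply hED
        apply YoungDiagram.rowLen_injective
        funext i
        by_cases hi : i < n
        · have := congrFun heq ⟨i, hi⟩
          simpa using this
        · rw [E.rowLen_eq_zero ((hc E hE).trans (not_lt.1 hi)),
            D.rowLen_eq_zero (hD.trans (not_lt.1 hi))]
    rw [sum_congr rfl this, sum_ite_eq']
    split_ifs with hs
    · rfl
    · rw [Finsupp.notMem_support_iff.1 hs, Nat.cast_zero]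
  ext D
  by_cases hD : D.colLen 0 ≤ n
  · have h1 := key c hc D hD
    rw [h, key c' hc' D hD] at h1
    exact_mod_cast h1.symm
  · rw [Finsupp.notMem_support_iff.1 fun hs => hD (hc D hs),
      Finsupp.notMem_support_iff.1 fun hs => hD (hc' D hs)]

end product

/-! ### Tableaux and patterns -/

section tableaux

variable {μ : YoungDiagram} {n : ℕ}

/-- The pattern of a tableau. -/
def gtOfTableau (T : SemistandardYoungTableau μ) : ℕ → ℕ → ℕ :=
  fun m i => #{j ∈ range (μ.rowLen i) | T i j < m}

/-- Rows increase weakly, so the cells with entry less than `m` form an initial segment of the row.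
-/
theorem lt_gtOfTableau (T : SemistandardYoungTableau μ) (m i j : ℕ) :
    j < gtOfTableau T m i ↔ j < μ.rowLen i ∧ T i j < m := by
  classical
  have hex : ∃ N, ¬ (N < μ.rowLen i ∧ T i N < m) := ⟨μ.rowLen i, fun h => lt_irrefl _ h.1⟩
  have hN : ∀ x, x < Nat.find hex ↔ x < μ.rowLen i ∧ T i x < m := by
    intro x
    rw [Nat.lt_find_iff]
    constructor
    · intro h
      exact not_not.1 (h x le_rfl)
    · intro h y hy
      refine not_not.2 ⟨hy.trans_lt h.1, lt_of_le_of_lt ?_ h.2⟩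
      exact T.row_weak_of_le hy (YoungDiagram.mem_iff_lt_rowLen.2 h.1)
  have : ({j ∈ range (μ.rowLen i) | T i j < m} : Finset ℕ) = range (Nat.find hex) := by
    ext x
    rw [mem_filter, mem_range, mem_range, hN]
  rw [gtOfTableau, this, card_range, hN]

theorem isGT_gtOfTableau (T : SemistandardYoungTableau μ)
    (hT : ∀ i j, (i, j) ∈ μ → T i j < n) : IsGT μ.rowLen n (gtOfTableau T) := by
  refine ⟨fun i => ?_, fun m i => ?_, fun m i => ?_, fun m i hm => ?_⟩
  · simp [gtOfTableau]
  · refine le_of_forall_lt fun j hj => ?_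
    rw [lt_gtOfTableau] at hj ⊢
    exact ⟨hj.1, hj.2.trans (Nat.lt_succ_self m)⟩
  · refine le_of_forall_lt fun j hj => ?_
    rw [lt_gtOfTableau] at hj ⊢
    have := T.col_strict (Nat.lt_succ_self i) (YoungDiagram.mem_iff_lt_rowLen.2 hj.1)
    simp only [Nat.succ_eq_add_one] at this
    exact ⟨hj.1.trans_le (μ.rowLen_anti _ _ (Nat.le_succ i)), by omega⟩
  · refine eq_of_forall_lt_iff fun j => ?_
    rw [lt_gtOfTableau, and_iff_left_iff_imp]
    exact fun hj => (hT i j (YoungDiagram.mem_iff_lt_rowLen.2 hj)).trans_le hm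

theorem gtOfTableau_injective : Function.Injective (gtOfTableau (μ := μ)) := by
  intro T T' h
  ext i j
  by_cases hj : j < μ.rowLen i
  · refine eq_of_forall_gt_iff fun m => ?_
    have h1 := lt_gtOfTableau T m i j
    have h2 := lt_gtOfTableau T' m i j
    rw [h, h2] at h1
    simpa [hj] using h1.symm
  · have : (i, j) ∉ μ := fun hc => hj (YoungDiagram.mem_iff_lt_rowLen.1 hc)
    rw [T.zeros this, T'.zeros this]

/-- The entry of a cell is the least `m` such that level `m + 1` covers it. Antitone levels and
interlacing then give strict columns. -/
theorem exists_gtOfTableau_eq {p : ℕ → ℕ → ℕ} (h : IsGT μ.rowLen n p) :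
    ∃ T : SemistandardYoungTableau μ, gtOfTableau T = p ∧ ∀ i j, (i, j) ∈ μ → T i j < n := by
  classical
  have hex : ∀ i j, j < μ.rowLen i → ∃ m, j < p (m + 1) i := fun i j hj =>
    ⟨n, by rwa [h.top _ _ (Nat.le_succ n)]⟩
  let e : ℕ → ℕ → ℕ := fun i j => if hj : j < μ.rowLen i then Nat.find (hex i j hj) else 0
  have he : ∀ i j, j < μ.rowLen i → ∀ m, e i j < m ↔ j < p m i := by
    intro i j hj m
    simp only [e, dif_pos hj, Nat.find_lt_iff]
    constructor
    · rintro ⟨x, hx, hp⟩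
      exact hp.trans_le (h.monotone i hx)
    · intro hp
      cases m with
      | zero => rw [h.zero] at hp; omega
      | succ m => exact ⟨m, Nat.lt_succ_self m, hp⟩
  let T : SemistandardYoungTableau μ :=
    { entry := e
      row_weak' := by
        intro i j1 j2 hj hc
        rw [YoungDiagram.mem_iff_lt_rowLen] at hc
        refine le_of_forall_gt fun m hm => ?_
        rw [he i j2 hc] at hm
        rw [he i j1 (hj.trans hc)]
        exact hj.trans hm
      col_strict' := by
        intro i1 i2 j hi hc
        rw [YoungDiagram.mem_iff_lt_rowLen] at hc
        have hc1 : j < μ.rowLen i1 := hc.trans_le (μ.rowLen_anti _ _ hi.le)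
        rw [he i1 j hc1]
        have h2 : j < p (e i2 j + 1) i2 := (he i2 j hc _).1 (Nat.lt_succ_self _)
        exact (h2.trans_le (h.antitone _ hi)).trans_le (h.inter _ _)
      zeros' := by
        intro i j hc
        rw [YoungDiagram.mem_iff_lt_rowLen] at hc
        simp [e, hc] }
  refine ⟨T, ?_, fun i j hc => ?_⟩
  · funext m i
    refine eq_of_forall_lt_iff fun j => ?_
    rw [lt_gtOfTableau]
    constructor
    · rintro ⟨h1, h2⟩
      exact (he i j h1 m).1 h2
    · intro hp
      have h1 := hp.trans_le (h.le_top m i)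
      exact ⟨h1, (he i j h1 m).2 hp⟩
  · rw [YoungDiagram.mem_iff_lt_rowLen] at hc
    exact (he i j hc n).2 (by rwa [h.top _ _ le_rfl])

theorem ssytWeight_apply (T : SemistandardYoungTableau μ) (m : ℕ) :
    ssytWeight T m = #{c ∈ μ.cells | T c.1 c.2 = m} := by
  simp [ssytWeight, Finsupp.finsetSum_apply, Finsupp.single_apply]

theorem gtWeight_gtOfTableau (T : SemistandardYoungTableau μ) (m : ℕ) :
    μ.gtWeight (gtOfTableau T) m = ssytWeight T m := by
  have h : ∀ m, colCount (μ.colLen 0) (gtOfTableau T) 0 m = #{c ∈ μ.cells | T c.1 c.2 < m} := by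
    intro m
    rw [card_filter, μ.sum_cells le_rfl (fun i j => if T i j < m then 1 else 0)]
    simp [colCount, gtOfTableau]
  rw [YoungDiagram.gtWeight, wt, h, h, ssytWeight_apply]
  have : #{c ∈ μ.cells | T c.1 c.2 < m + 1} =
      #{c ∈ μ.cells | T c.1 c.2 < m} + #{c ∈ μ.cells | T c.1 c.2 = m} := by
    simp only [card_filter, ← sum_add_distrib]
    refine sum_congr rfl fun c _ => ?_
    split_ifs <;> omega
  omega

/-- Setting all but the first `n` variables to zero turns Schur functions into Schur
polynomials. -/
theorem killCompl_schur (μ : YoungDiagram) (n : ℕ) :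
    MvPowerSeries.killCompl (R := ℚ) (Fin.valEmbedding (n := n)) (schur μ) =
      (schurPoly n μ : MvPowerSeries (Fin n) ℚ) := by
  classical
  ext α
  rw [MvPowerSeries.coeff_killCompl, MvPolynomial.coeff_coe, schurPoly, MvPolynomial.coeff_sum]
  obtain ⟨g, rfl⟩ := Finsupp.equivFunOnFinite.symm.surjective α
  simp only [coeff_mono]
  rw [← natCast_card_filter]
  change ((Nat.card _ : ℕ) : ℚ) = _
  congr 1
  rw [← Nat.card_eq_finsetCard]
  have hval : ∀ i : Fin n, (Finsupp.embDomain Fin.valEmbedding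
      (Finsupp.equivFunOnFinite.symm g)) (i : ℕ) = g i := by
    intro i
    have := Finsupp.embDomain_apply_self (Fin.valEmbedding (n := n))
      (Finsupp.equivFunOnFinite.symm g) i
    simpa using this
  have hout : ∀ i : ℕ, n ≤ i → (Finsupp.embDomain (Fin.valEmbedding (n := n))
      (Finsupp.equivFunOnFinite.symm g)) i = 0 := by
    intro i hi
    apply Finsupp.embDomain_of_notMem_range
    rintro ⟨x, hx⟩
    have := x.2
    simp at hx
    omega
  have hlt : ∀ T : SemistandardYoungTableau μ, ssytWeight T = Finsupp.embDomain Fin.valEmbedding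
      (Finsupp.equivFunOnFinite.symm g) → ∀ i j, (i, j) ∈ μ → T i j < n := by
    intro T hT i j hc
    by_contra! hn
    have h1 := hout _ hn
    rw [← hT, ssytWeight_apply, card_eq_zero, filter_eq_empty_iff] at h1
    exact h1 ((YoungDiagram.mem_cells (i, j)).2 hc) rfl
  refine Nat.card_congr (Equiv.ofBijective (fun T => ⟨gtOfTableau T.1, ?_⟩) ⟨?_, ?_⟩)
  · rw [mem_filter, mem_gtPatterns]
    refine ⟨isGT_gtOfTableau _ (hlt T.1 T.2), ?_⟩
    funext i
    rw [gtWeight_gtOfTableau, T.2, hval]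
  · intro T T' h
    exact Subtype.ext (gtOfTableau_injective (congrArg Subtype.val h))
  · rintro ⟨p, hp⟩
    rw [mem_filter, mem_gtPatterns] at hp
    obtain ⟨T, rfl, hT⟩ := exists_gtOfTableau_eq hp.1
    refine ⟨⟨T, ?_⟩, rfl⟩
    ext i
    by_cases hi : i < n
    · rw [← gtWeight_gtOfTableau]
      exact (congrFun hp.2 ⟨i, hi⟩).trans (hval ⟨i, hi⟩).symm
    · rw [hout i (not_lt.1 hi), ssytWeight_apply, card_eq_zero, filter_eq_empty_iff]
      rintro ⟨a, b⟩ hc heq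
      have := hT a b ((YoungDiagram.mem_cells (a, b)).1 hc)
      simp only at heq
      omega

end tableaux

/-! ### The Littlewood-Richardson rule -/

/-- A monomial involves finitely many variables, so its coefficient is still visible once `n` is
large. -/
theorem MvPowerSeries.eq_of_killCompl_eq {f g : MvPowerSeries ℕ ℚ} (N : ℕ)
    (h : ∀ n, N ≤ n → killCompl (R := ℚ) (Fin.valEmbedding (n := n)) f =
      killCompl (R := ℚ) (Fin.valEmbedding (n := n)) g) : f = g := by
  ext α
  obtain ⟨n, hn, hα⟩ : ∃ n, N ≤ n ∧ ∀ i ∈ α.support, i < n :=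
    ⟨max N (α.support.sup id + 1), le_max_left _ _, fun i hi =>
      lt_of_lt_of_le (Nat.lt_succ_of_le (Finset.le_sup (f := id) hi)) (le_max_right _ _)⟩
  have : α = Finsupp.embDomain (Fin.valEmbedding (n := n))
      (Finsupp.equivFunOnFinite.symm fun i => α i) := by
    ext i
    by_cases hi : i < n
    · have := Finsupp.embDomain_apply_self (Fin.valEmbedding (n := n))
        (Finsupp.equivFunOnFinite.symm fun i : Fin n => α i) ⟨i, hi⟩
      simpa using this.symm
    · rw [Finsupp.embDomain_of_notMem_range]
      · by_contra h0
        exact hi (hα i (Finsupp.mem_support_iff.2 h0))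
      · rintro ⟨x, hx⟩
        have := x.2
        simp at hx
        omega
  have h2 := congrArg (MvPowerSeries.coeff (Finsupp.equivFunOnFinite.symm fun i : Fin n => α i))
    (h n hn)
  rwa [MvPowerSeries.coeff_killCompl, MvPowerSeries.coeff_killCompl, ← this] at h2

theorem killCompl_sum_schur (c : YoungDiagram →₀ ℕ) (n : ℕ) :
    MvPowerSeries.killCompl (R := ℚ) (Fin.valEmbedding (n := n)) (c.sum fun D m => m • schur D) =
      ((c.sum fun D m => m • schurPoly n D : MvPolynomial (Fin n) ℚ) :
        MvPowerSeries (Fin n) ℚ) := by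
  rw [Finsupp.sum, Finsupp.sum, map_sum, ← MvPolynomial.coeToMvPowerSeries.ringHom_apply, map_sum]
  refine sum_congr rfl fun D _ => ?_
  rw [map_nsmul, map_nsmul, killCompl_schur]
  rfl

theorem schurExpansion_unique {c c' : YoungDiagram →₀ ℕ}
    (h : (c.sum fun D m => m • schur D) = c'.sum fun D m => m • schur D) : c = c' := by
  let n := max (c.support.sup fun D => D.colLen 0) (c'.support.sup fun D => D.colLen 0)
  refine eq_of_sum_schurPoly_eq (n := n) (fun D hD => ?_) (fun D hD => ?_) ?_
  · exact (Finset.le_sup (f := fun D : YoungDiagram => D.colLen 0) hD).trans (le_max_left _ _)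
  · exact (Finset.le_sup (f := fun D : YoungDiagram => D.colLen 0) hD).trans (le_max_right _ _)
  · have := congrArg (MvPowerSeries.killCompl (R := ℚ) (Fin.valEmbedding (n := n))) h
    rw [killCompl_sum_schur, killCompl_sum_schur] at this
    exact MvPolynomial.coe_injective _ _ this

theorem YoungDiagram.colLen_le_card (μ : YoungDiagram) : μ.colLen 0 ≤ μ.card := by
  rw [YoungDiagram.colLen_eq_card]
  exact card_le_card (filter_subset _ _)

theorem sum_wt {μ : YoungDiagram} {n : ℕ} {p : ℕ → ℕ → ℕ} (h : IsGT μ.rowLen n p) (m : ℕ) :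
    ∑ x ∈ range m, μ.gtWeight p x = colCount (μ.colLen 0) p 0 m := by
  induction m with
  | zero => simp [colCount, h.zero]
  | succ m ih => rw [sum_range_succ, ih, YoungDiagram.gtWeight, h.colCount_add_wt]

/-- The patterns counted by the Littlewood-Richardson rule. -/
noncomputable def lrPatterns (ν μ : YoungDiagram) : Finset (ℕ → ℕ → ℕ) :=
  open Classical in
  {p ∈ gtPatterns μ (ν.card + μ.card) | GoodPattern (μ.colLen 0) ν.rowLen p}

/-- The number of levels becomes immaterial: `ν` plus the weight is a partition of `|ν| + |μ|`, so
it has no part at or beyond this index, and the pattern is constant from this level on. -/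
theorem mem_lrPatterns {ν μ : YoungDiagram} {p : ℕ → ℕ → ℕ} {n : ℕ} (hn : ν.card + μ.card ≤ n) :
    p ∈ lrPatterns ν μ ↔ IsGT μ.rowLen n p ∧ GoodPattern (μ.colLen 0) ν.rowLen p := by
  classical
  rw [lrPatterns, mem_filter, mem_gtPatterns]
  refine ⟨fun h => ⟨h.1.levels_mono hn, h.2⟩, fun h => ⟨?_, h.2⟩⟩
  obtain ⟨h, hg⟩ := h
  have ha := hg.antitone h
  set N := ν.card + μ.card with hN
  have hw : ∀ m, N ≤ m → ν.rowLen m + μ.gtWeight p m = 0 := by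
    intro m hm
    by_contra h0
    have hmn : m < n := by
      by_contra hc
      rw [YoungDiagram.gtWeight, h.wt_eq_zero (not_lt.1 hc), ν.rowLen_eq_zero] at h0
      · exact h0 rfl
      · have := ν.colLen_le_card
        omega
    have h1 : ∑ x ∈ range n, (ν.rowLen x + μ.gtWeight p x) = N := by
      rw [sum_add_distrib, ← ν.card_eq_sum (by have := ν.colLen_le_card; omega), sum_wt h,
        hN, μ.card_eq_sum le_rfl]
      simp [colCount, h.top n _ le_rfl]
    -- If part `m` were positive, so would be all parts before it, and `m + 1 > N` positive parts
    -- exceed the total `N`.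
    have h2 : ∑ x ∈ range (m + 1), 1 ≤ ∑ x ∈ range n, (ν.rowLen x + μ.gtWeight p x) := by
      refine le_trans (sum_le_sum fun x hx => ?_)
        (sum_le_sum_of_subset (range_mono (Nat.succ_le_of_lt hmn)))
      have : ν.rowLen m + μ.gtWeight p m ≤ ν.rowLen x + μ.gtWeight p x :=
        ha (Nat.lt_succ_iff.1 (mem_range.1 hx))
      omega
    rw [h1] at h2
    simp at h2
    omega
  have hstep : ∀ m i, N ≤ m → p (m + 1) i = p m i := by
    intro m i hm
    by_cases hi : i < μ.colLen 0
    · have e := h.colCount_add_wt (L := μ.colLen 0) m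
      have := hw m hm
      rw [YoungDiagram.gtWeight] at this
      rw [show wt (μ.colLen 0) p m = 0 by omega, add_zero] at e
      have := (sum_eq_sum_iff_of_le (fun i _ => Nat.sub_le_sub_right (h.mono m i) 0)).1 e i
        (mem_range.2 hi)
      simpa using this.symm
    · rw [h.eq_zero (fun _ => μ.rowLen_eq_zero) (not_lt.1 hi),
        h.eq_zero (fun _ => μ.rowLen_eq_zero) (not_lt.1 hi)]
  refine ⟨h.zero, h.mono, h.inter, fun m i hm => ?_⟩
  have : ∀ d, p (m + d) i = p m i := by
    intro d
    induction d with
    | zero => rfl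
    | succ d ih => rw [← ih, ← hstep (m + d) i (by omega)]; rfl
  rw [← this n, h.top _ _ (Nat.le_add_left _ _)]

/-- The expansion of a product of two Schur functions. -/
noncomputable def lrExpansion (ν μ : YoungDiagram) : YoungDiagram →₀ ℕ :=
  ∑ p ∈ lrPatterns ν μ, Finsupp.single (addWeight ν μ p) 1

theorem isSchurExpansion_lrExpansion (ν μ : YoungDiagram) :
    IsSchurExpansion (schur ν * schur μ) (lrExpansion ν μ) := by
  classical
  refine MvPowerSeries.eq_of_killCompl_eq (ν.card + μ.card) fun n hn => ?_
  have hν : ν.colLen 0 ≤ n := by have := ν.colLen_le_card; omega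
  rw [map_mul, killCompl_schur, killCompl_schur, killCompl_sum_schur, ← MvPolynomial.coe_mul,
    schurPoly_mul ν μ hν, lrExpansion, ← Finsupp.sum_finsetSum_index]
  · congr 1
    refine sum_congr ?_ fun p _ => ?_
    · ext p
      rw [mem_filter, mem_gtPatterns, mem_lrPatterns hn]
    · rw [Finsupp.sum_single_index] <;> simp
  · simp
  · intro D a b
    exact add_smul _ _ _

theorem existsUnique_schurExpansion (μ ν : YoungDiagram) :
    ∃! c : YoungDiagram →₀ ℕ, IsSchurExpansion (schur μ * schur ν) c :=
  ⟨_, isSchurExpansion_lrExpansion μ ν, fun _ hc =>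
    schurExpansion_unique (hc.symm.trans (isSchurExpansion_lrExpansion μ ν))⟩

/-- The Littlewood-Richardson rule. -/
theorem lrCoeff_eq_card (lam μ ν : YoungDiagram) :
    lrCoeff lam μ ν = Set.ncard {p | IsGT μ.rowLen (ν.card + μ.card) p ∧
      GoodPattern (μ.colLen 0) ν.rowLen p ∧
      ∀ m, ν.rowLen m + μ.gtWeight p m = lam.rowLen m} := by
  classical
  have h : ∃ c, IsSchurExpansion (schur μ * schur ν) c := by
    -- The factors are exchanged so that the patterns have the shape `μ`, of size `k`, and start
    -- from `ν`.
    rw [mul_comm]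
    exact ⟨_, isSchurExpansion_lrExpansion ν μ⟩
  have h2 : h.choose = lrExpansion ν μ := by
    apply schurExpansion_unique
    rw [← h.choose_spec, mul_comm]
    exact isSchurExpansion_lrExpansion ν μ
  rw [lrCoeff, dif_pos h, h2, lrExpansion, Finsupp.finsetSum_apply]
  simp only [Finsupp.single_apply]
  rw [← card_filter, ← Set.ncard_coe_finset]
  congr 1
  ext p
  simp only [coe_filter, Set.mem_ofPred_eq]
  rw [mem_lrPatterns le_rfl, and_assoc]
  refine and_congr_right fun hp => and_congr_right fun hg => ?_
  have hr := rowLen_addWeight hp hg (by have := ν.colLen_le_card; omega)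
  rw [← YoungDiagram.rowLen_injective.eq_iff, hr, funext_iff]

/-! ### Littlewood-Richardson matrices -/

/-- Partial row sums. -/
def rowSum (a : ℕ → ℕ → ℕ) (i m : ℕ) : ℕ := ∑ x ∈ range m, a i x

/-- Partial column sums. -/
def colSum (a : ℕ → ℕ → ℕ) (i m : ℕ) : ℕ := ∑ x ∈ range i, a x m

/-- Partial sums of the previous column. -/
def prevColSum (a : ℕ → ℕ → ℕ) (i : ℕ) : ℕ → ℕ
  | 0 => 0
  | m + 1 => colSum a i m

/-- Matrices counting the entries `m` in row `i` of the tableaux of shape `μ` counted by the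
Littlewood-Richardson rule. -/
structure LRMat (l r : ℕ) (μ g d : ℕ → ℕ) (a : ℕ → ℕ → ℕ) : Prop where
  row_supp : ∀ i m, l ≤ i → a i m = 0
  col_supp : ∀ i m, r ≤ m → a i m = 0
  row : ∀ i, i < l → rowSum a i r = μ i
  col : ∀ m, m < r → colSum a l m ≤ d m
  strict : ∀ i m, m < r → rowSum a (i + 1) (m + 1) ≤ rowSum a i m
  ballot : ∀ i m, m < r → colSum a (i + 1) m ≤ g m + prevColSum a i m

theorem rowSum_succ (a : ℕ → ℕ → ℕ) (i m : ℕ) : rowSum a i (m + 1) = rowSum a i m + a i m :=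
  sum_range_succ _ _

theorem colSum_succ (a : ℕ → ℕ → ℕ) (i m : ℕ) : colSum a (i + 1) m = colSum a i m + a i m :=
  sum_range_succ _ _

theorem rowSum_zero (a : ℕ → ℕ → ℕ) (i : ℕ) : rowSum a i 0 = 0 := rfl

theorem rowSum_mono (a : ℕ → ℕ → ℕ) (i : ℕ) : Monotone (rowSum a i) :=
  monotone_nat_of_le_succ fun m => by rw [rowSum_succ]; exact Nat.le_add_right _ _

theorem colSum_mono (a : ℕ → ℕ → ℕ) (m : ℕ) : Monotone fun i => colSum a i m :=
  monotone_nat_of_le_succ fun i => by rw [colSum_succ]; exact Nat.le_add_right _ _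

theorem rowSum_eq_of_le {a : ℕ → ℕ → ℕ} {i r m : ℕ} (h : ∀ x, r ≤ x → a i x = 0) (hm : r ≤ m) :
    rowSum a i m = rowSum a i r :=
  (sum_subset (range_mono hm) fun x _ hx => h x (by simpa using hx)).symm

theorem colSum_eq_of_le {a : ℕ → ℕ → ℕ} {m l i : ℕ} (h : ∀ x, l ≤ x → a x m = 0) (hi : l ≤ i) :
    colSum a i m = colSum a l m :=
  (sum_subset (range_mono hi) fun x _ hx => h x (by simpa using hx)).symm

theorem colSum_le_of_supp {a : ℕ → ℕ → ℕ} {l : ℕ} (h : ∀ i m, l ≤ i → a i m = 0) (i m : ℕ) :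
    colSum a i m ≤ colSum a l m := by
  rcases le_total i l with hi | hi
  · exact colSum_mono a m hi
  · exact (colSum_eq_of_le (fun x hx => h x m hx) hi).le

namespace LRMat

variable {l r : ℕ} {μ g d : ℕ → ℕ} {a : ℕ → ℕ → ℕ}

theorem colSum_le (h : LRMat l r μ g d a) (i : ℕ) {m : ℕ} (hm : m < r) : colSum a i m ≤ d m :=
  (colSum_le_of_supp h.row_supp i m).trans (h.col m hm)

theorem rowSum_eq (h : LRMat l r μ g d a) {i m : ℕ} (hm : r ≤ m) :
    rowSum a i m = rowSum a i r :=
  rowSum_eq_of_le (h.col_supp i) hm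

theorem strict' (h : LRMat l r μ g d a) (i m : ℕ) : rowSum a (i + 1) (m + 1) ≤ rowSum a i m := by
  rcases lt_or_ge m r with hm | hm
  · exact h.strict i m hm
  · rw [h.rowSum_eq (hm.trans (Nat.le_succ m)), h.rowSum_eq hm]
    cases r with
    | zero => exact le_rfl
    | succ r => exact (h.strict i r (Nat.lt_succ_self r)).trans (rowSum_mono a i (Nat.le_succ r))

end LRMat

theorem finite_lrMat (l r : ℕ) (μ g d : ℕ → ℕ) : {a | LRMat l r μ g d a}.Finite := by
  let F : {a | LRMat l r μ g d a} → ((i : Fin l) → Fin r → Fin (μ i + 1)) :=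
    fun a i m => ⟨a.1 i m, Nat.lt_succ_of_le (by
      rw [← a.2.row i i.2]
      exact single_le_sum (f := fun x => a.1 i x) (fun _ _ => Nat.zero_le _)
        (mem_range.2 m.2))⟩
  have hF : Function.Injective F := by
    rintro ⟨a, ha⟩ ⟨b, hb⟩ h
    apply Subtype.ext
    funext i m
    by_cases hi : i < l
    · by_cases hm : m < r
      · exact congrArg Fin.val (congrFun (congrFun h ⟨i, hi⟩) ⟨m, hm⟩)
      · exact (ha.col_supp i m (not_lt.1 hm)).trans (hb.col_supp i m (not_lt.1 hm)).symm
    · exact (ha.row_supp i m (not_lt.1 hi)).trans (hb.row_supp i m (not_lt.1 hi)).symm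
  exact Set.finite_coe_iff.1 (Finite.of_injective F hF)

section patterns

variable {lam μ ν : YoungDiagram}

/-- The capacity of letter `m`. -/
def skewLen (lam ν : YoungDiagram) (m : ℕ) : ℕ := lam.rowLen m - ν.rowLen m

/-- The overlap of row `m` of `lam / ν` with the row above it. -/
def skewOverlap (lam ν : YoungDiagram) : ℕ → ℕ
  | 0 => 0
  | m + 1 => lam.rowLen (m + 1) - ν.rowLen m

/-- The initial slack of letter `m` in the ballot condition. -/
def skewGap (lam ν : YoungDiagram) (m : ℕ) : ℕ := skewLen lam ν m - skewOverlap lam ν m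

/-- A pattern is the array of partial row sums of its matrix of multiplicities, and interlacing is
`strict`. For `m > 0` the natural ballot slack is `ν (m-1) - ν m`; `skewGap` is its minimum with the
capacity, which changes nothing because the letter occurs at most as often as its capacity allows.
For letter 0 the slack is the capacity, so its condition is vacuous. -/
theorem ncard_gtPatterns_eq_lrMat (hle : ∀ m, ν.rowLen m ≤ lam.rowLen m)
    (hcard : ν.card + μ.card = lam.card) :
    Set.ncard {p | IsGT μ.rowLen (ν.card + μ.card) p ∧ GoodPattern (μ.colLen 0) ν.rowLen p ∧
      ∀ m, ν.rowLen m + μ.gtWeight p m = lam.rowLen m} =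
    Set.ncard {a | LRMat (μ.colLen 0) (lam.colLen 0) μ.rowLen (skewGap lam ν) (skewLen lam ν) a} := by
  set N := ν.card + μ.card with hN
  set l := μ.colLen 0 with hl
  set r := lam.colLen 0 with hr
  have hrN : r ≤ N := by rw [hcard]; exact lam.colLen_le_card
  have hμ0 : ∀ i, l ≤ i → μ.rowLen i = 0 := fun _ => μ.rowLen_eq_zero
  have tele : ∀ p, IsGT μ.rowLen N p → ∀ i m,
      rowSum (fun i m => p (m + 1) i - p m i) i m = p m i := by
    intro p h i m
    induction m with
    | zero => rw [rowSum_zero, h.zero]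
    | succ m ih =>
      rw [rowSum_succ, ih]
      have := h.mono m i
      omega
  have hwt : ∀ p, IsGT μ.rowLen N p → ∀ m,
      colSum (fun i m => p (m + 1) i - p m i) l m = μ.gtWeight p m := by
    intro p h m
    have h1 := h.colCount_add_sum (L := l) 0 m
    have h2 := h.colCount_add_wt (L := l) m
    simp only [Nat.sub_zero] at h1
    change colSum _ l m = wt l p m
    simp only [colSum]
    omega
  refine Set.ncard_congr (fun p _ => fun i m => p (m + 1) i - p m i) ?_ ?_ ?_
  · rintro p ⟨h, hg, hw⟩
    rw [h.goodPattern_iff hμ0 ν.rowLen_antitone] at hg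
    have hsupp : ∀ i m, l ≤ i → p (m + 1) i - p m i = 0 := fun i m hi => by
      rw [h.eq_zero hμ0 hi, Nat.zero_sub]
    have hcol : ∀ m, colSum (fun i m => p (m + 1) i - p m i) l m = skewLen lam ν m := by
      intro m
      rw [hwt p h, skewLen, ← hw m]
      omega
    have hcols : ∀ i m, r ≤ m → p (m + 1) i - p m i = 0 := by
      intro i m hm
      by_cases hi : i < l
      · have h1 := hcol m
        rw [skewLen, lam.rowLen_eq_zero hm, Nat.zero_sub] at h1
        exact sum_eq_zero_iff.1 h1 i (mem_range.2 hi)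
      · exact hsupp i m (not_lt.1 hi)
    refine ⟨hsupp, hcols, fun i _ => ?_, fun m _ => (hcol m).le, fun i m _ => ?_, fun i m _ => ?_⟩
    · rw [← rowSum_eq_of_le (m := N) (fun x hx => hcols i x hx) hrN, tele p h, h.top _ _ le_rfl]
    · rw [tele p h, tele p h]
      exact h.inter m i
    · have h1 := colSum_le_of_supp hsupp (i + 1) m
      rw [hcol] at h1
      cases m with
      | zero => simpa [prevColSum, skewGap, skewOverlap] using h1
      | succ m =>
        have h2 := hg i m
        have h3 := hle (m + 1)
        simp only [skewLen] at h1
        simp only [prevColSum, skewGap, skewOverlap, skewLen]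
        simp only [colSum] at h1 ⊢
        rw [show m + 1 + 1 = m + 2 from rfl] at h1 ⊢
        omega
  · rintro p q ⟨h, -⟩ ⟨h', -⟩ heq
    funext m i
    rw [← tele p h i m, ← tele q h' i m]
    exact congrArg (fun a => rowSum a i m) heq
  · intro a h
    have hpa : (fun i m => rowSum a i (m + 1) - rowSum a i m) = a := by
      funext i m
      rw [rowSum_succ]
      omega
    have hgt : IsGT μ.rowLen N (fun m i => rowSum a i m) := by
      refine ⟨fun i => rfl, fun m i => rowSum_mono a i (Nat.le_succ m), fun m i => h.strict' i m,
        fun m i hm => ?_⟩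
      rw [h.rowSum_eq (hrN.trans hm)]
      by_cases hi : i < l
      · exact h.row i hi
      · rw [hμ0 i (not_lt.1 hi)]
        exact sum_eq_zero fun x _ => h.row_supp i x (not_lt.1 hi)
    -- Summed over all letters, both the multiplicities and the capacities give `|μ|`, so the column
    -- inequalities are equalities.
    have hw : ∀ m, m < r → colSum a l m = skewLen lam ν m := by
      have htot : ∑ m ∈ range r, colSum a l m = ∑ m ∈ range r, skewLen lam ν m := by
        have hνr : ν.colLen 0 ≤ r := by
          apply YoungDiagram.colLen_le
          have := hle r
          rw [lam.rowLen_eq_zero le_rfl] at this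
          omega
        have e1 : ∑ m ∈ range r, colSum a l m = μ.card := by
          simp only [colSum]
          rw [sum_comm, μ.card_eq_sum le_rfl]
          exact sum_congr rfl fun i hi => h.row i (mem_range.1 hi)
        have e2 : ∑ m ∈ range r, skewLen lam ν m + ν.card = lam.card := by
          rw [ν.card_eq_sum hνr, lam.card_eq_sum le_rfl, ← sum_add_distrib]
          refine sum_congr rfl fun m _ => ?_
          have := hle m
          simp only [skewLen]
          omega
        omega
      intro m hm
      exact (sum_eq_sum_iff_of_le fun m hm => h.col m (mem_range.1 hm)).1 htot m (mem_range.2 hm)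
    refine ⟨fun m i => rowSum a i m, ⟨hgt, ?_, fun m => ?_⟩, hpa⟩
    · rw [hgt.goodPattern_iff hμ0 ν.rowLen_antitone]
      intro i m
      have e0 : ∀ x m, rowSum a x (m + 1) - rowSum a x m = a x m := fun x m => by
        rw [rowSum_succ, Nat.add_sub_cancel_left]
      have e1 : ∀ x m, rowSum a x (m + 2) - rowSum a x (m + 1) = a x (m + 1) :=
        fun x m => e0 x (m + 1)
      simp only [e0]
      change ν.rowLen (m + 1) + colSum a (i + 1) (m + 1) ≤ ν.rowLen m + colSum a i m
      by_cases hm : m + 1 < r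
      · have h4 := ν.rowLen_anti _ _ (Nat.le_succ m)
        simp only [Nat.succ_eq_add_one] at h4
        have h1 := h.ballot i (m + 1) hm
        have h2 := h.colSum_le (i + 1) hm
        have h3 := hle (m + 1)
        simp only [prevColSum, skewGap, skewOverlap, skewLen] at h1 h2
        omega
      · have h1 : colSum a (i + 1) (m + 1) = 0 :=
          sum_eq_zero fun x _ => h.col_supp x _ (not_lt.1 hm)
        have h2 := ν.rowLen_anti _ _ (Nat.le_succ m)
        simp only [Nat.succ_eq_add_one] at h2
        omega
    · have := hwt _ hgt m
      rw [← this, hpa]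
      by_cases hm : m < r
      · rw [hw m hm, skewLen]
        have := hle m
        omega
      · have h1 : colSum a l m = 0 := sum_eq_zero fun x _ => h.col_supp x _ (not_lt.1 hm)
        have h2 := hle m
        rw [lam.rowLen_eq_zero (not_lt.1 hm)] at h2 ⊢
        omega

theorem lrCoeff_eq_zero (h : ∃ m, lam.rowLen m < ν.rowLen m) : lrCoeff lam μ ν = 0 := by
  obtain ⟨m, hm⟩ := h
  rw [lrCoeff_eq_card, Set.ncard_eq_zero ((finite_isGT μ _).subset fun p hp => hp.1)]
  ext p
  simp only [Set.mem_ofPred_eq, Set.mem_empty_iff_false, iff_false, not_and]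
  intro _ _ hw
  have := hw m
  omega

end patterns

/-! ### Removing letters of capacity zero -/

section compress

variable {l r : ℕ} {μ g d : ℕ → ℕ}

/-- A letter of capacity zero never occurs, so its column can be dropped. This changes the
predecessor in the ballot condition of the next letter, but by `hg` that letter has slack equal to
its capacity, so its condition holds whatever the predecessor. -/
theorem ncard_lrMat_compress (hd : ∀ m, r ≤ m → d m = 0) (hg0 : g 0 = d 0)
    (hg : ∀ m, d m = 0 → g (m + 1) = d (m + 1)) :
    Set.ncard {a | LRMat l r μ g d a} =
      Set.ncard {a | LRMat l (Nat.count (fun m => d m ≠ 0) r) μ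
        (fun x => g (Nat.nth (fun m => d m ≠ 0) x)) (fun x => d (Nat.nth (fun m => d m ≠ 0) x)) a} := by
  set P : ℕ → Prop := fun m => d m ≠ 0 with hP
  set r' := Nat.count P r with hr'
  have hnlt : ∀ x, x < r' → Nat.nth P x < r := fun x hx => Nat.nth_lt_of_lt_count hx
  have hfin : (Set.ofPred P).Finite := (Set.finite_lt_nat r).subset fun m hm => by
    by_contra hc
    exact hm (hd m (not_lt.1 hc))
  have hcardfin : ∀ hf : (Set.ofPred P).Finite, #hf.toFinset = r' := by
    intro hf
    rw [hr', Nat.count_eq_card_filter_range]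
    congr 1
    ext m
    simp only [Set.Finite.mem_toFinset, mem_filter, mem_range]
    refine ⟨fun h => ⟨?_, h⟩, fun h => h.2⟩
    by_contra hc
    exact h (hd m (not_lt.1 hc))
  have hnP : ∀ x, x < r' → P (Nat.nth P x) := fun x hx =>
    Nat.nth_mem x fun hf => by rw [hcardfin hf]; exact hx
  have hcn : ∀ x, x < r' → Nat.count P (Nat.nth P x) = x := fun x hx =>
    Nat.count_nth fun hf => by rw [hcardfin hf]; exact hx
  have hclt : ∀ m, P m → Nat.count P m < r' := by
    intro m hm
    refine Nat.count_strict_mono hm ?_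
    by_contra hc
    exact hm (hd m (not_lt.1 hc))
  have hcle : ∀ m, Nat.count P m ≤ r' := by
    intro m
    rcases le_total m r with h | h
    · exact Nat.count_monotone P h
    · obtain ⟨e, rfl⟩ := Nat.exists_eq_add_of_le h
      rw [Nat.count_add]
      have : Nat.count (fun k => P (r + k)) e = 0 := by
        rw [Nat.count_eq_card_filter_range, card_eq_zero, filter_eq_empty_iff]
        intro x _ hx
        exact hx (hd _ (Nat.le_add_right _ _))
      omega
  let ex : (ℕ → ℕ → ℕ) → ℕ → ℕ → ℕ := fun b i m => if d m ≠ 0 then b i (Nat.count P m) else 0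
  have exP : ∀ b i m, P m → ex b i m = b i (Nat.count P m) := fun b i m hm => if_pos hm
  have exN : ∀ b i m, d m = 0 → ex b i m = 0 := fun b i m hm => if_neg (not_not.2 hm)
  have hrow : ∀ b i m, rowSum (ex b) i m = rowSum b i (Nat.count P m) := by
    intro b i m
    induction m with
    | zero => simp [rowSum_zero]
    | succ m ih =>
      rw [rowSum_succ, ih, Nat.count_succ]
      split_ifs with hm
      · rw [rowSum_succ, exP b i m hm]
      · rw [exN b i m (not_not.1 hm)]
        rfl
  have hcolP : ∀ b i m, P m → colSum (ex b) i m = colSum b i (Nat.count P m) :=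
    fun b i m hm => sum_congr rfl fun x _ => exP b x m hm
  have hcolN : ∀ b i m, d m = 0 → colSum (ex b) i m = 0 :=
    fun b i m hm => sum_eq_zero fun x _ => exN b x m hm
  -- Either the predecessor is kept and both ballot bounds agree, or both bounds are at least the
  -- capacity and thus vacuous.
  have hprev : ∀ b, ∀ i m, P m → g m + prevColSum (ex b) i m =
      g m + prevColSum b i (Nat.count P m) ∨
      (d m ≤ g m + prevColSum (ex b) i m ∧ d m ≤ g m + prevColSum b i (Nat.count P m)) := by
    intro b i m hm
    cases m with
    | zero => exact Or.inl rfl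
    | succ m =>
      by_cases h0 : d m = 0
      · right
        rw [hg m h0]
        exact ⟨Nat.le_add_right _ _, Nat.le_add_right _ _⟩
      · left
        have : Nat.count P (m + 1) = Nat.count P m + 1 := by
          rw [Nat.count_succ, if_pos h0]
        rw [this]
        simp only [prevColSum]
        rw [hcolP b i m h0]
  have key : ∀ b, (∀ i x, r' ≤ x → b i x = 0) → (LRMat l r μ g d (ex b) ↔
      LRMat l r' μ (fun x => g (Nat.nth P x)) (fun x => d (Nat.nth P x)) b) := by
    intro b hb
    constructor
    · intro h
      refine ⟨fun i x hi => ?_, hb, fun i hi => ?_, fun x hx => ?_, fun i x hx => ?_,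
        fun i x hx => ?_⟩
      · by_cases hx : x < r'
        · have := h.row_supp i (Nat.nth P x) hi
          rwa [exP b i _ (hnP x hx), hcn x hx] at this
        · exact hb i x (not_lt.1 hx)
      · rw [← h.row i hi, hrow]
      · have := h.col _ (hnlt x hx)
        rwa [hcolP b l _ (hnP x hx), hcn x hx] at this
      · have := h.strict i _ (hnlt x hx)
        rwa [hrow, hrow, Nat.count_succ, if_pos (hnP x hx), hcn x hx] at this
      · have h1 := h.ballot i _ (hnlt x hx)
        have h2 := h.colSum_le (i + 1) (hnlt x hx)
        have h3 := hprev b i _ (hnP x hx)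
        rw [hcolP b _ _ (hnP x hx), hcn x hx] at h1 h2
        rw [hcn x hx] at h3
        omega
    · intro h
      refine ⟨fun i m hi => ?_, fun i m hm => exN b i m (hd m hm), fun i hi => ?_, fun m _ => ?_,
        fun i m _ => ?_, fun i m _ => ?_⟩
      · by_cases hm : d m = 0
        · exact exN b i m hm
        · rw [exP b i m hm]
          exact h.row_supp i _ hi
      · rw [hrow, h.row i hi]
      · by_cases hm : d m = 0
        · rw [hcolN b l m hm]
          exact Nat.zero_le _
        · have := h.col _ (hclt m hm)
          rw [hcolP b l m hm]
          simpa [Nat.nth_count (p := P) hm] using this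
      · rw [hrow, hrow, Nat.count_succ]
        split_ifs with hm
        · exact h.strict' i _
        · rw [add_zero]
          rcases Nat.eq_zero_or_pos (Nat.count P m) with h0 | h0
          · rw [h0]
            rfl
          · obtain ⟨y, hy⟩ : ∃ y, Nat.count P m = y + 1 := ⟨_, (Nat.succ_pred_eq_of_pos h0).symm⟩
            rw [hy]
            exact (h.strict' i y).trans (rowSum_mono b i (Nat.le_succ y))
      · by_cases hm : d m = 0
        · rw [hcolN b _ m hm]
          exact Nat.zero_le _
        · have h1 := h.ballot i _ (hclt m hm)
          have h2 := h.colSum_le (i + 1) (hclt m hm)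
          have h3 := hprev b i m hm
          simp only [Nat.nth_count (p := P) hm] at h1 h2
          rw [hcolP b _ m hm]
          omega
  symm
  refine Set.ncard_congr (fun b _ => ex b) ?_ ?_ ?_
  · intro b hb
    exact (key b hb.col_supp).2 hb
  · intro b b' hb hb' heq
    funext i x
    by_cases hx : x < r'
    · have := congrFun (congrFun heq i) (Nat.nth P x)
      rwa [exP b i _ (hnP x hx), exP b' i _ (hnP x hx), hcn x hx] at this
    · rw [hb.col_supp i x (not_lt.1 hx), hb'.col_supp i x (not_lt.1 hx)]
  · intro a ha
    let b : ℕ → ℕ → ℕ := fun i x => if x < r' then a i (Nat.nth P x) else 0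
    have hab : ex b = a := by
      funext i m
      by_cases hm : d m = 0
      · rw [exN b i m hm]
        by_cases hmr : m < r
        · by_cases hi : i < l
          · have := ha.col m hmr
            rw [hm, Nat.le_zero] at this
            exact (sum_eq_zero_iff.1 this i (mem_range.2 hi)).symm
          · exact (ha.row_supp i m (not_lt.1 hi)).symm
        · exact (ha.col_supp i m (not_lt.1 hmr)).symm
      · rw [exP b i m hm]
        simp only [b]
        rw [if_pos (hclt m hm), Nat.nth_count (p := P) hm]
    refine ⟨b, ?_, hab⟩
    have hb : ∀ i x, r' ≤ x → b i x = 0 := fun i x hx => if_neg (not_lt.2 hx)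
    refine (key b hb).1 ?_
    rw [hab]
    exact ha

end compress

theorem skewGap_zero (lam ν : YoungDiagram) : skewGap lam ν 0 = skewLen lam ν 0 := by
  simp [skewGap, skewOverlap]

/-- Here `λ_m ≤ ν_m`, so `λ_{m+1} ≤ ν_m` and the overlap vanishes. -/
theorem skewGap_succ_of_skewLen_eq_zero {lam ν : YoungDiagram}
    {m : ℕ} (h : skewLen lam ν m = 0) :
    skewGap lam ν (m + 1) = skewLen lam ν (m + 1) := by
  have h1 := lam.rowLen_anti _ _ (Nat.le_succ m)
  simp only [skewGap, skewOverlap, skewLen, Nat.succ_eq_add_one] at *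
  omega

/-! ### Enumerating Littlewood-Richardson matrices by words -/

/-- Increase one entry of a matrix. -/
def addCell (a : ℕ → ℕ → ℕ) (i m : ℕ) : ℕ → ℕ → ℕ :=
  fun i' m' => a i' m' + if i' = i ∧ m' = m then 1 else 0

theorem rowSum_addCell (a : ℕ → ℕ → ℕ) (i m i' m' : ℕ) :
    rowSum (addCell a i m) i' m' = rowSum a i' m' + if i' = i ∧ m < m' then 1 else 0 := by
  simp only [rowSum, addCell, sum_add_distrib]
  congr 1
  by_cases h : i' = i <;> simp [h]

theorem colSum_addCell (a : ℕ → ℕ → ℕ) (i m i' m' : ℕ) :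
    colSum (addCell a i m) i' m' = colSum a i' m' + if m' = m ∧ i < i' then 1 else 0 := by
  simp only [colSum, addCell, sum_add_distrib]
  congr 1
  by_cases h : m' = m <;> simp [h]

theorem prevColSum_addCell (a : ℕ → ℕ → ℕ) (i m i' m' : ℕ) :
    prevColSum (addCell a i m) i' m' =
      prevColSum a i' m' + if m' = m + 1 ∧ i < i' then 1 else 0 := by
  cases m' with
  | zero => simp [prevColSum]
  | succ m' => simp [prevColSum, colSum_addCell]

theorem prevColSum_mono (a : ℕ → ℕ → ℕ) (m : ℕ) : Monotone fun i => prevColSum a i m := by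
  cases m with
  | zero => exact fun _ _ _ => le_rfl
  | succ m => exact colSum_mono a m

/-- How many cells may be put into row `i` in the columns `≤ m`. -/
def aboveSum (k : ℕ) (a : ℕ → ℕ → ℕ) : ℕ → ℕ → ℕ
  | 0, _ => k
  | i + 1, m => rowSum a i m

/-- Whether one more letter `m` may be put into row `i`. -/
structure CanAdd (k r : ℕ) (g d : ℕ → ℕ) (a : ℕ → ℕ → ℕ) (i m : ℕ) : Prop where
  lt : m < r
  rem : colSum a (i + 1) m < d m
  slack : colSum a (i + 1) m < g m + prevColSum a i m
  above : rowSum a i (m + 1) < aboveSum k a i m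

/-- Matrices filled up to row `i` and letter `m` which satisfy the conditions so far. -/
structure PartialLRMat (l r : ℕ) (μ g d : ℕ → ℕ) (i m : ℕ) (a : ℕ → ℕ → ℕ) : Prop where
  lt : i < l
  supp : ∀ i' m', (i < i' ∨ (i' = i ∧ m < m') ∨ r ≤ m') → a i' m' = 0
  row : ∀ i', i' < i → rowSum a i' r = μ i'
  col : ∀ m', m' < r → colSum a l m' ≤ d m'
  strict : ∀ i' m', m' < r → rowSum a (i' + 1) (m' + 1) ≤ rowSum a i' m'
  ballot : ∀ i' m', m' < r → colSum a (i' + 1) m' ≤ g m' + prevColSum a i' m'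

namespace PartialLRMat

variable {k l r : ℕ} {μ g d : ℕ → ℕ} {i m : ℕ} {a : ℕ → ℕ → ℕ}

theorem colSum_eq (h : PartialLRMat l r μ g d i m a) {i' m' : ℕ} (hi : i < i') :
    colSum a i' m' = colSum a (i + 1) m' :=
  colSum_eq_of_le (fun x hx => h.supp x m' (Or.inl hx)) hi

/-- Nothing has yet been placed in row `i` beyond letter `M`, nor in the rows below, so the tests in
`CanAdd` cover every condition that the new cell can affect. -/
theorem addCell (h : PartialLRMat l r μ g d i m a) {M : ℕ} (hM : m ≤ M)
    (hc : CanAdd k r g d a i M) : PartialLRMat l r μ g d i M (addCell a i M) := by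
  refine ⟨h.lt, fun i' m' h' => ?_, fun i' hi' => ?_, fun m' hm' => ?_, fun i' m' hm' => ?_,
    fun i' m' hm' => ?_⟩
  · have := hc.lt
    rw [_root_.addCell, h.supp i' m' (by omega), if_neg (by omega)]
  · rw [rowSum_addCell, h.row i' hi', if_neg (by omega), add_zero]
  · rw [colSum_addCell]
    split_ifs with hh
    · have h1 := hc.rem
      rw [hh.1, h.colSum_eq h.lt]
      omega
    · exact h.col m' hm'
  · rw [rowSum_addCell, rowSum_addCell]
    have h1 := h.strict i' m' hm'
    split_ifs with h2 h3 h3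
    · omega
    · obtain ⟨rfl, h4⟩ := h2
      have h5 := hc.above
      have h6 : rowSum a (i' + 1) (m' + 1) = rowSum a (i' + 1) (M + 1) :=
        rowSum_eq_of_le (fun x hx => h.supp _ x (by omega)) (by omega)
      have h7 := rowSum_mono a i' (show M ≤ m' by omega)
      simp only [aboveSum] at h5
      omega
    · omega
    · omega
  · rw [colSum_addCell, prevColSum_addCell]
    have h1 := h.ballot i' m' hm'
    by_cases h2 : m' = M ∧ i < i' + 1
    · obtain ⟨rfl, h3⟩ := h2
      have h5 := hc.slack
      have h6 := h.colSum_eq (m' := m') h3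
      have h7 : prevColSum a i m' ≤ prevColSum a i' m' := prevColSum_mono a m' (by omega)
      rw [if_pos ⟨rfl, h3⟩]
      omega
    · rw [if_neg h2]
      omega

theorem nextRow (h : PartialLRMat l r μ g d i m a) (hr : rowSum a i r = μ i) (hi : i + 1 < l) :
    PartialLRMat l r μ g d (i + 1) 0 a := by
  refine ⟨hi, fun i' m' h' => h.supp i' m' (by omega), fun i' hi' => ?_, h.col, h.strict, h.ballot⟩
  rcases Nat.lt_succ_iff_lt_or_eq.1 hi' with h1 | rfl
  · exact h.row i' h1
  · exact hr

theorem lrMat (h : PartialLRMat l r μ g d i m a) (hr : rowSum a i r = μ i) (hi : i + 1 = l) :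
    LRMat l r μ g d a := by
  refine ⟨fun i' m' h' => h.supp i' m' (by omega), fun i' m' h' => h.supp i' m' (by omega),
    fun i' hi' => ?_, h.col, h.strict, h.ballot⟩
  rcases Nat.lt_succ_iff_lt_or_eq.1 (hi.symm ▸ hi') with h1 | rfl
  · exact h.row i' h1
  · exact hr

end PartialLRMat

/-- `fs` marks, in the list of cells starting with the last `c` cells of row `i` and ending with row
`l - 1`, the last cells of the rows. -/
inductive Fits (μ : ℕ → ℕ) (l : ℕ) : ℕ → ℕ → List Bool → Prop
  | last {i} : i + 1 = l → Fits μ l i 1 [true]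
  | nextRow {i fs} : i + 1 < l → Fits μ l (i + 1) (μ (i + 1)) fs → Fits μ l i 1 (true :: fs)
  | cell {i c fs} : Fits μ l i (c + 1) fs → Fits μ l i (c + 2) (false :: fs)

/-- A word describes the cells in order: advance by so many letters, then add a cell; the flag tells
whether the cell is the last one of its row. -/
def WordValid (k r : ℕ) (g d : ℕ → ℕ) : (ℕ → ℕ → ℕ) → ℕ → ℕ → List ℕ → List Bool → Prop
  | a, i, m, y :: w, f :: fs => CanAdd k r g d a i (m + y) ∧
      if f then WordValid k r g d (addCell a i (m + y)) (i + 1) 0 w fs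
      else WordValid k r g d (addCell a i (m + y)) i (m + y) w fs
  | _, _, _, _, _ => True

/-- Sum of `F` over the words of length `n` with digits less than `B`. -/
def wordSum (B : ℕ) : ℕ → (List ℕ → ℕ) → ℕ
  | 0, F => F []
  | n + 1, F => ∑ y ∈ range B, wordSum B n fun w => F (y :: w)

theorem wordSum_zero (B n : ℕ) : wordSum B n (fun _ => 0) = 0 := by
  induction n with
  | zero => rfl
  | succ n ih => simp [wordSum, ih]

/-- The Littlewood-Richardson matrices extending a partial one. -/
def completions (l r : ℕ) (μ g d : ℕ → ℕ) (i m : ℕ) (a : ℕ → ℕ → ℕ) : Set (ℕ → ℕ → ℕ) :=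
  {x | LRMat l r μ g d x ∧ (∀ i' m', (i' < i ∨ (i' = i ∧ m' < m)) → x i' m' = a i' m') ∧
    a i m ≤ x i m}

section count

variable {k l r : ℕ} {μ g d : ℕ → ℕ}

/-- The completions whose next cell is a letter `M`. -/
def completionsAt (l r : ℕ) (μ g d : ℕ → ℕ) (i M : ℕ) (a : ℕ → ℕ → ℕ) : Set (ℕ → ℕ → ℕ) :=
  {x | LRMat l r μ g d x ∧ (∀ i' m', (i' < i ∨ (i' = i ∧ m' < M)) → x i' m' = a i' m') ∧
    a i M < x i M}

/-- Row `i` is not full, so a completion has a further cell in it. Its letter is the first one from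
`m` on where the completion exceeds `a`; being less than `r ≤ k`, it is reached by an advance of at
most `k`. -/
theorem completions_ncard_eq_sum (hr : r ≤ k) {i m : ℕ} {a : ℕ → ℕ → ℕ}
    (h : PartialLRMat l r μ g d i m a) (hrow : rowSum a i r < μ i) :
    (completions l r μ g d i m a).ncard =
      ∑ y ∈ range (k + 1), (completionsAt l r μ g d i (m + y) a).ncard := by
  classical
  have hfin : (completions l r μ g d i m a).Finite :=
    (finite_lrMat l r μ g d).subset fun x hx => hx.1
  have hfin' : ∀ y, (completionsAt l r μ g d i (m + y) a).Finite := fun y =>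
    (finite_lrMat l r μ g d).subset fun x hx => hx.1
  have hsub : ∀ y x, x ∈ completionsAt l r μ g d i (m + y) a →
      x ∈ completions l r μ g d i m a := by
    rintro y x ⟨h1, h2, h3⟩
    refine ⟨h1, fun i' m' h' => h2 i' m' (by omega), ?_⟩
    cases y with
    | zero => exact h3.le
    | succ y => exact (h2 i m (by omega)).ge
  have hex : ∀ x ∈ completions l r μ g d i m a, ∃ y, y < k + 1 ∧
      x ∈ completionsAt l r μ g d i (m + y) a := by
    rintro x ⟨h1, h2, h3⟩
    have hE : ∃ y, a i (m + y) < x i (m + y) := by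
      by_contra! hc
      have : rowSum x i r ≤ rowSum a i r := by
        refine sum_le_sum fun z _ => ?_
        rcases lt_or_ge z m with hz | hz
        · exact (h2 i z (by omega)).le
        · obtain ⟨e, rfl⟩ := Nat.exists_eq_add_of_le hz
          exact hc e
      rw [h1.row i h.lt] at this
      omega
    have hs := Nat.find_spec hE
    refine ⟨Nat.find hE, ?_, h1, fun i' m' h' => ?_, hs⟩
    · by_contra! hc
      rw [h1.col_supp i _ (by omega)] at hs
      omega
    · by_cases hlt : i' < i ∨ (i' = i ∧ m' < m)
      · exact h2 i' m' hlt
      · obtain ⟨rfl, hm⟩ : i' = i ∧ m ≤ m' := by omega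
        obtain ⟨e, rfl⟩ := Nat.exists_eq_add_of_le hm
        have hmin := Nat.find_min hE (m := e) (by omega)
        cases e with
        | zero => exact le_antisymm (not_lt.1 hmin) h3
        | succ e => rw [h.supp i' _ (by omega)] at hmin ⊢; omega
  rw [Set.ncard_eq_toFinset_card _ hfin]
  simp only [fun y => Set.ncard_eq_toFinset_card _ (hfin' y)]
  rw [← card_biUnion]
  · congr 1
    ext x
    simp only [Set.Finite.mem_toFinset, mem_biUnion, mem_range]
    exact ⟨fun hx => hex x hx, fun ⟨y, _, hy⟩ => hsub y x hy⟩
  · intro y _ y' _ hne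
    refine disjoint_left.2 fun x hx hx' => ?_
    simp only [Set.Finite.mem_toFinset] at hx hx'
    rcases lt_or_gt_of_ne hne with hlt | hlt
    · have := hx'.2.1 i (m + y) (by omega)
      have := hx.2.2
      omega
    · have := hx.2.1 i (m + y') (by omega)
      have := hx'.2.2
      omega

/-- A completion agrees with `a` before the position `(i, M)` and has at least one more cell there,
so its own conditions imply the tests. In row 0 the room is `k`, which suffices by `hk`. -/
theorem canAdd_of_mem_completionsAt (hk : μ 0 ≤ k) {i m M : ℕ} {a x : ℕ → ℕ → ℕ}
    (h : PartialLRMat l r μ g d i m a) (hx : x ∈ completionsAt l r μ g d i M a) :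
    CanAdd k r g d a i M := by
  obtain ⟨h1, h2, h3⟩ := hx
  have hlt : M < r := by
    by_contra hc
    rw [h1.col_supp i M (not_lt.1 hc)] at h3
    omega
  have hcol : ∀ m', colSum x i m' = colSum a i m' := fun m' =>
    sum_congr rfl fun z hz => h2 z m' (Or.inl (mem_range.1 hz))
  have hprev : prevColSum x i M = prevColSum a i M := by
    cases M with
    | zero => rfl
    | succ M => exact hcol M
  have hrow : rowSum x i M = rowSum a i M :=
    sum_congr rfl fun z hz => h2 i z (Or.inr ⟨rfl, mem_range.1 hz⟩)
  have hc := hcol M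
  refine ⟨hlt, ?_, ?_, ?_⟩
  · have := h1.colSum_le (i + 1) hlt
    rw [colSum_succ] at this ⊢
    omega
  · have := h1.ballot i M hlt
    rw [colSum_succ] at this ⊢
    omega
  · cases i with
    | zero =>
      have e1 := h1.row 0 h.lt
      have e2 := rowSum_mono x 0 (show M + 1 ≤ r from hlt)
      rw [rowSum_succ] at e2 ⊢
      simp only [aboveSum]
      omega
    | succ i =>
      have e1 := h1.strict i M hlt
      have e3 : rowSum x i M = rowSum a i M :=
        sum_congr rfl fun z _ => h2 i z (Or.inl (Nat.lt_succ_self i))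
      rw [rowSum_succ] at e1 ⊢
      simp only [aboveSum]
      omega

theorem completionsAt_eq {i M : ℕ} {a : ℕ → ℕ → ℕ} :
    completionsAt l r μ g d i M a = completions l r μ g d i M (addCell a i M) := by
  ext x
  simp only [completionsAt, completions, Set.mem_ofPred_eq]
  refine and_congr_right fun _ => and_congr (forall₂_congr fun i' m' => ?_) ?_
  · refine imp_congr_right fun h' => ?_
    rw [addCell, if_neg (by omega), add_zero]
  · simp [addCell]

/-- On row `i` the completion dominates `a` entrywise and has the same sum. -/
theorem completions_row_full {i M : ℕ} {a x : ℕ → ℕ → ℕ} (h : PartialLRMat l r μ g d i M a)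
    (hrow : rowSum a i r = μ i) (hx : x ∈ completions l r μ g d i M a) :
    ∀ i' m', i' ≤ i → x i' m' = a i' m' := by
  obtain ⟨h1, h2, h3⟩ := hx
  intro i' m' hi'
  rcases Nat.lt_or_eq_of_le hi' with hlt | rfl
  · exact h2 i' m' (Or.inl hlt)
  · by_cases hm : m' < r
    · have hle : ∀ z ∈ range r, a i' z ≤ x i' z := by
        intro z _
        rcases lt_trichotomy z M with hz | rfl | hz
        · exact (h2 i' z (Or.inr ⟨rfl, hz⟩)).ge
        · exact h3
        · rw [h.supp i' z (by omega)]
          exact Nat.zero_le _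
      exact ((sum_eq_sum_iff_of_le hle).1 (hrow.trans (h1.row i' h.lt).symm) m'
        (mem_range.2 hm)).symm
    · rw [h1.col_supp _ _ (not_lt.1 hm), h.supp _ _ (by omega)]

-- Both sides branch over the letter of the next cell: a letter refused by `CanAdd` starts no
-- completion, and an accepted one leaves the same problem with one cell less to place.
open Classical in
theorem wordSum_eq_ncard_completions (hr : r ≤ k) (hk : μ 0 ≤ k) (hμ : ∀ i, i < l → 0 < μ i)
    {i c : ℕ} {fs : List Bool} (hf : Fits μ l i c fs) :
    ∀ (a : ℕ → ℕ → ℕ) (m : ℕ), PartialLRMat l r μ g d i m a → rowSum a i r + c = μ i →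
      wordSum (k + 1) fs.length (fun w => if WordValid k r g d a i m w fs then 1 else 0) =
        (completions l r μ g d i m a).ncard := by
  -- The part common to the three cases: one cell is placed, and the hypothesis describes what
  -- follows it.
  have key : ∀ (i c : ℕ) (f : Bool) (fs : List Bool),
      (∀ (a : ℕ → ℕ → ℕ) (M : ℕ), PartialLRMat l r μ g d i M a → rowSum a i r + c = μ i →
        wordSum (k + 1) fs.length (fun w => if (if f then WordValid k r g d a (i + 1) 0 w fs
          else WordValid k r g d a i M w fs) then 1 else 0) =
          (completions l r μ g d i M a).ncard) →
      ∀ (a : ℕ → ℕ → ℕ) (m : ℕ), PartialLRMat l r μ g d i m a → rowSum a i r + (c + 1) = μ i →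
      wordSum (k + 1) (f :: fs).length
        (fun w => if WordValid k r g d a i m w (f :: fs) then 1 else 0) =
        (completions l r μ g d i m a).ncard := by
    intro i c f fs ih a m h hrow
    rw [completions_ncard_eq_sum hr h (by omega), List.length_cons, wordSum]
    refine sum_congr rfl fun y _ => ?_
    simp only [WordValid]
    by_cases hc : CanAdd k r g d a i (m + y)
    · have h' := h.addCell (Nat.le_add_right m y) hc
      have hlt := hc.lt
      simp only [hc, true_and]
      rw [completionsAt_eq]
      refine ih _ _ h' ?_
      rw [rowSum_addCell, if_pos ⟨rfl, hlt⟩]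
      omega
    · simp only [hc, false_and, if_false]
      rw [wordSum_zero]
      symm
      rw [Set.ncard_eq_zero ((finite_lrMat l r μ g d).subset fun x hx => hx.1)]
      exact Set.eq_empty_of_forall_notMem fun x hx => hc (canAdd_of_mem_completionsAt hk h hx)
  induction hf with
  | @last i hi =>
    refine key i 0 true [] fun a M h hrow => ?_
    rw [add_zero] at hrow
    simp only [List.length_nil, wordSum, WordValid, if_true]
    symm
    rw [Set.ncard_eq_one]
    refine ⟨a, Set.eq_singleton_iff_unique_mem.2 ⟨⟨h.lrMat hrow hi, fun _ _ _ => rfl, le_rfl⟩,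
      fun x hx => ?_⟩⟩
    funext i' m'
    rcases le_or_gt i' i with h' | h'
    · exact completions_row_full h hrow hx i' m' h'
    · rw [hx.1.row_supp _ _ (by omega), h.supp _ _ (Or.inl h')]
  | @nextRow i fs hi _ ih =>
    refine key i 0 true fs fun a M h hrow => ?_
    rw [add_zero] at hrow
    have h' := h.nextRow hrow hi
    have h0 : rowSum a (i + 1) r = 0 := sum_eq_zero fun x _ => h.supp _ _ (by omega)
    simp only [if_true]
    rw [ih a 0 h' (by omega)]
    congr 1
    ext x
    constructor
    · rintro ⟨h1, h2, -⟩
      exact ⟨h1, fun i' m' hh => h2 i' m' (by omega), (h2 i M (by omega)).ge⟩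
    · intro hx
      refine ⟨hx.1, fun i' m' hh => completions_row_full h hrow hx i' m' (by omega), ?_⟩
      rw [h.supp _ _ (by omega)]
      exact Nat.zero_le _
  | @cell i c fs _ ih =>
    refine key i (c + 1) false fs fun a M h hrow => ?_
    simp only [Bool.false_eq_true, if_false]
    exact ih a M h hrow

open Classical in
theorem wordSum_eq_ncard_lrMat (hr : r ≤ k) (hk : μ 0 ≤ k) (hμ : ∀ i, i < l → 0 < μ i)
    (hl : 0 < l) {fs : List Bool} (hf : Fits μ l 0 (μ 0) fs) :
    wordSum (k + 1) fs.length (fun w => if WordValid k r g d (fun _ _ => 0) 0 0 w fs then 1 else 0) =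
      {a | LRMat l r μ g d a}.ncard := by
  rw [wordSum_eq_ncard_completions hr hk hμ hf (fun _ _ => 0) 0]
  · congr 1
    ext x
    simp [completions]
  · refine ⟨hl, fun _ _ _ => rfl, fun i hi => absurd hi (Nat.not_lt_zero _), ?_, ?_, ?_⟩ <;>
      simp [colSum, rowSum]
  · simp [rowSum]

theorem ncard_lrMat_zero : {a | LRMat 0 r μ g d a}.ncard = 1 := by
  rw [Set.ncard_eq_one]
  refine ⟨fun _ _ => 0, Set.eq_singleton_iff_unique_mem.2 ⟨?_, fun x hx => ?_⟩⟩
  · refine ⟨fun _ _ _ => rfl, fun _ _ _ => rfl, fun i hi => absurd hi (Nat.not_lt_zero _), ?_, ?_,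
      ?_⟩ <;> simp [colSum, rowSum]
  · funext i m
    exact hx.row_supp i m (Nat.zero_le i)

end count

/-! ### Draining, moving and clearing stacks -/

namespace StackProg

variable {K : Type} {S S' : Stacks K}

/-- A step moves at most one symbol onto each stack. -/
theorem Runs.length_le {p : StackProg K} {t : ℕ} (h : Runs p S S' t) (k : K) :
    (S' k).length ≤ (S k).length + t := by
  obtain ⟨s, hs, e⟩ := h
  refine le_trans ?_ (Nat.add_le_add_left hs _)
  clear hs
  induction e with
  | act f S =>
    simp only [applyAct, edit]
    rcases f (tops S) k with ⟨b, o⟩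
    cases b <;> cases o <;> simp <;> omega
  | seq _ _ h₁ h₂ => omega
  | iteTrue _ _ h => omega
  | iteFalse _ _ h => omega
  | loopDone _ => omega
  | loopStep _ _ _ h₁ h₂ => omega

/-- The program which does nothing. -/
def skip : StackProg K := act fun _ _ => (false, none)

theorem Runs.skip : Runs skip S S 1 := Runs.act' fun _ => rfl

variable [DecidableEq K]

/-- Pop symbols off the stack `i` while they satisfy `c`, pushing `h x k` onto the stack `k` for each
popped symbol `x`. -/
def drain (i : K) (c : Γ' → Bool) (h : Γ' → K → Option Γ') : StackProg K :=
  loop (fun t => (t i).any c)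
    (act fun t k => if k = i then (true, none) else (false, (t i).bind fun x => h x k))

/-- Each symbol costs one test and one action; the last test fails at `rest`. -/
theorem Runs.drain {i : K} {c : Γ' → Bool} {h : Γ' → K → Option Γ'} (l rest : List Γ')
    (hi : S i = l ++ rest) (hc : ∀ x ∈ l, c x = true) (hr : rest.head?.any c = false)
    (hi' : S' i = rest) (hk : ∀ k, k ≠ i → S' k = (l.filterMap fun x => h x k).reverse ++ S k) :
    Runs (drain i c h) S S' (2 * l.length + 1) := by
  induction l generalizing S with
  | nil =>
    have : S' = S := funext fun k => by
      by_cases hki : k = i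
      · rw [hki, hi', hi, List.nil_append]
      · simpa using hk k hki
    rw [this]
    refine (Runs.done ?_).mono (by simp)
    simpa [tops, hi] using hr
  | cons x l ih =>
    let S₁ : Stacks K := fun k => if k = i then l ++ rest else (h x k).toList ++ S k
    have h₁ : Runs (act fun t k => if k = i then (true, none) else (false, (t i).bind fun x => h x k))
        S S₁ 1 := by
      refine Runs.act' fun k => ?_
      by_cases hki : k = i
      · subst hki
        simp [S₁, edit, hi]
      · simp [S₁, edit, hki, tops, hi]
    refine (Runs.step ?_ h₁ (ih (S := S₁) ?_ ?_ ?_)).mono (t := 1 + (2 * l.length + 1) + 1) ?_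
    · simp [tops, hi, hc x]
    · simp [S₁]
    · exact fun y hy => hc y (List.mem_cons_of_mem _ hy)
    · intro k hki
      rw [hk k hki]
      simp only [S₁, if_neg hki, List.filterMap_cons]
      cases h x k <;> simp
    · simp only [List.length_cons]
      omega

/-- Move symbols from the stack `i` onto the stacks `js` while they satisfy `c`. -/
def moveTo (i : K) (c : Γ' → Bool) (js : List K) : StackProg K :=
  drain i c fun x k => if k ∈ js then some x else none

theorem Runs.moveTo {i : K} {c : Γ' → Bool} {js : List K} (l rest : List Γ')
    (hi : S i = l ++ rest) (hc : ∀ x ∈ l, c x = true) (hr : rest.head?.any c = false)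
    (hi' : S' i = rest)
    (hk : ∀ k, k ≠ i → S' k = if k ∈ js then l.reverse ++ S k else S k) :
    Runs (moveTo i c js) S S' (2 * l.length + 1) := by
  refine Runs.drain l rest hi hc hr hi' fun k hki => ?_
  rw [hk k hki]
  split_ifs <;> simp

theorem Runs.of_eq {p : StackProg K} {T : Stacks K} {t t' : ℕ} (h : Runs p S S' t)
    (he : ∀ k, S' k = T k) (ht : t ≤ t') : Runs p S T t' := by
  obtain rfl : S' = T := funext he
  exact h.mono ht

theorem Runs.of_start {p : StackProg K} {T : Stacks K} {t : ℕ} (h : Runs p S S' t)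
    (he : ∀ k, T k = S k) : Runs p T S' t := by
  obtain rfl : T = S := funext he
  exact h

/-- The stacks after moving `l` from the stack `i` onto the stacks `js`. -/
def moved (S : Stacks K) (i : K) (js : List K) (l rest : List Γ') : Stacks K :=
  fun k => if k = i then rest else if k ∈ js then l.reverse ++ S k else S k

theorem Runs.moved {i : K} {c : Γ' → Bool} {js : List K} (l rest : List Γ')
    (hi : S i = l ++ rest) (hc : ∀ x ∈ l, c x = true) (hr : rest.head?.any c = false) :
    Runs (StackProg.moveTo i c js) S (StackProg.moved S i js l rest) (2 * l.length + 1) :=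
  Runs.moveTo l rest hi hc hr (if_pos rfl) fun _ hk => if_neg hk

/-- The stacks after popping `l` from the stack `i` and pushing symbols according to `h`. -/
def drained (S : Stacks K) (i : K) (h : Γ' → K → Option Γ') (l rest : List Γ') : Stacks K :=
  fun k => if k = i then rest else (l.filterMap fun x => h x k).reverse ++ S k

theorem Runs.drained {i : K} {c : Γ' → Bool} {h : Γ' → K → Option Γ'} (l rest : List Γ')
    (hi : S i = l ++ rest) (hc : ∀ x ∈ l, c x = true) (hr : rest.head?.any c = false) :
    Runs (StackProg.drain i c h) S (StackProg.drained S i h l rest) (2 * l.length + 1) :=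
  Runs.drain l rest hi hc hr (if_pos rfl) fun _ hk => if_neg hk

theorem Runs.act (f : (K → Option Γ') → K → Bool × Option Γ') :
    Runs (StackProg.act f) S (applyAct f S) 1 := Runs.act' fun _ => rfl

/-- Move all symbols from the stack `i` onto the stacks `js`. -/
def moveAll (i : K) (js : List K) : StackProg K := moveTo i (fun _ => true) js

theorem Runs.moveAll {i : K} {js : List K} (l : List Γ') (hi : S i = l) (hi' : S' i = [])
    (hk : ∀ k, k ≠ i → S' k = if k ∈ js then l.reverse ++ S k else S k) :
    Runs (moveAll i js) S S' (2 * l.length + 1) :=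
  Runs.moveTo l [] (by simpa using hi) (fun _ _ => rfl) rfl hi' hk

theorem Runs.movedAll {i : K} {js : List K} (l : List Γ') (hi : S i = l) :
    Runs (StackProg.moveAll i js) S (StackProg.moved S i js l []) (2 * l.length + 1) :=
  Runs.moveAll l hi (if_pos rfl) fun _ hk => if_neg hk

/-- Empty the stacks `ks`. -/
def clear : List K → StackProg K
  | [] => skip
  | k :: ks => seq (moveAll k []) (clear ks)

/-- The stacks after emptying the stacks `ks`. -/
def cleared (S : Stacks K) (ks : List K) : Stacks K := fun k => if k ∈ ks then [] else S k

theorem Runs.clear {n : ℕ} (ks : List K) (hn : ∀ k ∈ ks, (S k).length ≤ n)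
    (h : ∀ k, S' k = if k ∈ ks then [] else S k) :
    Runs (clear ks) S S' (ks.length * (2 * n + 1) + 1) := by
  induction ks generalizing S with
  | nil =>
    obtain rfl : S' = S := funext fun k => by simpa using h k
    exact Runs.skip.mono (by simp)
  | cons k ks ih =>
    refine (Runs.seq' (S₁ := fun k' => if k' = k then [] else S k')
      (Runs.moveAll (S k) rfl (if_pos rfl) fun k' hk' => by simp [hk']) (ih ?_ ?_)).mono
        (t := (2 * (S k).length + 1) + (ks.length * (2 * n + 1) + 1)) ?_
    · intro k' hk'
      split_ifs
      · simp
      · exact hn k' (List.mem_cons_of_mem _ hk')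
    · intro k'
      rw [h k']
      by_cases h1 : k' = k <;> by_cases h2 : k' ∈ ks <;> simp [h1, h2]
    · have := hn k List.mem_cons_self
      rw [List.length_cons, add_one_mul]
      omega

theorem Runs.cleared {n : ℕ} (ks : List K) (hn : ∀ k ∈ ks, (S k).length ≤ n) :
    Runs (StackProg.clear ks) S (StackProg.cleared S ks) (ks.length * (2 * n + 1) + 1) :=
  Runs.clear ks hn fun _ => rfl

end StackProg

/-! ### Lists of blocks on a pair of stacks -/

/-- Concatenation of `f m`, `f (m + 1)`, …, with `n` terms. -/
def blocks (f : ℕ → List Γ') : ℕ → ℕ → List Γ'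
  | _, 0 => []
  | m, n + 1 => f m ++ blocks f (m + 1) n

/-- The reversal of the concatenation of `f 0`, …, `f (m - 1)`. -/
def revBlocks (f : ℕ → List Γ') : ℕ → List Γ'
  | 0 => []
  | m + 1 => (f m).reverse ++ revBlocks f m

theorem blocks_congr {f f' : ℕ → List Γ'} {m n : ℕ} (h : ∀ x, m ≤ x → x < m + n → f x = f' x) :
    blocks f m n = blocks f' m n := by
  induction n generalizing m with
  | zero => rfl
  | succ n ih =>
    rw [blocks, blocks, h m le_rfl (by omega), ih fun x h1 h2 => h x (by omega) (by omega)]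

theorem revBlocks_congr {f f' : ℕ → List Γ'} {m : ℕ} (h : ∀ x, x < m → f x = f' x) :
    revBlocks f m = revBlocks f' m := by
  induction m with
  | zero => rfl
  | succ m ih => rw [revBlocks, revBlocks, h m (by omega), ih fun x h1 => h x (by omega)]

theorem reverse_revBlocks_append (f : ℕ → List Γ') (m n : ℕ) :
    (revBlocks f m).reverse ++ blocks f m n = blocks f 0 (m + n) := by
  induction m generalizing n with
  | zero => simp [revBlocks]
  | succ m ih =>
    rw [revBlocks, List.reverse_append, List.reverse_reverse, List.append_assoc]
    have := ih (n + 1)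
    rw [blocks] at this
    rw [this]
    congr 1
    omega

theorem reverse_revBlocks (f : ℕ → List Γ') (m : ℕ) : (revBlocks f m).reverse = blocks f 0 m := by
  simpa [blocks] using reverse_revBlocks_append f m 0

theorem reverse_blocks (f : ℕ → List Γ') (m : ℕ) : (blocks f 0 m).reverse = revBlocks f m := by
  rw [← reverse_revBlocks, List.reverse_reverse]

theorem length_blocks_le {f : ℕ → List Γ'} {m n b : ℕ} (h : ∀ x, m ≤ x → x < m + n → (f x).length ≤ b) :
    (blocks f m n).length ≤ n * b := by
  induction n generalizing m with
  | zero => simp [blocks]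
  | succ n ih =>
    rw [blocks, List.length_append, Nat.succ_mul, add_comm]
    exact add_le_add (ih fun x h1 h2 => h x (by omega) (by omega)) (h m le_rfl (by omega))

theorem length_revBlocks_le {f : ℕ → List Γ'} {m b : ℕ} (h : ∀ x, x < m → (f x).length ≤ b) :
    (revBlocks f m).length ≤ m * b := by
  rw [← reverse_blocks, List.length_reverse]
  exact length_blocks_le fun x _ h2 => h x (by omega)

theorem blocks_succ_right (f : ℕ → List Γ') (m n : ℕ) :
    blocks f m (n + 1) = blocks f m n ++ f (m + n) := by
  induction n generalizing m with
  | zero => simp [blocks]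
  | succ n ih =>
    rw [blocks, ih, blocks, List.append_assoc]
    congr 3
    omega

/-! ### Registers of the machine -/

/-- The stacks of the machine for Littlewood-Richardson coefficients. -/
inductive Reg
  | inp | lam | tmp | prev | prev' | qd | qo | f₁ | f₂ | fail | mu | kk | ku | x | x' | y | y' | ge | gs
  | w | w' | sr | sl | er | el | br | bl | cur | up | bad | out | quit
  deriving DecidableEq

instance : Fintype Reg :=
  ⟨{.inp, .lam, .tmp, .prev, .prev', .qd, .qo, .f₁, .f₂, .fail, .mu, .kk, .ku, .x, .x', .y, .y',
    .ge, .gs, .w, .w', .sr, .sl, .er, .el, .br, .bl, .cur, .up, .bad, .out, .quit},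
    fun r => by cases r <;> decide⟩

/-- The stacks used for checking a word. -/
structure Zipper where
  (sr sl er el br bl cur up bad : List Γ')

/-- The contents of the stacks of the machine for Littlewood-Richardson coefficients. -/
structure Mem where
  (inp lam tmp prev prev' qd qo f₁ f₂ fail mu kk ku x x' y y' ge gs w w' out quit : List Γ')
  z : Zipper

/-- The content of a stack. -/
def Mem.get (M : Mem) : Stacks Reg
  | .inp => M.inp | .lam => M.lam | .tmp => M.tmp | .prev => M.prev | .prev' => M.prev'
  | .qd => M.qd | .qo => M.qo | .f₁ => M.f₁ | .f₂ => M.f₂ | .fail => M.fail | .mu => M.mu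
  | .kk => M.kk | .ku => M.ku | .x => M.x | .x' => M.x' | .y => M.y | .y' => M.y'
  | .ge => M.ge | .gs => M.gs | .w => M.w | .w' => M.w' | .out => M.out | .quit => M.quit
  | .sr => M.z.sr | .sl => M.z.sl | .er => M.z.er | .el => M.z.el | .br => M.z.br | .bl => M.z.bl
  | .cur => M.z.cur | .up => M.z.up | .bad => M.z.bad

/-! ### The state of the word checker -/

/-- The entries of the row above. -/
def aboveEntry (a : ℕ → ℕ → ℕ) : ℕ → ℕ → ℕ
  | 0, _ => 0
  | i + 1, m => a i m

/-- The meaning of the counters of the checker: for each letter its slack `s`, its remaining number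
of occurrences `e` and its number `b` of occurrences in the current or previous row, the number `c`
of occurrences of the current letter in the current row, and the room `u` below the previous row. -/
structure CheckInv (k r : ℕ) (g d : ℕ → ℕ) (a : ℕ → ℕ → ℕ) (i m : ℕ) (s e b : ℕ → ℕ) (c u : ℕ) :
    Prop where
  supp : ∀ i' m', (i < i' ∨ (i' = i ∧ m < m')) → a i' m' = 0
  rem : ∀ m', m' < r → e m' + colSum a (i + 1) m' = d m'
  slack_left : ∀ m', m' < r → m' ≤ m → s m' + colSum a (i + 1) m' = g m' + prevColSum a i m'
  slack_right : ∀ m', m' < r → m < m' → s m' + colSum a (i + 1) m' = g m' + prevColSum a (i - 1) m'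
  row_left : ∀ m', m' < r → m' < m → b m' = a i m'
  row_right : ∀ m', m' < r → m ≤ m' → b m' = aboveEntry a i m'
  cur : c = a i m
  room : u + rowSum a i (m + 1) = aboveSum k a i m

namespace CheckInv

variable {k r : ℕ} {g d : ℕ → ℕ} {a : ℕ → ℕ → ℕ} {i m : ℕ} {s e b : ℕ → ℕ} {c u : ℕ}

theorem init : CheckInv k r g d (fun _ _ => 0) 0 0 g d (fun _ => 0) 0 k := by
  have hp : ∀ i m', prevColSum (fun _ _ => 0) i m' = 0 := by
    rintro i ⟨⟩ <;> simp [prevColSum, colSum]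
  refine ⟨fun _ _ _ => rfl, ?_, ?_, ?_, fun _ _ _ => rfl, fun _ _ _ => rfl, rfl, ?_⟩
  all_goals simp [colSum, rowSum, hp, aboveSum]

/-- By the invariants the inequalities of `CanAdd` say that three counters are positive, which shows
on the tops of the stacks. -/
theorem canAdd_iff (h : CheckInv k r g d a i m s e b c u) (hm : m < r) :
    CanAdd k r g d a i m ↔ 0 < s m ∧ 0 < e m ∧ 0 < u := by
  have h1 := h.rem m hm
  have h2 := h.slack_left m hm le_rfl
  have h3 := h.room
  constructor
  · rintro ⟨_, h4, h5, h6⟩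
    omega
  · rintro ⟨h4, h5, h6⟩
    exact ⟨hm, by omega, by omega, by omega⟩

theorem add (h : CheckInv k r g d a i m s e b c u) (hm : m < r) (hs : 0 < s m) (he : 0 < e m)
    (hu : 0 < u) :
    CheckInv k r g d (addCell a i m) i m (Function.update s m (s m - 1))
      (Function.update e m (e m - 1)) b (c + 1) (u - 1) := by
  have hpre : ∀ j m', j ≤ i → prevColSum (addCell a i m) j m' = prevColSum a j m' := by
    intro j m' hj
    rw [prevColSum_addCell, if_neg (by omega), add_zero]
  have hcol : ∀ m', colSum (addCell a i m) (i + 1) m' =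
      colSum a (i + 1) m' + if m' = m then 1 else 0 := by
    intro m'
    rw [colSum_addCell]
    simp
  have hab : ∀ m', aboveEntry (addCell a i m) i m' = aboveEntry a i m' := by
    intro m'
    cases i <;> simp [aboveEntry, addCell]
  have has : aboveSum k (addCell a i m) i m = aboveSum k a i m := by
    cases i <;> simp [aboveSum, rowSum_addCell]
  refine ⟨fun i' m' h' => ?_, fun m' h' => ?_, fun m' h' hm' => ?_, fun m' h' hm' => ?_,
    fun m' h' hm' => ?_, fun m' h' hm' => ?_, ?_, ?_⟩
  · rw [addCell, h.supp i' m' h', if_neg (by omega)]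
  · have := h.rem m' h'
    rw [hcol]
    by_cases hmm : m' = m
    · subst hmm
      simp
      omega
    · simpa [hmm] using this
  · have := h.slack_left m' h' hm'
    rw [hcol, hpre i m' le_rfl]
    by_cases hmm : m' = m
    · subst hmm
      simp
      omega
    · simpa [hmm] using this
  · have := h.slack_right m' h' hm'
    rw [hcol, hpre (i - 1) m' (by omega)]
    simpa [hm'.ne'] using this
  · rw [h.row_left m' h' hm', addCell, if_neg (by omega), add_zero]
  · rw [h.row_right m' h' hm', hab]
  · rw [h.cur, addCell, if_pos ⟨rfl, rfl⟩]
  · have := h.room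
    rw [has, rowSum_addCell, if_pos ⟨rfl, by omega⟩]
    omega

/-- The letters `m` of row `i - 1` are credited only when the scan of row `i` passes `m`: they then
raise the slack of `m + 1` and the room in row `i`. This realises the delay by one row in the ballot
condition. The counter `b m` is then free to hold the number of letters `m` in row `i`, for use in
the next row. -/
theorem advance (h : CheckInv k r g d a i m s e b c u) (hm : m < r) :
    CheckInv k r g d a i (m + 1) (Function.update s (m + 1) (s (m + 1) + b m)) e
      (Function.update b m c) 0 (u + b m) := by
  have hb := h.row_right m hm le_rfl
  have h0 := h.supp i (m + 1) (by omega)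
  refine ⟨fun i' m' h' => h.supp i' m' (by omega), h.rem, fun m' h' hm' => ?_, fun m' h' hm' => ?_,
    fun m' h' hm' => ?_, fun m' h' hm' => ?_, h0.symm, ?_⟩
  · by_cases hmm : m' = m + 1
    · subst hmm
      have := h.slack_right _ h' (by omega)
      rw [Function.update_self]
      have hp : prevColSum a i (m + 1) = prevColSum a (i - 1) (m + 1) + b m := by
        rw [hb]
        cases i with
        | zero => simp [prevColSum, aboveEntry]
        | succ i => simp only [prevColSum, aboveEntry, Nat.add_sub_cancel, colSum_succ]
      omega
    · rw [Function.update_of_ne hmm]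
      exact h.slack_left m' h' (by omega)
  · rw [Function.update_of_ne (by omega)]
    exact h.slack_right m' h' (by omega)
  · by_cases hmm : m' = m
    · subst hmm
      rw [Function.update_self, h.cur]
    · rw [Function.update_of_ne hmm]
      exact h.row_left m' h' (by omega)
  · rw [Function.update_of_ne (by omega)]
    exact h.row_right m' h' (by omega)
  · have h1 := h.room
    rw [rowSum_succ, h0, hb]
    cases i with
    | zero =>
      simp only [aboveSum, aboveEntry] at *
      omega
    | succ i =>
      simp only [aboveSum, aboveEntry, rowSum_succ] at *
      omega

/-- Once all letters are passed, the slacks refer to the rows `< i`, as row `i + 1` expects for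
letters still to come. -/
theorem nextRow (h : CheckInv k r g d a i r s e b c u) :
    CheckInv k r g d a (i + 1) 0 s e b 0 0 := by
  have hz : ∀ m', a (i + 1) m' = 0 := fun m' => h.supp _ _ (by omega)
  refine ⟨fun i' m' h' => h.supp i' m' (by omega), fun m' h' => ?_, fun m' h' hm' => ?_,
    fun m' h' hm' => ?_, fun m' h' hm' => absurd hm' (Nat.not_lt_zero _), fun m' h' hm' => ?_,
    (hz 0).symm, ?_⟩
  · rw [colSum_succ, hz]
    exact h.rem m' h'
  · obtain rfl : m' = 0 := by omega
    rw [colSum_succ, hz]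
    exact h.slack_left 0 h' (by omega)
  · rw [colSum_succ, hz]
    exact h.slack_left m' h' h'.le
  · exact h.row_left m' h' h'
  · rw [rowSum_succ, hz]
    rfl

/-- The unary counters stay of size `O(k)`, so moving one of them costs `O(k)` steps. -/
theorem bound (h : CheckInv k r g d a i m s e b c u) (hd : ∀ m', m' < r → d m' ≤ k)
    (hg : ∀ m', m' < r → g m' ≤ k) {m' : ℕ} (hm' : m' < r) :
    s m' ≤ 2 * k ∧ e m' ≤ k ∧ b m' ≤ k := by
  have hcol : ∀ x, x < r → ∀ j, j ≤ i + 1 → colSum a j x ≤ k := fun x hx j hj => by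
    have h1 := h.rem x hx
    have h2 := hd x hx
    have h3 : colSum a j x ≤ colSum a (i + 1) x := colSum_mono a x hj
    omega
  have hprev : ∀ j, j ≤ i + 1 → prevColSum a j m' ≤ k := fun j hj => by
    cases m' with
    | zero => exact Nat.zero_le _
    | succ x => exact hcol x (by omega) j hj
  have hent : ∀ j, j ≤ i → a j m' ≤ k := fun j hj => by
    have := hcol m' hm' (j + 1) (by omega)
    rw [colSum_succ] at this
    omega
  refine ⟨?_, ?_, ?_⟩
  · rcases le_or_gt m' m with h1 | h1
    · have := h.slack_left m' hm' h1
      have := hprev i (by omega)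
      have := hg m' hm'
      omega
    · have := h.slack_right m' hm' h1
      have := hprev (i - 1) (by omega)
      have := hg m' hm'
      omega
  · have := h.rem m' hm'
    have := hd m' hm'
    omega
  · rcases lt_or_ge m' m with h1 | h1
    · rw [h.row_left m' hm' h1]
      exact hent i le_rfl
    · rw [h.row_right m' hm' h1]
      cases i with
      | zero => exact Nat.zero_le _
      | succ i => exact hent i (by omega)

theorem cur_le (h : CheckInv k r g d a i m s e b c u) (hd : ∀ m', m' < r → d m' ≤ k) (hm : m < r) :
    c ≤ k := by
  have h1 := h.rem m hm
  rw [colSum_succ, ← h.cur] at h1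
  have := hd m hm
  omega

theorem room_le (h : CheckInv k r g d a i m s e b c u) (hd : ∀ m', m' < r → d m' ≤ k)
    (hm : m ≤ r) : u ≤ k + m * k := by
  have h1 := h.room
  cases i with
  | zero =>
    simp only [aboveSum] at h1
    omega
  | succ i =>
    have h2 : rowSum a i m ≤ ∑ _x ∈ range m, k := sum_le_sum fun x hx => by
      have hx : x < m := mem_range.1 hx
      have h3 := h.rem x (by omega)
      have h4 := hd x (by omega)
      rw [colSum_succ, colSum_succ] at h3
      omega
    rw [sum_const, card_range, smul_eq_mul] at h2
    simp only [aboveSum] at h1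
    omega

end CheckInv

/-! ### The word checker -/

/-- The token of unary numbers. -/
abbrev tok : Γ' := Γ'.bit true

/-- The filler of digit blocks. -/
abbrev off : Γ' := Γ'.bit false

/-- A unary number followed by a comma. -/
def unary (n : ℕ) : List Γ' := List.replicate n tok ++ [Γ'.comma]

theorem unary_append (n : ℕ) (l : List Γ') :
    unary n ++ l = List.replicate n tok ++ Γ'.comma :: l := by
  simp [unary]

theorem reverse_unary (n : ℕ) : (unary n).reverse = Γ'.comma :: List.replicate n tok := by
  simp [unary]

theorem length_unary (n : ℕ) : (unary n).length = n + 1 := by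
  simp [unary]

namespace StackProg

/-- Advance to the next letter. -/
def advance : StackProg Reg :=
  seq (moveTo .sr (· = tok) [.sl]) <| seq (moveTo .er (· = tok) [.el]) <|
  seq (act fun _ k => match k with
    | .sr => (true, none) | .er => (true, none)
    | .sl => (false, some Γ'.comma) | .el => (false, some Γ'.comma)
    | _ => (false, none)) <|
  seq (drain .br (· = tok) fun _ k => match k with
    | .up => some tok | .sr => some tok | _ => none) <|
  seq (moveTo .cur (· = tok) [.bl]) <|
  act fun _ k => match k with
    | .br => (true, none) | .bl => (false, some Γ'.comma) | _ => (false, none)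

/-- Add a cell with the current letter. -/
def addToken : StackProg Reg :=
  act fun _ k => match k with
    | .sr => (true, none) | .er => (true, none) | .up => (true, none)
    | .cur => (false, some tok) | _ => (false, none)

/-- Return to the first letter. -/
def endRow : StackProg Reg :=
  seq (loop (fun t => (t .er).isSome) advance) <|
  seq (moveAll .sl [.sr]) <| seq (moveAll .el [.er]) <| seq (moveAll .bl [.br]) <| clear [.up]

/-- Report that the word is invalid. -/
def setBad : StackProg Reg :=
  act fun _ k => match k with | .bad => (false, some tok) | _ => (false, none)

/-- Move on to the next symbol of the word. -/
def nextSymbol : StackProg Reg :=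
  act fun t k => match k with | .w => (true, none) | .w' => (false, t .w) | _ => (false, none)

/-- Process the letter advances in one digit. -/
def checkDigit : StackProg Reg :=
  loop (fun t => t .w = some tok && t .bad = none)
    (ite (fun t => (t .er).isSome) (seq advance nextSymbol) setBad)

/-- Process one cell of the word. -/
def checkCell : StackProg Reg :=
  seq (moveTo .w (· = off) [.w']) <| seq checkDigit <|
  ite (fun t => t .bad = none)
    (ite (fun t => t .sr = some tok && t .er = some tok && t .up = some tok)
      (seq addToken <| seq (ite (fun t => t .w = some Γ'.ket) endRow skip) nextSymbol) setBad) skip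

/-- Check a word. -/
def checkWord : StackProg Reg :=
  seq (loop (fun t => (t .w).isSome && t .bad = none) checkCell) (moveAll .w [.w'])

end StackProg

open StackProg

/-- Replace the stacks of the checker. -/
abbrev Mem.setZ (M : Mem) (z : Zipper) : Mem := { M with z := z }

/-- The stacks of the checker at the letter `m`, with `n` letters to come. -/
def zipper (s e b : ℕ → ℕ) (c u m n : ℕ) (rest : List Γ') : Zipper where
  sr := blocks (fun x => unary (s x)) m n ++ rest
  sl := revBlocks (fun x => unary (s x)) m
  er := blocks (fun x => unary (e x)) m n
  el := revBlocks (fun x => unary (e x)) m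
  br := blocks (fun x => unary (b x)) m n
  bl := revBlocks (fun x => unary (b x)) m
  cur := List.replicate c tok
  up := List.replicate u tok
  bad := []

/-- After the comma of letter `m` has left `sr`, tokens pushed there land directly on the unary
slack of `m + 1`, so addition is mere pushing. Behind the last letter they land on `rest`, harmless
litter below the blocks of `sr`. -/
theorem runs_advance (M : Mem) (s e b : ℕ → ℕ) (c u m n : ℕ) (rest : List Γ') :
    ∃ rest', Runs advance (M.setZ (zipper s e b c u m (n + 1) rest)).get
      (M.setZ (zipper (Function.update s (m + 1) (s (m + 1) + b m)) e (Function.update b m c) 0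
        (u + b m) (m + 1) n rest')).get (2 * (s m + e m + b m + c) + 6) := by
  have hb : ∀ f : ℕ → ℕ, ∀ v, blocks (fun x => unary (Function.update f m v x)) (m + 1) n =
      blocks (fun x => unary (f x)) (m + 1) n := fun f v =>
    blocks_congr fun x h1 h2 => by simp only [Function.update_of_ne (show x ≠ m by omega)]
  have hb' : ∀ f : ℕ → ℕ, ∀ v, revBlocks (fun x => unary (Function.update f m v x)) m =
      revBlocks (fun x => unary (f x)) m := fun f v =>
    revBlocks_congr fun x h1 => by simp only [Function.update_of_ne (show x ≠ m by omega)]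
  have hs' : ∀ f : ℕ → ℕ, ∀ v, revBlocks (fun x => unary (Function.update f (m + 1) v x)) m =
      revBlocks (fun x => unary (f x)) m := fun f v =>
    revBlocks_congr fun x h1 => by simp only [Function.update_of_ne (show x ≠ m + 1 by omega)]
  have hs : ∃ rest', blocks (fun x => unary (Function.update s (m + 1) (s (m + 1) + b m) x)) (m + 1) n
      ++ rest' = List.replicate (b m) tok ++ (blocks (fun x => unary (s x)) (m + 1) n ++ rest) := by
    cases n with
    | zero => exact ⟨List.replicate (b m) tok ++ rest, by simp [blocks]⟩
    | succ n =>
      refine ⟨rest, ?_⟩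
      have h : blocks (fun x => unary (Function.update s (m + 1) (s (m + 1) + b m) x)) (m + 1 + 1) n =
          blocks (fun x => unary (s x)) (m + 1 + 1) n :=
        blocks_congr fun x h1 h2 => by simp only [Function.update_of_ne (show x ≠ m + 1 by omega)]
      simp only [blocks, Function.update_self]
      rw [h, add_comm, unary, unary, List.replicate_add]
      simp only [List.append_assoc]
  obtain ⟨rest', hrest⟩ := hs
  refine ⟨rest', ?_⟩
  refine (Runs.seq' (Runs.moved (List.replicate (s m) tok)
      (Γ'.comma :: (blocks (fun x => unary (s x)) (m + 1) n ++ rest)) ?_ ?_ ?_) <|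
    Runs.seq' (Runs.moved (List.replicate (e m) tok)
      (Γ'.comma :: (blocks (fun x => unary (e x)) (m + 1) n)) ?_ ?_ ?_) <|
    Runs.seq' (Runs.act _) <|
    Runs.seq' (Runs.drained (List.replicate (b m) tok)
      (Γ'.comma :: (blocks (fun x => unary (b x)) (m + 1) n)) ?_ ?_ ?_) <|
    Runs.seq' (Runs.moved (List.replicate c tok) [] ?_ ?_ ?_) (Runs.act _)).of_eq ?_ ?_
  case refine_14 => simp only [List.length_replicate]; omega
  case refine_13 =>
    rintro ⟨⟩ <;> simp [moved, drained, applyAct, edit, Mem.get, zipper, blocks, unary_append, reverse_unary, revBlocks, hb, hb', hs', hrest,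
      Nat.add_comm u (b m)]
  all_goals simp [moved, drained, applyAct, edit, Mem.get, zipper, blocks, unary_append]

theorem runs_addToken (M : Mem) {s e b : ℕ → ℕ} {c u m n : ℕ} {rest : List Γ'} (hs : 0 < s m)
    (he : 0 < e m) (hu : 0 < u) :
    Runs addToken (M.setZ (zipper s e b c u m (n + 1) rest)).get
      (M.setZ (zipper (Function.update s m (s m - 1)) (Function.update e m (e m - 1)) b (c + 1)
        (u - 1) m (n + 1) rest)).get 1 := by
  have hb : ∀ f : ℕ → ℕ, ∀ v, blocks (fun x => unary (Function.update f m v x)) (m + 1) n =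
      blocks (fun x => unary (f x)) (m + 1) n := fun f v =>
    blocks_congr fun x h1 h2 => by simp only [Function.update_of_ne (show x ≠ m by omega)]
  have hb' : ∀ f : ℕ → ℕ, ∀ v, revBlocks (fun x => unary (Function.update f m v x)) m =
      revBlocks (fun x => unary (f x)) m := fun f v =>
    revBlocks_congr fun x h1 => by simp only [Function.update_of_ne (show x ≠ m by omega)]
  obtain ⟨s', hs'⟩ := Nat.exists_eq_add_of_lt hs
  obtain ⟨e', he'⟩ := Nat.exists_eq_add_of_lt he
  obtain ⟨u', rfl⟩ := Nat.exists_eq_add_of_lt hu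
  rw [zero_add] at hs' he'
  refine Runs.act' ?_
  rintro ⟨⟩ <;> simp [edit, Mem.get, zipper, blocks, unary_append, hb, hb', hs', he',
    List.replicate_succ]

section check

variable {k r : ℕ} {g d : ℕ → ℕ} {a : ℕ → ℕ → ℕ}

theorem CheckInv.advance_cost {i m : ℕ} {s e b : ℕ → ℕ} {c u : ℕ}
    (h : CheckInv k r g d a i m s e b c u) (hd : ∀ m', m' < r → d m' ≤ k)
    (hg : ∀ m', m' < r → g m' ≤ k) (hm : m < r) :
    2 * (s m + e m + b m + c) + 6 ≤ 10 * k + 6 := by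
  have h1 := h.bound hd hg hm
  have h2 := h.cur_le hd hm
  omega

/-- The end of the letters is detected on `er`, since `sr` may carry litter. -/
theorem runs_advance_loop (hd : ∀ m', m' < r → d m' ≤ k) (hg : ∀ m', m' < r → g m' ≤ k) (M : Mem)
    {i n m : ℕ} (hmn : m + n + 1 = r) {s e b : ℕ → ℕ} {c u : ℕ} {rest : List Γ'}
    (h : CheckInv k r g d a i m s e b c u) :
    ∃ s' b' u' rest', Runs (loop (fun t => (t .er).isSome) advance)
      (M.setZ (zipper s e b c u m (n + 1) rest)).get (M.setZ (zipper s' e b' 0 u' r 0 rest')).get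
        ((n + 1) * (10 * k + 7) + 1) ∧ CheckInv k r g d a i r s' e b' 0 u' := by
  induction n generalizing m s b c u rest with
  | zero =>
    obtain ⟨rest', h1⟩ := runs_advance M s e b c u m 0 rest
    have h2 := h.advance (by omega)
    have h3 := h.advance_cost hd hg (by omega)
    rw [show m + 1 = r by omega] at h1 h2
    refine ⟨_, _, _, rest', (Runs.step ?_ (h1.mono h3) (Runs.done ?_)).mono (by omega), h2⟩
    · simp [tops, Mem.get, zipper, blocks, unary]
    · simp [tops, Mem.get, zipper, blocks]
  | succ n ih =>
    obtain ⟨rest', h1⟩ := runs_advance M s e b c u m (n + 1) rest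
    obtain ⟨s', b', u', rest'', h4, h5⟩ := ih (m := m + 1) (rest := rest') (by omega)
      (h.advance (by omega))
    have h3 := h.advance_cost hd hg (by omega)
    refine ⟨s', b', u', rest'', (Runs.step ?_ (h1.mono h3) h4).mono ?_, h5⟩
    · simp [tops, Mem.get, zipper, blocks, unary]
    · ring_nf
      omega

/-- At most `k` advances of cost `O(k)`, then the left stacks of total length `O(k^2)` are moved
back. -/
theorem runs_endRow (hrk : r ≤ k) (hd : ∀ m', m' < r → d m' ≤ k) (hg : ∀ m', m' < r → g m' ≤ k)
    (M : Mem) {i n m : ℕ} (hmn : m + n + 1 = r) {s e b : ℕ → ℕ} {c u : ℕ} {rest : List Γ'}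
    (h : CheckInv k r g d a i m s e b c u) :
    ∃ s' b' rest', Runs endRow
      (M.setZ (zipper s e b c u m (n + 1) rest)).get (M.setZ (zipper s' e b' 0 0 0 r rest')).get
        (25 * (k + 1) ^ 2) ∧ CheckInv k r g d a (i + 1) 0 s' e b' 0 0 := by
  obtain ⟨s', b', u', rest', h1, h2⟩ := runs_advance_loop hd hg M hmn h (rest := rest)
  refine ⟨s', b', rest', (Runs.seq' h1 <|
    Runs.seq' (Runs.movedAll (revBlocks (fun x => unary (s' x)) r) ?_) <|
    Runs.seq' (Runs.movedAll (revBlocks (fun x => unary (e x)) r) ?_) <|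
    Runs.seq' (Runs.movedAll (revBlocks (fun x => unary (b' x)) r) ?_) <|
    Runs.cleared (n := k + r * k) [Reg.up] ?_).of_eq ?_ ?_, h2.nextRow⟩
  case refine_5 =>
    rintro ⟨⟩ <;> simp [moved, cleared, Mem.get, zipper, blocks, reverse_revBlocks, revBlocks]
  case refine_6 =>
    have hb := fun x (hx : x < r) => h2.bound hd hg hx
    have e1 : (revBlocks (fun x => unary (s' x)) r).length ≤ r * (2 * k + 1) :=
      length_revBlocks_le fun x hx => by rw [length_unary]; have := hb x hx; omega
    have e2 : (revBlocks (fun x => unary (e x)) r).length ≤ r * (k + 1) :=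
      length_revBlocks_le fun x hx => by rw [length_unary]; have := hb x hx; omega
    have e3 : (revBlocks (fun x => unary (b' x)) r).length ≤ r * (k + 1) :=
      length_revBlocks_le fun x hx => by rw [length_unary]; have := hb x hx; omega
    have e4 : r * (2 * k + 1) ≤ k * (2 * k + 1) := Nat.mul_le_mul_right _ hrk
    have e5 : r * (k + 1) ≤ k * (k + 1) := Nat.mul_le_mul_right _ hrk
    have e6 : (n + 1) * (10 * k + 7) ≤ k * (10 * k + 7) := Nat.mul_le_mul_right _ (by omega)
    have e7 : r * k ≤ k * k := Nat.mul_le_mul_right _ hrk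
    simp only [List.length_singleton, one_mul]
    have e8 : 25 * (k + 1) ^ 2 = 25 * (k * k) + 50 * k + 25 := by ring
    have e9 : k * (2 * k + 1) = 2 * (k * k) + k := by ring
    have e10 : k * (k + 1) = k * k + k := by ring
    have e11 : k * (10 * k + 7) = 10 * (k * k) + 7 * k := by ring
    omega
  · simp [Mem.get, zipper]
  · simp [moved, Mem.get, zipper]
  · simp [moved, Mem.get, zipper]
  · simpa [moved, Mem.get, zipper] using h2.room_le hd le_rfl

/-! ### Checking words -/

section check

variable {k r : ℕ} {g d : ℕ → ℕ} {a : ℕ → ℕ → ℕ}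

/-- One advance per token, or a report when the letters run out. In either case the symbols read are
kept on `w'`, so the word can be restored for the odometer. -/
theorem runs_checkDigit (hd : ∀ m', m' < r → d m' ≤ k) (hg : ∀ m', m' < r → g m' ≤ k)
    {i : ℕ} {w : List Γ'} (hw : w.head? ≠ some tok) (y : ℕ) :
    ∀ (M : Mem) {n m : ℕ}, m + n = r → ∀ {s e b : ℕ → ℕ} {c u : ℕ} {rest : List Γ'},
    CheckInv k r g d a i m s e b c u →
    ∃ z w₁ w₁', Runs checkDigit
      { M with w := List.replicate y tok ++ w, z := zipper s e b c u m n rest }.get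
      { M with w := w₁, w' := w₁', z := z }.get (y * (10 * k + 9) + 4) ∧
      w₁'.reverse ++ w₁ = M.w'.reverse ++ (List.replicate y tok ++ w) ∧
      (y ≤ n → w₁ = w ∧ ∃ s' b' c' u' rest', z = zipper s' e b' c' u' (m + y) (n - y) rest' ∧
        CheckInv k r g d a i (m + y) s' e b' c' u') ∧
      (n < y → z.bad ≠ []) := by
  induction y with
  | zero =>
    intro M n m hmn s e b c u rest h
    refine ⟨_, w, M.w', (Runs.done ?_).of_eq (fun _ => rfl) (by omega), rfl,
      fun _ => ⟨rfl, s, b, c, u, rest, rfl, h⟩, fun hn => absurd hn (Nat.not_lt_zero _)⟩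
    simp [tops, Mem.get, zipper, hw]
  | succ y ih =>
    intro M n m hmn s e b c u rest h
    cases n with
    | zero =>
      refine ⟨{ zipper s e b c u m 0 rest with bad := [tok] }, List.replicate (y + 1) tok ++ w, M.w',
        (Runs.step (t₁ := 2) (t₂ := 1) ?_ (Runs.iteF ?_ (Runs.act' ?_)) (Runs.done ?_)).mono ?_, rfl,
        fun hn => absurd hn (by omega), fun _ => by simp⟩
      · simp [tops, Mem.get, zipper, List.replicate_succ]
      · simp [tops, Mem.get, zipper, blocks]
      · rintro ⟨⟩ <;> simp [edit, Mem.get, zipper]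
      · simp [tops, Mem.get]
      · omega
    | succ n =>
      obtain ⟨rest', h1⟩ := runs_advance { M with w := List.replicate (y + 1) tok ++ w }
        s e b c u m n rest
      have h3 := h.advance_cost hd hg (by omega)
      obtain ⟨z, w₁, w₁', h4, h5, h6, h7⟩ := ih { M with w' := tok :: M.w' } (n := n) (m := m + 1)
        (rest := rest') (by omega) (h.advance (by omega))
      unfold checkDigit at h4
      refine ⟨z, w₁, w₁', (Runs.step ?_ (Runs.iteT ?_ (Runs.seq' (h1.mono h3)
        (Runs.act' (S' := { M with
          w := List.replicate y tok ++ w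
          w' := tok :: M.w'
          z := (zipper (Function.update s (m + 1) (s (m + 1) + b m)) e (Function.update b m c) 0
            (u + b m) (m + 1) n rest') }.get) ?_))) h4).mono ?_, ?_, ?_, fun hn => h7 (by omega)⟩
      · simp [tops, Mem.get, zipper, List.replicate_succ]
      · simp [tops, Mem.get, zipper, blocks, unary]
      · rintro ⟨⟩ <;> simp [edit, Mem.get, tops, List.replicate_succ]
      · ring_nf
        omega
      · rw [h5]
        simp [List.replicate_succ]
      · intro hn
        obtain ⟨h8, s', b', c', u', r', h9, h10⟩ := h6 (by omega)
        rw [show m + 1 + y = m + (y + 1) by omega] at h9 h10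
        rw [show n - y = n + 1 - (y + 1) by omega] at h9
        exact ⟨h8, s', b', c', u', r', h9, h10⟩

/-- The end mark of a cell. -/
def cellMark (f : Bool) : Γ' := if f then Γ'.ket else Γ'.comma

/-- The encoding of a word with digits at most `k`. -/
def encodeWord (k : ℕ) : List ℕ → List Bool → List Γ'
  | y :: w, f :: fs =>
    List.replicate (k - y) off ++ (List.replicate y tok ++ cellMark f :: encodeWord k w fs)
  | _, _ => []

theorem runs_checkCell (hrk : r ≤ k) (hd : ∀ m', m' < r → d m' ≤ k)
    (hg : ∀ m', m' < r → g m' ≤ k) {i y : ℕ} {w : List Γ'} {f : Bool} (hy : y ≤ k)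
    (M : Mem) {n m : ℕ} (hmn : m + n = r) {s e b : ℕ → ℕ} {c u : ℕ} {rest : List Γ'}
    (h : CheckInv k r g d a i m s e b c u) :
    ∃ z w₁ w₁', Runs checkCell
      { M with
        w := List.replicate (k - y) off ++ (List.replicate y tok ++ cellMark f :: w)
        z := zipper s e b c u m n rest }.get
      { M with w := w₁, w' := w₁', z := z }.get (50 * (k + 1) ^ 2) ∧
      w₁'.reverse ++ w₁ = M.w'.reverse ++
        (List.replicate (k - y) off ++ (List.replicate y tok ++ cellMark f :: w)) ∧
      (¬ CanAdd k r g d a i (m + y) → z.bad ≠ []) ∧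
      (CanAdd k r g d a i (m + y) → w₁ = w ∧ ∃ s' e' b' c' u' m' n' rest',
        z = zipper s' e' b' c' u' m' n' rest' ∧ m' + n' = r ∧ m' = (if f then 0 else m + y) ∧
        CheckInv k r g d (addCell a i (m + y)) (if f then i + 1 else i) m' s' e' b' c' u') := by
  obtain ⟨z, w₁, w₁', h1, h2, h3, h4⟩ := runs_checkDigit hd hg (i := i) (a := a)
    (w := cellMark f :: w) (by cases f <;> simp [cellMark]) y
    { M with w' := List.replicate (k - y) off ++ M.w' } hmn (rest := rest) h
  have h0 : Runs (moveTo .w (· = off) [.w'])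
      { M with
        w := List.replicate (k - y) off ++ (List.replicate y tok ++ cellMark f :: w)
        z := zipper s e b c u m n rest }.get
      { M with
        w := List.replicate y tok ++ cellMark f :: w
        w' := List.replicate (k - y) off ++ M.w'
        z := zipper s e b c u m n rest }.get (2 * k + 1) := by
    refine (Runs.moved (List.replicate (k - y) off) (List.replicate y tok ++ cellMark f :: w)
      ?_ ?_ ?_).of_eq ?_ ?_
    · simp [Mem.get]
    · simp
    · cases y <;> cases f <;> simp [cellMark, List.replicate_succ]
    · rintro ⟨⟩ <;> simp [moved, Mem.get]
    · simp
  have h2' : w₁'.reverse ++ w₁ = M.w'.reverse ++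
      (List.replicate (k - y) off ++ (List.replicate y tok ++ cellMark f :: w)) := by
    rw [h2]
    simp
  have hk2 : y * (10 * k + 9) ≤ k * (10 * k + 9) := Nat.mul_le_mul_right _ hy
  have e1 : 50 * (k + 1) ^ 2 = 50 * (k * k) + 100 * k + 50 := by ring
  have e2 : k * (10 * k + 9) = 10 * (k * k) + 9 * k := by ring
  have e3 : 25 * (k + 1) ^ 2 = 25 * (k * k) + 50 * k + 25 := by ring
  by_cases hy' : y ≤ n
  · obtain ⟨rfl, s', b', c', u', rest', rfl, h5⟩ := h3 hy'
    have hbad : (zipper s' e b' c' u' (m + y) (n - y) rest').bad = [] := rfl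
    by_cases hc : CanAdd k r g d a i (m + y)
    · have hlt := hc.lt
      obtain ⟨p1, p2, p3⟩ := (h5.canAdd_iff hlt).1 hc
      obtain ⟨n', hn'⟩ : ∃ n', n - y = n' + 1 := ⟨n - y - 1, by omega⟩
      rw [hn'] at h1
      have h6 := h5.add hlt p1 p2 p3
      have h7 := runs_addToken { M with w := cellMark f :: w, w' := w₁' } (s := s') (e := e) (b := b')
        (c := c') (n := n') (rest := rest') p1 p2 p3
      obtain ⟨s1, hs1⟩ := Nat.exists_eq_add_of_lt p1
      obtain ⟨e4, he4⟩ := Nat.exists_eq_add_of_lt p2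
      obtain ⟨u1, hu1⟩ := Nat.exists_eq_add_of_lt p3
      rw [zero_add] at hs1 he4 hu1
      cases f with
      | false =>
        refine ⟨zipper (Function.update s' (m + y) (s' (m + y) - 1))
          (Function.update e (m + y) (e (m + y) - 1)) b' (c' + 1) (u' - 1) (m + y) (n' + 1) rest',
          w, Γ'.comma :: w₁', Runs.mono (Runs.seq' h0 <| Runs.seq' h1 <| Runs.iteT ?_ <| Runs.iteT ?_ <|
          Runs.seq' h7 <| Runs.seq' (Runs.iteF ?_ Runs.skip) (Runs.act' ?_)) ?_, ?_, fun hh => absurd hc hh, fun _ =>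
          ⟨rfl, _, _, _, _, _, m + y, n' + 1, rest', rfl, by omega, rfl, h6⟩⟩
        · simp [tops, Mem.get, zipper]
        · simp [tops, Mem.get, zipper, blocks, unary_append, hs1, he4, hu1, List.replicate_succ]
        · simp [tops, Mem.get, cellMark]
        · rintro ⟨⟩ <;> simp [edit, Mem.get, tops, cellMark]
        · omega
        · rw [← h2']
          simp [cellMark]
      | true =>
        obtain ⟨s'', b'', rest'', h8, h9⟩ := runs_endRow hrk hd hg
          { M with w := cellMark true :: w, w' := w₁' } (show m + y + n' + 1 = r by omega)
          (rest := rest') h6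
        refine ⟨zipper s'' (Function.update e (m + y) (e (m + y) - 1)) b'' 0 0 0 r rest'', w, Γ'.ket :: w₁', Runs.mono (Runs.seq' h0 <| Runs.seq' h1 <| Runs.iteT ?_ <| Runs.iteT ?_ <|
          Runs.seq' h7 <| Runs.seq' (Runs.iteT ?_ h8) (Runs.act' ?_)) ?_, ?_, fun hh => absurd hc hh, fun _ =>
          ⟨rfl, _, _, _, _, _, 0, r, rest'', rfl, by omega, rfl, h9⟩⟩
        · simp [tops, Mem.get, zipper]
        · simp [tops, Mem.get, zipper, blocks, unary_append, hs1, he4, hu1, List.replicate_succ]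
        · simp [tops, Mem.get, cellMark]
        · rintro ⟨⟩ <;> simp [edit, Mem.get, tops, cellMark]
        · omega
        · rw [← h2']
          simp [cellMark]
    · refine ⟨{ zipper s' e b' c' u' (m + y) (n - y) rest' with bad := [tok] }, cellMark f :: w, w₁',
        Runs.mono (Runs.seq' h0 <| Runs.seq' h1 <| Runs.iteT ?_ <| Runs.iteF ?_ <| Runs.act' ?_) ?_, h2',
        fun _ => by simp, fun hh => absurd hh hc⟩
      · simp [tops, Mem.get, zipper]
      -- Either one of the three counters of the current letter is zero, or all letters are passed
      -- and `er` is empty.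
      · rcases Nat.lt_or_ge (m + y) r with hlt | hge
        · obtain ⟨n', hn'⟩ : ∃ n', n - y = n' + 1 := ⟨n - y - 1, by omega⟩
          have hc' := fun hh => hc ((h5.canAdd_iff hlt).2 hh)
          rw [hn']
          rcases hs1 : s' (m + y) with _ | s1
          · simp [tops, Mem.get, zipper, blocks, unary_append, hs1]
          · rcases he1 : e (m + y) with _ | e4
            · simp [tops, Mem.get, zipper, blocks, unary_append, he1]
            · obtain rfl : u' = 0 := Nat.eq_zero_of_not_pos fun hu => hc' ⟨by omega, by omega, hu⟩
              simp [tops, Mem.get, zipper]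
        · rw [show n - y = 0 by omega]
          simp [tops, Mem.get, zipper, blocks]
      · rintro ⟨⟩ <;> simp [edit, Mem.get, zipper]
      · omega
  · have hbad := h4 (by omega)
    refine ⟨z, w₁, w₁', Runs.mono (Runs.seq' h0 <| Runs.seq' h1 <| Runs.iteF ?_ Runs.skip) ?_, h2',
      fun _ => hbad, fun hh => ?_⟩
    · simpa [tops, Mem.get] using hbad
    · omega
    · have := hh.lt
      omega

theorem runs_checkCell_loop (hrk : r ≤ k) (hd : ∀ m', m' < r → d m' ≤ k)
    (hg : ∀ m', m' < r → g m' ≤ k) (w : List ℕ) :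
    ∀ (fs : List Bool), w.length = fs.length → (∀ y ∈ w, y ≤ k) → ∀ (M : Mem) {a : ℕ → ℕ → ℕ}
    {i n m : ℕ}, m + n = r → ∀ {s e b : ℕ → ℕ} {c u : ℕ} {rest : List Γ'},
    CheckInv k r g d a i m s e b c u →
    ∃ z w₁ w₁', Runs (loop (fun t => (t .w).isSome && t .bad = none) checkCell)
      { M with w := encodeWord k w fs, z := zipper s e b c u m n rest }.get
      { M with w := w₁, w' := w₁', z := z }.get (w.length * (50 * (k + 1) ^ 2 + 1) + 1) ∧
      w₁'.reverse ++ w₁ = M.w'.reverse ++ encodeWord k w fs ∧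
      (z.bad = [] ↔ WordValid k r g d a i m w fs) := by
  induction w with
  | nil =>
    intro fs hl _ M a i n m _ s e b c u rest _
    obtain rfl : fs = [] := List.eq_nil_of_length_eq_zero hl.symm
    refine ⟨zipper s e b c u m n rest, [], M.w', Runs.of_eq (Runs.done ?_) (fun _ => rfl) (by simp), rfl,
      by simp [zipper, WordValid]⟩
    simp [tops, Mem.get, encodeWord]
  | cons y w ih =>
    intro fs hl hy M a i n m hmn s e b c u rest h
    obtain _ | ⟨f, fs⟩ := fs
    · simp at hl
    obtain ⟨z, w₁, w₁', h1, h2, h3, h4⟩ := runs_checkCell hrk hd hg (w := encodeWord k w fs) (f := f)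
      (hy y (by simp)) M hmn (rest := rest) h
    have htest : ((tops { M with
        w := encodeWord k (y :: w) (f :: fs), z := zipper s e b c u m n rest }.get .w).isSome &&
        (tops { M with
          w := encodeWord k (y :: w) (f :: fs), z := zipper s e b c u m n rest }.get .bad = none :
            Bool)) = true := by
      have : encodeWord k (y :: w) (f :: fs) ≠ [] := by simp [encodeWord]
      simp [tops, Mem.get, zipper, List.isSome_head?, this]
    by_cases hc : CanAdd k r g d a i (m + y)
    · obtain ⟨rfl, s', e', b', c', u', m', n', rest', rfl, h5, h6, h7⟩ := h4 hc
      obtain ⟨z, w₂, w₂', h8, h9, h10⟩ := ih fs (by simpa using hl)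
        (fun x hx => hy x (List.mem_cons_of_mem _ hx)) { M with w' := w₁' } h5 (rest := rest') h7
      refine ⟨z, w₂, w₂', Runs.mono (Runs.step htest h1 h8) ?_, ?_, ?_⟩
      · rw [List.length_cons, add_one_mul]
        omega
      · rw [h9, h2]
        rfl
      · rw [h10, WordValid]
        cases f <;> simp [hc, h6]
    · have hz := h3 hc
      refine ⟨z, w₁, w₁', Runs.mono (Runs.step htest h1 (Runs.done ?_)) ?_, h2, ?_⟩
      · simp [tops, Mem.get, hz]
      · rw [List.length_cons, add_one_mul]
        omega
      · rw [WordValid]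
        simp [hc, hz]

theorem length_encodeWord {w : List ℕ} : ∀ {fs : List Bool}, w.length = fs.length →
    (∀ y ∈ w, y ≤ k) → (encodeWord k w fs).length = w.length * (k + 1) := by
  induction w with
  | nil => simp [encodeWord]
  | cons y w ih =>
    intro fs hl hy
    obtain _ | ⟨f, fs⟩ := fs
    · simp at hl
    have := ih (fs := fs) (by simpa using hl) fun x hx => hy x (List.mem_cons_of_mem _ hx)
    have := hy y (by simp)
    simp only [encodeWord, List.length_append, List.length_replicate, List.length_cons]
    rw [add_one_mul]
    omega

/-- Even after an early stop the unread rest of the word follows the read part onto `w'`, so nothing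
is lost. -/
theorem runs_checkWord (hrk : r ≤ k) (hd : ∀ m', m' < r → d m' ≤ k)
    (hg : ∀ m', m' < r → g m' ≤ k) {w : List ℕ} {fs : List Bool} (hl : w.length = fs.length)
    (hw : ∀ y ∈ w, y ≤ k) (M : Mem) (rest : List Γ') :
    ∃ z, Runs checkWord
      { M with w := encodeWord k w fs, w' := [], z := zipper g d (fun _ => 0) 0 k 0 r rest }.get
      { M with w := [], w' := (encodeWord k w fs).reverse, z := z }.get
        (w.length * (60 * (k + 1) ^ 2) + 2) ∧
      (z.bad = [] ↔ WordValid k r g d (fun _ _ => 0) 0 0 w fs) := by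
  obtain ⟨z, w₁, w₁', h1, h2, h3⟩ := runs_checkCell_loop hrk hd hg w fs hl hw { M with w' := [] }
    (zero_add r) (rest := rest) CheckInv.init
  rw [List.reverse_nil, List.nil_append] at h2
  refine ⟨z, Runs.mono (Runs.seq' h1 (Runs.moveAll w₁ ?_ ?_ ?_)) ?_, h3⟩
  · simp [Mem.get]
  · simp [Mem.get]
  · rintro ⟨⟩ <;> simp [Mem.get, ← h2]
  · have h4 := congrArg List.length h2
    rw [List.length_append, length_encodeWord hl hw] at h4
    have h5 : w.length * (60 * (k + 1) ^ 2) = w.length * (50 * (k + 1) ^ 2 + 1) + w.length * (2 * (k + 1))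
        + w.length * (10 * k ^ 2 + 18 * k + 7) := by ring
    have h6 : w.length * (2 * (k + 1)) = 2 * (w.length * (k + 1)) := by ring
    omega

end check

/-! ### Binary numbers -/

theorem encodePosNum_eq_bits (p : PosNum) : encodePosNum p = Nat.bits (p : ℕ) := by
  induction p with
  | one => simp [encodePosNum]
  | bit1 p ih =>
    rw [encodePosNum, ih, PosNum.cast_bit1, ← two_mul, Nat.bit1_bits]
  | bit0 p ih =>
    rw [encodePosNum, ih, PosNum.cast_bit0, ← two_mul, Nat.bit0_bits]
    exact (PosNum.cast_pos p).ne'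

theorem encodeNat_eq_bits (n : ℕ) : encodeNat n = n.bits := by
  rw [encodeNat]
  conv_rhs => rw [← Num.to_of_nat n]
  rcases (n : Num) with _ | p
  · simp [encodeNum]
  · rw [encodeNum, encodePosNum_eq_bits]
    rfl

/-- The symbols for a list of bits. -/
def bitSyms (l : List Bool) : List Γ' := l.map Γ'.bit

theorem encodingNatΓ'_encode (n : ℕ) : encodingNatΓ'.encode n = bitSyms n.bits := by
  rw [← encodeNat_eq_bits]
  rfl

/-- Add one to a binary number. -/
def incBits : List Bool → List Bool
  | [] => [true]
  | false :: l => true :: l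
  | true :: l => false :: incBits l

theorem bits_succ (n : ℕ) : (n + 1).bits = incBits n.bits := by
  induction n using Nat.strong_induction_on with
  | _ n ih =>
    rcases Nat.even_or_odd' n with ⟨m, rfl | rfl⟩
    · rw [Nat.bit1_bits]
      rcases Nat.eq_zero_or_pos m with rfl | hm
      · simp [incBits]
      · rw [Nat.bit0_bits m hm.ne', incBits]
    · rw [Nat.bit1_bits, incBits, ← ih m (by omega), ← Nat.bit0_bits _ (Nat.succ_ne_zero m)]
      congr 1

/-- The carry made explicit: the leading ones become zeros, and the next bit, possibly absent,
becomes one. The program `count` follows this description. -/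
theorem incBits_eq (l : List Bool) : ∃ j rest, l = List.replicate j true ++ rest ∧
    rest.head? ≠ some true ∧ incBits l = List.replicate j false ++ true :: rest.tail := by
  induction l with
  | nil => exact ⟨0, [], by simp [incBits]⟩
  | cons b l ih =>
    cases b with
    | false => exact ⟨0, false :: l, by simp [incBits]⟩
    | true =>
      obtain ⟨j, rest, h1, h2, h3⟩ := ih
      exact ⟨j + 1, rest, by simp [List.replicate_succ, ← h1], h2,
        by simp [incBits, h3, List.replicate_succ]⟩

namespace StackProg

/-- Add one to the output. -/
def count : StackProg Reg :=
  seq (drain .out (· = tok) fun _ k => match k with | .tmp => some off | _ => none) <|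
  seq (act fun _ k => match k with | .out => (true, some tok) | _ => (false, none)) <|
  moveAll .tmp [.out]

end StackProg

theorem runs_count (M : Mem) (l : List Bool) :
    Runs count { M with out := bitSyms l, tmp := [] }.get
      { M with out := bitSyms (incBits l), tmp := [] }.get (4 * l.length + 3) := by
  obtain ⟨j, rest, rfl, h2, h3⟩ := incBits_eq l
  refine Runs.of_eq (Runs.seq' (Runs.drained (List.replicate j tok) (bitSyms rest) ?_ ?_ ?_) <|
    Runs.seq' (Runs.act _) (Runs.movedAll (List.replicate j off) ?_)) ?_ ?_
  · simp [Mem.get, bitSyms]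
  · simp
  · rcases rest with _ | ⟨_ | _, rest⟩ <;> simp_all [bitSyms]
  · simp [applyAct, drained, edit, Mem.get]
  · rw [h3]
    rintro ⟨⟩ <;> simp [applyAct, drained, moved, edit, Mem.get, bitSyms]
  · simp
    omega

/-! ### The odometer -/

/-- The digits of `j` to the base `B`, least significant first, as a word of length `n`. -/
def wordOf (B : ℕ) : ℕ → ℕ → List ℕ
  | 0, _ => []
  | n + 1, j => j % B :: wordOf B n (j / B)

theorem length_wordOf (B n j : ℕ) : (wordOf B n j).length = n := by
  induction n generalizing j with
  | zero => rfl
  | succ n ih => simp [wordOf, ih]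

theorem wordOf_le (k n j : ℕ) : ∀ y ∈ wordOf (k + 1) n j, y ≤ k := by
  induction n generalizing j with
  | zero => simp [wordOf]
  | succ n ih =>
    intro y hy
    rcases List.mem_cons.1 hy with rfl | hy
    · exact Nat.le_of_lt_succ (Nat.mod_lt _ (Nat.succ_pos k))
    · exact ih _ y hy

theorem sum_range_mul (B N : ℕ) (f : ℕ → ℕ) :
    ∑ j ∈ range (B * N), f j = ∑ q ∈ range N, ∑ y ∈ range B, f (B * q + y) := by
  induction N with
  | zero => simp
  | succ N ih => rw [Nat.mul_succ, sum_range_add, sum_range_succ, ih]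

/-- Writing `j = B * q + y`, the first digit `y` is the least significant one. -/
theorem wordSum_eq_sum_range {B : ℕ} (hB : 0 < B) (n : ℕ) (F : List ℕ → ℕ) :
    wordSum B n F = ∑ j ∈ range (B ^ n), F (wordOf B n j) := by
  induction n generalizing F with
  | zero => simp [wordSum, wordOf]
  | succ n ih =>
    rw [wordSum, pow_succ', sum_range_mul, sum_comm]
    refine sum_congr rfl fun y hy => ?_
    rw [ih]
    refine sum_congr rfl fun q _ => ?_
    have hy := mem_range.1 hy
    rw [wordOf, Nat.mul_add_mod, Nat.mod_eq_of_lt hy, Nat.mul_add_div hB, Nat.div_eq_of_lt hy,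
      add_zero]

namespace StackProg

/-- Increment one digit, with carry. -/
def incrementDigit : StackProg Reg :=
  seq (moveTo .w (· = off) [.w']) <|
  ite (fun t => t .w' = some off)
    (act fun _ k => match k with
      | .w' => (true, none) | .w => (false, some tok) | .quit => (false, some tok) | _ => (false, none))
    (seq (drain .w (· = tok) fun _ k => match k with | .w' => some off | _ => none) nextSymbol)

/-- Pass to the next word. -/
def increment : StackProg Reg :=
  seq (loop (fun t => (t .w).isSome && t .quit = none) incrementDigit) <|
  seq (act fun t k => match k with
    | .quit => (true, if t .quit = none then some tok else none) | _ => (false, none)) <|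
  moveAll .w' [.w]

end StackProg

/-- Because of the hypothesis on the top of `w'`, a filler found there after skipping the fillers of
a digit means that the digit is below `k`. It is then raised and `quit` stops the loop; otherwise
the digit becomes zero and the carry goes on. After the last word all digits wrap around and `quit`
stays empty. -/
theorem runs_incrementDigit_loop (k n : ℕ) :
    ∀ (fs : List Bool), fs.length = n → ∀ (j : ℕ), j < (k + 1) ^ n → ∀ M : Mem,
    M.w'.head? ≠ some off →
    ∃ w₁ w₁', Runs (loop (fun t => (t .w).isSome && t .quit = none) incrementDigit)
      { M with w := encodeWord k (wordOf (k + 1) n j) fs, quit := [] }.get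
      { M with w := w₁, w' := w₁', quit := if j + 1 < (k + 1) ^ n then [tok] else [] }.get
        (n * (2 * k + 5) + 1) ∧
      w₁.length + w₁'.length = M.w'.length + n * (k + 1) ∧
      (j + 1 < (k + 1) ^ n →
        w₁'.reverse ++ w₁ = M.w'.reverse ++ encodeWord k (wordOf (k + 1) n (j + 1)) fs) := by
  induction n with
  | zero =>
    intro fs hfs j hj M hM
    refine ⟨[], M.w', Runs.of_eq (Runs.done ?_) ?_ (by simp), by simp, fun h => ?_⟩
    · simp [tops, Mem.get, wordOf, encodeWord]
    · rintro ⟨⟩ <;> simp [Mem.get, wordOf, encodeWord]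
    · simp at h
  | succ n ih =>
    intro fs hfs j hj M hM
    obtain _ | ⟨f, fs⟩ := fs
    · simp at hfs
    have hfs : fs.length = n := by simpa using hfs
    have hy := Nat.mod_lt j (Nat.succ_pos k)
    have hdm := Nat.div_add_mod j (k + 1)
    have hq : j / (k + 1) < (k + 1) ^ n := by
      rw [Nat.div_lt_iff_lt_mul (Nat.succ_pos k), ← pow_succ]
      exact hj
    have hlenfs := length_encodeWord (k := k) (w := wordOf (k + 1) n (j / (k + 1))) (fs := fs)
      (by rw [length_wordOf, hfs]) (wordOf_le k n _)
    rw [length_wordOf] at hlenfs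
    set y := j % (k + 1) with hyd
    set q := j / (k + 1) with hqd
    rw [wordOf, ← hyd, ← hqd, encodeWord]
    have hmove : Runs (moveTo .w (· = off) [.w'])
        { M with
          w := List.replicate (k - y) off ++
            (List.replicate y tok ++ cellMark f :: encodeWord k (wordOf (k + 1) n q) fs)
          quit := [] }.get
        { M with
          w := List.replicate y tok ++ cellMark f :: encodeWord k (wordOf (k + 1) n q) fs
          w' := List.replicate (k - y) off ++ M.w'
          quit := [] }.get (2 * (k - y) + 1) := by
      refine Runs.of_eq (Runs.moved (List.replicate (k - y) off)
        (List.replicate y tok ++ cellMark f :: encodeWord k (wordOf (k + 1) n q) fs) ?_ ?_ ?_) ?_ ?_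
      · simp [Mem.get]
      · simp
      · cases y <;> cases f <;> simp [cellMark, List.replicate_succ]
      · rintro ⟨⟩ <;> simp [moved, Mem.get]
      · simp
    have htest : ∀ l : List Γ', ((tops { M with w := List.replicate (k - y) off ++
          (List.replicate y tok ++ cellMark f :: l), quit := [] }.get .w).isSome &&
        (tops { M with w := List.replicate (k - y) off ++
          (List.replicate y tok ++ cellMark f :: l), quit := [] }.get .quit = none : Bool)) = true := by
      intro l
      simp [tops, Mem.get]
    rcases Nat.lt_succ_iff_lt_or_eq.1 hy with hyk | hyk
    · have hj1 : j + 1 < (k + 1) ^ (n + 1) := by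
        rw [pow_succ']
        have : (k + 1) * (q + 1) ≤ (k + 1) * (k + 1) ^ n := Nat.mul_le_mul_left _ hq
        rw [Nat.mul_succ] at this
        omega
      obtain ⟨x, hx⟩ : ∃ x, k - y = x + 1 := ⟨k - y - 1, by omega⟩
      refine ⟨tok :: (List.replicate y tok ++ cellMark f :: encodeWord k (wordOf (k + 1) n q) fs),
        List.replicate x off ++ M.w', Runs.mono (Runs.step (htest _) (Runs.seq' hmove
          (Runs.iteT ?_ (Runs.act _))) (Runs.of_eq (Runs.done ?_) ?_ le_rfl)) ?_, ?_, fun _ => ?_⟩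
      · simp [tops, Mem.get, hx, List.replicate_succ]
      · simp [applyAct, tops, Mem.get, edit]
      · rintro ⟨⟩ <;> simp [applyAct, Mem.get, edit, hx, hj1, List.replicate_succ]
      · have := Nat.zero_le (n * (2 * k + 5))
        rw [add_one_mul]
        omega
      · simp only [List.length_cons, List.length_append, List.length_replicate, hlenfs]
        rw [add_one_mul]
        omega
      · have e1 : (j + 1) % (k + 1) = y + 1 := by
          rw [show j + 1 = (k + 1) * q + (y + 1) by omega, Nat.mul_add_mod,
            Nat.mod_eq_of_lt (by omega)]
        have e2 : (j + 1) / (k + 1) = q := by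
          rw [show j + 1 = (k + 1) * q + (y + 1) by omega, Nat.mul_add_div (Nat.succ_pos k),
            Nat.div_eq_of_lt (by omega), add_zero]
        rw [wordOf, e1, e2, encodeWord, show k - (y + 1) = x by omega]
        simp [List.replicate_succ]
    · obtain ⟨w₁, w₁', h1, h2, h3⟩ := ih fs hfs q hq
        { M with w' := cellMark f :: (List.replicate k off ++ M.w') } (by cases f <;> simp [cellMark])
      have hiff : q + 1 < (k + 1) ^ n ↔ j + 1 < (k + 1) ^ (n + 1) := by
        rw [show j + 1 = (k + 1) * (q + 1) by rw [Nat.mul_succ]; omega, pow_succ']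
        exact (Nat.mul_lt_mul_left (Nat.succ_pos k)).symm
      refine ⟨w₁, w₁', Runs.mono (Runs.step (htest _) (Runs.seq' hmove (Runs.iteF ?_ (Runs.seq'
        (Runs.drained (List.replicate y tok) (cellMark f :: encodeWord k (wordOf (k + 1) n q) fs)
          ?_ ?_ ?_) (Runs.act' ?_))))
        (h1.of_eq ?_ le_rfl)) ?_, ?_, fun hlt => ?_⟩
      · simp [tops, Mem.get, hyk, hM]
      · simp [Mem.get]
      · simp
      · cases f <;> simp [cellMark]
      · rintro ⟨⟩ <;> simp [edit, tops, drained, Mem.get, hyk]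
      · rintro ⟨⟩ <;> simp [Mem.get, hiff]
      · rw [List.length_replicate, add_one_mul]
        omega
      · rw [h2]
        simp only [List.length_cons, List.length_append, List.length_replicate]
        rw [add_one_mul]
        omega
      · rw [h3 (hiff.2 hlt)]
        have e1 : (j + 1) % (k + 1) = 0 := by
          rw [show j + 1 = (k + 1) * (q + 1) by rw [Nat.mul_succ]; omega, Nat.mul_mod_right]
        have e2 : (j + 1) / (k + 1) = q + 1 := by
          rw [show j + 1 = (k + 1) * (q + 1) by rw [Nat.mul_succ]; omega,
            Nat.mul_div_cancel_left _ (Nat.succ_pos k)]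
        rw [wordOf, e1, e2, encodeWord]
        simp

/-- The meaning of `quit` is reversed at the end: within the loop a token says that the carry is
settled, afterwards that the words are exhausted. -/
theorem runs_increment {k n : ℕ} {fs : List Bool} (hfs : fs.length = n) {j : ℕ}
    (hj : j < (k + 1) ^ n) (M : Mem) :
    ∃ w, Runs increment
      { M with w := encodeWord k (wordOf (k + 1) n j) fs, w' := [], quit := [] }.get
      { M with w := w, w' := [], quit := if j + 1 < (k + 1) ^ n then [] else [tok] }.get
        (n * (4 * k + 7) + 3) ∧
      (j + 1 < (k + 1) ^ n → w = encodeWord k (wordOf (k + 1) n (j + 1)) fs) := by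
  obtain ⟨w₁, w₁', h1, h2, h3⟩ := runs_incrementDigit_loop k n fs hfs j hj { M with w' := [] } (by simp)
  refine ⟨w₁'.reverse ++ w₁, Runs.of_eq (Runs.seq' h1 (Runs.seq' (Runs.act _)
    (Runs.movedAll w₁' ?_))) ?_ ?_, by simpa using h3⟩
  · simp [applyAct, edit, Mem.get]
  · by_cases hlt : j + 1 < (k + 1) ^ n <;>
    rintro ⟨⟩ <;> simp [moved, applyAct, edit, tops, Mem.get, hlt]
  · have e : n * (4 * k + 7) = n * (2 * k + 5) + 2 * (n * (k + 1)) := by ring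
    simp only [List.length_nil] at h2
    omega

/-! ### The main loop -/

/-- The stacks of the checker. -/
def zipRegs : List Reg := [.sr, .sl, .er, .el, .br, .bl, .cur, .up, .bad]

namespace StackProg

/-- Prepare the stacks of the checker. -/
def initCheck : StackProg Reg :=
  seq (clear zipRegs) <| seq (moveAll .ge [.x]) <|
  seq (drain .x (fun _ => true) fun x k => match k with
    | .ge => some x | .er => some x
    | .br => if x = Γ'.comma then some Γ'.comma else none | _ => none) <|
  seq (moveAll .gs [.x]) <| seq (moveAll .x [.gs, .sr]) <|
  seq (moveAll .kk [.ku]) <| moveAll .ku [.kk, .up]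

/-- Check one word and pass to the next one. -/
def checkStep : StackProg Reg :=
  seq initCheck <| seq checkWord <| seq (ite (fun t => t .bad = none) count skip) <|
  seq (moveAll .w' [.w]) increment

/-- Check all words. -/
def checkAll : StackProg Reg := loop (fun t => t .quit = none) checkStep

end StackProg

theorem filterMap_blocks_unary (d : ℕ → ℕ) (m r : ℕ) :
    (blocks (fun x => unary (d x)) m r).filterMap
      (fun x => if x = Γ'.comma then some Γ'.comma else none) = blocks (fun _ => unary 0) m r := by
  induction r generalizing m with
  | zero => rfl
  | succ r ih =>
    rw [blocks, blocks, List.filterMap_append, ih]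
    simp [unary, List.filterMap_append]

/-- The data for the main loop. -/
structure Mem.Ready (M : Mem) (k r : ℕ) (g d : ℕ → ℕ) : Prop where
  ge : M.ge = blocks (fun x => unary (d x)) 0 r
  gs : M.gs = blocks (fun x => unary (g x)) 0 r
  kk : M.kk = List.replicate k tok
  ku : M.ku = []
  x : M.x = []

section main

variable {k r : ℕ} {g d : ℕ → ℕ}

/-- The counters are rebuilt from the master copies `ge`, `gs`, `kk`; each copy takes two moves, as
a move reverses the list. Only commas reach `br`, that is, unary zeros. The bound `L` limits what
the preceding check has left behind. -/
theorem runs_initCheck {M : Mem} (hM : M.Ready k r g d) (hrk : r ≤ k)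
    (hd : ∀ m', m' < r → d m' ≤ k) (hg : ∀ m', m' < r → g m' ≤ k) {L : ℕ}
    (hL : ∀ q ∈ zipRegs, (M.get q).length ≤ L) :
    Runs initCheck M.get { M with z := zipper g d (fun _ => 0) 0 k 0 r [] }.get
      (18 * L + 40 * (k + 1) ^ 2) := by
  obtain ⟨hge, hgs, hkk, hku, hx⟩ := hM
  have l1 : (blocks (fun x => unary (d x)) 0 r).length ≤ r * (k + 1) :=
    length_blocks_le fun x _ hx => by
      rw [length_unary]
      have := hd x (by omega)
      omega
  have l2 : (blocks (fun x => unary (g x)) 0 r).length ≤ r * (k + 1) :=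
    length_blocks_le fun x _ hx => by
      rw [length_unary]
      have := hg x (by omega)
      omega
  have l3 : r * (k + 1) ≤ k * (k + 1) := Nat.mul_le_mul_right _ hrk
  refine Runs.of_eq (Runs.seq' (Runs.cleared zipRegs hL) <|
    Runs.seq' (Runs.movedAll (blocks (fun x => unary (d x)) 0 r) ?_) <|
    Runs.seq' (Runs.drained (blocks (fun x => unary (d x)) 0 r).reverse [] ?_ ?_ ?_) <|
    Runs.seq' (Runs.movedAll (blocks (fun x => unary (g x)) 0 r) ?_) <|
    Runs.seq' (Runs.movedAll (blocks (fun x => unary (g x)) 0 r).reverse ?_) <|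
    Runs.seq' (Runs.movedAll (List.replicate k tok) ?_) <|
    Runs.movedAll (List.replicate k tok) ?_) ?_ ?_
  case refine_9 =>
    rintro ⟨⟩ <;> simp [cleared, moved, drained, Mem.get, zipRegs, zipper, revBlocks, hge, hgs, hkk,
      hku, hx, List.filterMap_reverse, filterMap_blocks_unary]
  case refine_10 =>
    simp only [List.length_reverse, List.length_replicate]
    have e : 40 * (k + 1) ^ 2 = 40 * (k * (k + 1)) + 40 * k + 40 := by ring
    have e' : zipRegs.length = 9 := rfl
    rw [e']
    omega
  all_goals simp [cleared, moved, drained, Mem.get, zipRegs, hge, hgs, hkk, hku, hx]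

open Classical in
/-- The number of valid words among the first `j`. -/
noncomputable def validCount (k r : ℕ) (g d : ℕ → ℕ) (fs : List Bool) (j : ℕ) : ℕ :=
  ∑ i ∈ range j,
    if WordValid k r g d (fun _ _ => 0) 0 0 (wordOf (k + 1) fs.length i) fs then 1 else 0

theorem validCount_le (fs : List Bool) (j : ℕ) : validCount k r g d fs j ≤ j := by
  refine (sum_le_sum (g := fun _ => 1) fun i _ => ?_).trans (by simp)
  split_ifs <;> simp

/-- Since `k + 1 ≤ 2 ^ k`, the count is at most `2 ^ (k * k)`; hence updating the binary output
costs `O(k^2)`. -/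
theorem length_bits_le_of_le_pow {n : ℕ} (hn : n ≤ (k + 1) ^ k) : n.bits.length ≤ k * k + 1 := by
  rw [Nat.size_eq_bits_len, Nat.size_le, pow_succ, pow_mul]
  have : (k + 1) ^ k ≤ (2 ^ k) ^ k := Nat.pow_le_pow_left Nat.lt_two_pow_self k
  have : 0 < (2 ^ k) ^ k := by positivity
  omega

theorem length_zipper_le (hrk : r ≤ k) (hd : ∀ m', m' < r → d m' ≤ k)
    (hg : ∀ m', m' < r → g m' ≤ k) (M : Mem) : ∀ q ∈ zipRegs,
      ({ M with z := zipper g d (fun _ => 0) 0 k 0 r [] }.get q).length ≤ (k + 1) ^ 2 := by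
  have l1 : (blocks (fun x => unary (d x)) 0 r).length ≤ r * (k + 1) :=
    length_blocks_le fun x _ hx => by
      rw [length_unary]
      have := hd x (by omega)
      omega
  have l2 : (blocks (fun x => unary (g x)) 0 r).length ≤ r * (k + 1) :=
    length_blocks_le fun x _ hx => by
      rw [length_unary]
      have := hg x (by omega)
      omega
  have l3 : (blocks (fun _ => unary 0) 0 r).length ≤ r * (k + 1) :=
    length_blocks_le fun x _ hx => by
      rw [length_unary]
      omega
  have l4 : r * (k + 1) ≤ k * (k + 1) := Nat.mul_le_mul_right _ hrk
  have e : (k + 1) ^ 2 = k * (k + 1) + k + 1 := by ring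
  intro q hq
  fin_cases hq <;> simp [Mem.get, zipper, revBlocks] <;> omega

/-- The bound on the checker's stacks reproduces itself: they are rebuilt with length at most `(k +
1) ^ 2`, and by `Runs.length_le` a check of `O(k^3)` steps lengthens them by at most that much. So
clearing them costs `O(k^3)` for every word. -/
theorem runs_checkStep (hrk : r ≤ k) (hd : ∀ m', m' < r → d m' ≤ k)
    (hg : ∀ m', m' < r → g m' ≤ k) {fs : List Bool} (hfs : fs.length = k) {M : Mem}
    (hM : M.Ready k r g d) {j : ℕ} (hj : j < (k + 1) ^ k) {z : Zipper}
    (hz : ∀ q ∈ zipRegs, ({ M with z := z }.get q).length ≤ 63 * (k + 1) ^ 3) :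
    ∃ w z', Runs checkStep
      { M with
        w := encodeWord k (wordOf (k + 1) k j) fs
        w' := []
        quit := []
        tmp := []
        out := bitSyms (validCount k r g d fs j).bits
        z := z }.get
      { M with
        w := w
        w' := []
        quit := if j + 1 < (k + 1) ^ k then [] else [tok]
        tmp := []
        out := bitSyms (validCount k r g d fs (j + 1)).bits
        z := z' }.get (1400 * (k + 1) ^ 3) ∧
      (j + 1 < (k + 1) ^ k → w = encodeWord k (wordOf (k + 1) k (j + 1)) fs) ∧
      (∀ q ∈ zipRegs, ({ M with z := z' }.get q).length ≤ 63 * (k + 1) ^ 3) := by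
  have h1 := runs_initCheck (M := { M with
        w := encodeWord k (wordOf (k + 1) k j) fs
        w' := []
        quit := []
        tmp := []
        out := bitSyms (validCount k r g d fs j).bits
        z := z }) (k := k) (r := r) (g := g) (d := d) ⟨hM.1, hM.2, hM.3, hM.4, hM.5⟩ hrk hd hg
          (L := 63 * (k + 1) ^ 3) (fun q hq => by
            refine le_trans (le_of_eq ?_) (hz q hq)
            fin_cases hq <;> rfl)
  have hwl : (wordOf (k + 1) k j).length = fs.length := by rw [length_wordOf, hfs]
  have hwk := wordOf_le k k j
  have hlen := length_encodeWord hwl hwk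
  rw [length_wordOf] at hlen
  obtain ⟨z', h2, h3⟩ := runs_checkWord hrk hd hg hwl hwk { M with
        quit := []
        tmp := []
        out := bitSyms (validCount k r g d fs j).bits } []
  rw [length_wordOf] at h2
  have h4 : Runs (StackProg.ite (fun t => t Reg.bad = none) count skip) { M with
        w := []
        w' := (encodeWord k (wordOf (k + 1) k j) fs).reverse
        quit := []
        tmp := []
        out := bitSyms (validCount k r g d fs j).bits
        z := z' }.get { M with
        w := []
        w' := (encodeWord k (wordOf (k + 1) k j) fs).reverse
        quit := []
        tmp := []
        out := bitSyms (validCount k r g d fs (j + 1)).bits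
        z := z' }.get (4 * (k * k + 1) + 4) := by
    have hsucc : validCount k r g d fs (j + 1) = validCount k r g d fs j + if z'.bad = [] then 1 else 0 := by
      rw [validCount, sum_range_succ, hfs, validCount, hfs]
      congr 1
      classical exact if_congr h3.symm rfl rfl
    by_cases hb : z'.bad = []
    · rw [hsucc, if_pos hb, bits_succ]
      refine Runs.mono (Runs.iteT ?_ (runs_count { M with
        w := []
        w' := (encodeWord k (wordOf (k + 1) k j) fs).reverse
        quit := []
        z := z' } (validCount k r g d fs j).bits)) ?_
      · simp [tops, Mem.get, hb]
      · have := length_bits_le_of_le_pow ((validCount_le (k := k) (r := r) (g := g) (d := d) fs j).trans hj.le)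
        omega
    · rw [hsucc, if_neg hb, add_zero]
      refine Runs.mono (Runs.iteF ?_ Runs.skip) (by omega)
      simp [tops, Mem.get, hb]
  obtain ⟨w, h5, h6⟩ := runs_increment hfs hj { M with
        tmp := []
        out := bitSyms (validCount k r g d fs (j + 1)).bits
        z := z' }
  have e1 : (k + 1) ^ 3 = k * k * k + 3 * (k * k) + 3 * k + 1 := by ring
  have e2 : (k + 1) ^ 2 = k * k + 2 * k + 1 := by ring
  have e3 : k * (60 * (k + 1) ^ 2) = 60 * (k * k * k) + 120 * (k * k) + 60 * k := by ring
  have e4 : k * (k + 1) = k * k + k := by ring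
  have e5 : k * (4 * k + 7) = 4 * (k * k) + 7 * k := by ring
  refine ⟨w, z', Runs.mono (Runs.seq' h1 (Runs.seq' h2 (Runs.seq' h4 (Runs.seq'
    (Runs.moveAll (encodeWord k (wordOf (k + 1) k j) fs).reverse rfl rfl ?_) h5)))) ?_, h6,
    fun q hq => ?_⟩
  · rintro ⟨⟩ <;> simp [Mem.get]
  · rw [List.length_reverse, hlen]
    omega
  · have l1 := h2.length_le q
    have l2 := length_zipper_le hrk hd hg M q hq
    have l3 : ({ M with z := z' }.get q).length ≤ (k + 1) ^ 2 + (k * (60 * (k + 1) ^ 2) + 2) := by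
      fin_cases hq <;> exact l1.trans (Nat.add_le_add_right l2 _)
    omega

theorem runs_checkAll (hrk : r ≤ k) (hd : ∀ m', m' < r → d m' ≤ k)
    (hg : ∀ m', m' < r → g m' ≤ k) {fs : List Bool} (hfs : fs.length = k) {M : Mem}
    (hM : M.Ready k r g d) (rem : ℕ) : ∀ (j : ℕ), j + rem + 1 = (k + 1) ^ k → ∀ z : Zipper,
    (∀ q ∈ zipRegs, ({ M with z := z }.get q).length ≤ 63 * (k + 1) ^ 3) →
    ∃ M' : Mem, Runs checkAll
      { M with
        w := encodeWord k (wordOf (k + 1) k j) fs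
        w' := []
        quit := []
        tmp := []
        out := bitSyms (validCount k r g d fs j).bits
        z := z }.get M'.get ((rem + 1) * (1400 * (k + 1) ^ 3 + 1) + 1) ∧
      M'.out = bitSyms (validCount k r g d fs ((k + 1) ^ k)).bits := by
  induction rem with
  | zero =>
    intro j hj z hz
    obtain ⟨w, z', h1, h2, h3⟩ := runs_checkStep hrk hd hg hfs hM (j := j) (by omega) hz
    rw [if_neg (by omega)] at h1
    refine ⟨_, Runs.mono (Runs.step ?_ h1 (Runs.done ?_)) (by omega), ?_⟩
    · simp [tops, Mem.get]
    · simp [tops, Mem.get]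
    · simp [← hj]
  | succ rem ih =>
    intro j hj z hz
    obtain ⟨w, z', h1, h2, h3⟩ := runs_checkStep hrk hd hg hfs hM (j := j) (by omega) hz
    rw [if_pos (by omega), h2 (by omega)] at h1
    obtain ⟨M', h4, h5⟩ := ih (j + 1) (by omega) z' h3
    unfold checkAll at h4
    refine ⟨M', Runs.mono (Runs.step ?_ h1 h4) ?_, h5⟩
    · simp [tops, Mem.get]
    · rw [add_one_mul (rem + 1)]
      omega

end main

/-! ### Reading the input -/

/-- The value of a list of bits, least significant bit first. -/
def bitsVal (l : List Bool) : ℕ := l.foldr (fun b u => 2 * u + b.toNat) 0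

theorem bitsVal_cons (b : Bool) (l : List Bool) : bitsVal (b :: l) = 2 * bitsVal l + b.toNat := rfl

theorem bitsVal_bits (n : ℕ) : bitsVal n.bits = n := by
  induction n using Nat.strong_induction_on with
  | _ n ih =>
    rcases Nat.even_or_odd' n with ⟨m, rfl | rfl⟩
    · rcases Nat.eq_zero_or_pos m with rfl | hm
      · rfl
      · rw [Nat.bit0_bits m hm.ne', bitsVal_cons, ih m (by omega)]
        rfl
    · rw [Nat.bit1_bits, bitsVal_cons, ih m (by omega)]
      rfl

/-- Bits as opposed to punctuation marks. -/
def isBit : Γ' → Bool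
  | .bit _ => true
  | _ => false

theorem isBit_of_mem_bitSyms {l : List Bool} : ∀ x ∈ bitSyms l, isBit x = true := by
  intro x hx
  obtain ⟨b, -, rfl⟩ := List.mem_map.1 hx
  rfl

namespace StackProg

/-- Convert the binary number on top of the stack `src`, most significant bit first, to unary on the
stack `dst`. -/
def toUnary (src dst : Reg) : StackProg Reg :=
  loop (fun t => (t src).any isBit) <|
  seq (moveAll dst [.y, .y']) <| seq (moveAll .y [dst]) <| seq (moveAll .y' [dst]) <|
  act fun t k => if k = src then (true, none)
    else if k = dst then (false, if t src = some tok then some tok else none) else (false, none)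

end StackProg

theorem le_foldl_bits (l : List Bool) (u : ℕ) :
    u ≤ l.foldl (fun u b => 2 * u + b.toNat) u := by
  induction l generalizing u with
  | nil => exact le_rfl
  | cons b l ih =>
    have := ih (2 * u + b.toNat)
    rw [List.foldl_cons]
    omega

/-- Doubling `u` costs `O(u)` and raises the value by at least `u`, so the cost is linear in the
final value plus the number of bits. -/
theorem runs_toUnary {src dst : Reg} (h : [src, dst, .y, .y'].Nodup) (l : List Bool) :
    ∀ {S : Stacks Reg} {rest : List Γ'} {u : ℕ}, S src = bitSyms l ++ rest →
    rest.head?.any isBit = false → S dst = List.replicate u tok → S .y = [] → S .y' = [] →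
    Runs (toUnary src dst) S
      (fun k => if k = src then rest else if k = dst then
        List.replicate (l.foldl (fun u b => 2 * u + b.toNat) u) tok else S k)
      (6 * (l.foldl (fun u b => 2 * u + b.toNat) u - u) + 5 * l.length + 1) := by
  simp only [List.nodup_cons, List.mem_cons, List.not_mem_nil, or_false, not_or] at h
  obtain ⟨⟨h1, h2, h3⟩, ⟨h4, h5⟩, h6, -⟩ := h
  induction l with
  | nil =>
    intro S rest u hs hr hd hy hy'
    refine Runs.of_eq (Runs.done ?_) (fun k => ?_) (by simp)
    · simpa [tops, hs, bitSyms] using hr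
    · by_cases hk1 : k = src
      · simp [hk1, hs, bitSyms]
      · by_cases hk2 : k = dst
        · simp [hk2, hd, Ne.symm h1]
        · simp [hk1, hk2]
  | cons b l ih =>
    intro S rest u hs hr hd hy hy'
    have hl := le_foldl_bits l (2 * u + b.toNat)
    have hstep := ih (S := fun k => if k = src then bitSyms l ++ rest else if k = dst then
        List.replicate (2 * u + b.toNat) tok else S k) (rest := rest) (u := 2 * u + b.toNat)
        (by simp) hr (by simp [Ne.symm h1]) (by simp [Ne.symm h2, Ne.symm h4, hy])
        (by simp [Ne.symm h3, Ne.symm h5, hy'])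
    unfold toUnary at hstep
    refine Runs.of_eq (Runs.step ?_ (Runs.of_eq (Runs.seq' (Runs.movedAll (List.replicate u tok) hd) <|
      Runs.seq' (Runs.movedAll (List.replicate u tok) ?_) <|
      Runs.seq' (Runs.movedAll (List.replicate u tok) ?_) (Runs.act _)) (fun k => ?_) le_rfl)
      hstep) (fun k => ?_) ?_
    · simp [tops, hs, bitSyms, isBit]
    · simp [moved, Ne.symm h4, hy]
    · simp [moved, Ne.symm h5, hy', Ne.symm h6]
    · by_cases hk1 : k = src
      · subst hk1
        simp [applyAct, moved, edit, h1, h2, h3, hs, bitSyms]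
      · by_cases hk2 : k = dst
        · subst hk2
          cases b <;> simp [applyAct, moved, edit, tops, hk1, Ne.symm hk1, h2, h3, h4, h5, hs,
            bitSyms, two_mul, List.replicate_succ]
        · by_cases hk3 : k = .y
          · subst hk3
            simp [applyAct, moved, edit, hk1, hk2, hy]
          · by_cases hk4 : k = .y'
            · subst hk4
              simp [applyAct, moved, edit, hk1, hk2, hy']
            · simp [applyAct, moved, edit, hk1, hk2, hk3, hk4]
    · by_cases hk1 : k = src <;> by_cases hk2 : k = dst <;> simp [hk1, hk2]
    · simp only [List.length_replicate, List.foldl_cons, List.length_cons]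
      omega

theorem runs_toUnary_bitsVal {src dst : Reg} (h : [src, dst, .y, .y'].Nodup) (l : List Bool)
    {S : Stacks Reg} {rest : List Γ'} (hs : S src = bitSyms l.reverse ++ rest)
    (hr : rest.head?.any isBit = false) (hd : S dst = []) (hy : S .y = []) (hy' : S .y' = []) :
    Runs (toUnary src dst) S
      (fun k => if k = src then rest else if k = dst then
        List.replicate (bitsVal l) tok else S k) (6 * bitsVal l + 5 * l.length + 1) := by
  have := runs_toUnary h l.reverse hs hr (u := 0) hd hy hy'
  rwa [List.foldl_reverse, List.length_reverse, Nat.sub_zero] at this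

/-- The code of one part of a partition. -/
def encodePart (n : ℕ) : List Γ' := bitSyms n.bits ++ [Γ'.comma]

theorem encodePartition_eq (lam : YoungDiagram) :
    encodePartition lam =
      blocks (fun i => encodePart (lam.rowLen i)) 0 (lam.colLen 0) ++ [Γ'.ket] := by
  have h : ∀ n, ((List.range n).map lam.rowLen).flatMap
      (fun p => encodingNatΓ'.encode p ++ [Γ'.comma]) =
      blocks (fun i => encodePart (lam.rowLen i)) 0 n := by
    intro n
    induction n with
    | zero => rfl
    | succ n ih =>
      rw [blocks_succ_right, ← ih, List.range_succ]
      simp [encodePart, encodingNatΓ'_encode]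
  rw [encodePartition, YoungDiagram.rowLens, h]

theorem ne_ket_of_mem_blocks (f : ℕ → ℕ) (n : ℕ) : ∀ m, ∀ x ∈ blocks (fun i => encodePart (f i)) m n,
    x ≠ Γ'.ket := by
  induction n with
  | zero => simp [blocks]
  | succ n ih =>
    intro m x hx
    rw [blocks, List.mem_append] at hx
    rcases hx with hx | hx
    · simp only [encodePart, bitSyms, List.mem_append, List.mem_map, List.mem_singleton] at hx
      rcases hx with ⟨b, -, rfl⟩ | rfl <;> simp
    · exact ih _ x hx

namespace StackProg

/-- Move the code of the first partition to its own stack. -/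
def readFirst : StackProg Reg :=
  seq (moveTo .inp (· ≠ Γ'.ket) [.tmp]) <|
  seq (act fun _ k => match k with
    | .inp => (true, none) | .lam => (false, some Γ'.ket) | _ => (false, none)) <|
  moveAll .tmp [.lam]

/-- Read one part of the second partition. -/
def readPart : StackProg Reg :=
  seq (moveTo .inp isBit [.tmp]) <|
  seq (act fun _ k => match k with | .inp => (true, none) | _ => (false, none)) <|
  seq (toUnary .tmp .x) <|
  seq (drain .x (· = tok) fun _ k => match k with
    | .mu => some Γ'.comma | .kk => some tok | _ => none) <|
  act fun _ k => match k with | .mu => (true, some Γ'.ket) | _ => (false, none)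

/-- Read the second partition: unary size and end marks of its cells. -/
def readSecond : StackProg Reg :=
  seq (loop (fun t => t .inp ≠ some Γ'.ket) readPart) <|
  act fun _ k => match k with | .inp => (true, none) | _ => (false, none)

/-- Write the first word. -/
def firstWord : StackProg Reg :=
  loop (fun t => (t .mu).isSome) <|
    seq (act fun t k => match k with
      | .mu => (true, none) | .w => (false, t .mu) | _ => (false, none)) <|
    seq (drain .kk (fun _ => true) fun x k => match k with
      | .ku => some x | .w => some off | _ => none) <|
    moveAll .ku [.kk]

end StackProg

theorem runs_readFirst (M : Mem) (lam : YoungDiagram) (rest : List Γ') :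
    Runs readFirst { M with inp := encodePartition lam ++ rest, tmp := [], lam := [] }.get
      { M with inp := rest, tmp := [], lam := encodePartition lam }.get
      (4 * (encodePartition lam).length + 3) := by
  rw [encodePartition_eq]
  set B := blocks (fun i => encodePart (lam.rowLen i)) 0 (lam.colLen 0) with hB
  refine Runs.of_eq (Runs.seq' (Runs.moved B (Γ'.ket :: rest) ?_ ?_ ?_) <|
    Runs.seq' (Runs.act _) (Runs.movedAll B.reverse ?_)) ?_ ?_
  · simp [Mem.get]
  · intro x hx
    simpa using ne_ket_of_mem_blocks _ _ _ x (hB ▸ hx)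
  · simp
  · simp [applyAct, edit, moved, Mem.get]
  · rintro ⟨⟩ <;> simp [applyAct, edit, moved, Mem.get]
  · simp
    omega

/-- The flags marking the last cells of the rows `i`, …, `i + n - 1` of a diagram. -/
def rowFlags (μ : ℕ → ℕ) : ℕ → ℕ → List Bool
  | _, 0 => []
  | i, n + 1 => List.replicate (μ i - 1) false ++ true :: rowFlags μ (i + 1) n

theorem fits_rowFlags {μ : ℕ → ℕ} {l : ℕ} (n : ℕ) : ∀ i, i + n + 1 = l →
    (∀ j, j < l → 0 < μ j) → Fits μ l i (μ i) (rowFlags μ i (n + 1)) := by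
  have key : ∀ i c fs, Fits μ l i 1 (true :: fs) →
      Fits μ l i (c + 1) (List.replicate c false ++ true :: fs) := by
    intro i c fs h
    induction c with
    | zero => exact h
    | succ c ih => exact Fits.cell ih
  induction n with
  | zero =>
    intro i hi hμ
    have h0 := hμ i (by omega)
    have := key i (μ i - 1) [] (Fits.last (by omega))
    rwa [Nat.sub_add_cancel h0] at this
  | succ n ih =>
    intro i hi hμ
    have h0 := hμ i (by omega)
    have := key i (μ i - 1) _ (Fits.nextRow (by omega) (ih (i + 1) (by omega) hμ))
    rwa [Nat.sub_add_cancel h0] at this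

theorem length_rowFlags {μ : ℕ → ℕ} (n : ℕ) : ∀ i, (∀ j, i ≤ j → j < i + n → 0 < μ j) →
    (rowFlags μ i n).length = ∑ j ∈ range n, μ (i + j) := by
  induction n with
  | zero => simp [rowFlags]
  | succ n ih =>
    intro i hμ
    have := hμ i le_rfl (by omega)
    rw [rowFlags, List.length_append, List.length_cons, ih (i + 1) fun j h1 h2 => hμ j (by omega) (by omega),
      sum_range_succ', List.length_replicate]
    simp only [add_zero, Nat.add_right_comm i 1, Nat.add_assoc]
    omega

theorem length_bits_le (n : ℕ) : n.bits.length ≤ n := by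
  rw [Nat.size_eq_bits_len, Nat.size_le]
  exact Nat.lt_two_pow_self

/-- Reading a part costs time linear in the part, because its binary length is at most its value;
everything is charged to the cells. Each cell puts a comma on `mu`, and the last comma of a row is
replaced by the row mark. -/
theorem runs_readSecond_loop (μ : ℕ → ℕ) (rest : List Γ') (n : ℕ) : ∀ (i : ℕ),
    (∀ j, i ≤ j → j < i + n → 0 < μ j) → ∀ M : Mem,
    Runs (loop (fun t => t .inp ≠ some Γ'.ket) readPart)
      { M with
        inp := blocks (fun i => encodePart (μ i)) i n ++ Γ'.ket :: rest
        tmp := []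
        x := []
        y := []
        y' := [] }.get
      { M with
        inp := Γ'.ket :: rest
        tmp := []
        x := []
        y := []
        y' := []
        mu := ((rowFlags μ i n).map cellMark).reverse ++ M.mu
        kk := List.replicate (rowFlags μ i n).length tok ++ M.kk }.get
      (21 * (rowFlags μ i n).length + 1) := by
  induction n with
  | zero =>
    intro i hμ M
    refine Runs.of_eq (Runs.done ?_) ?_ (by simp [rowFlags])
    · simp [tops, Mem.get, blocks]
    · rintro ⟨⟩ <;> simp [Mem.get, blocks, rowFlags]
  | succ n ih =>
    intro i hμ M
    have h0 := hμ i le_rfl (by omega)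
    have hb := length_bits_le (μ i)
    have h1 := ih (i + 1) (fun j h1 h2 => hμ j (by omega) (by omega)) { M with
      mu := Γ'.ket :: (List.replicate (μ i - 1) Γ'.comma ++ M.mu)
      kk := List.replicate (μ i) tok ++ M.kk }
    have hnb : (μ i).bits ≠ [] := by
      intro h
      have := bitsVal_bits (μ i)
      rw [h] at this
      simp [bitsVal] at this
      omega
    obtain ⟨b, bs, hbs⟩ := List.exists_cons_of_ne_nil hnb
    have hv := bitsVal_bits (μ i)
    obtain ⟨p, hp⟩ : ∃ p, μ i = p + 1 := ⟨μ i - 1, by omega⟩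
    refine Runs.of_eq (Runs.step ?_ (Runs.of_eq (Runs.seq' (Runs.moved (bitSyms (μ i).bits)
        (Γ'.comma :: (blocks (fun i => encodePart (μ i)) (i + 1) n ++ Γ'.ket :: rest)) ?_
          isBit_of_mem_bitSyms ?_) <|
      Runs.seq' (Runs.act _) <| Runs.seq' (runs_toUnary_bitsVal (rest := []) (by decide) (μ i).bits ?_ rfl ?_ ?_ ?_) <|
      Runs.seq' (Runs.drained (List.replicate (μ i) tok) [] ?_ ?_ ?_) (Runs.act _)) ?_ le_rfl) h1) ?_ ?_
    · simp [tops, Mem.get, blocks, encodePart, hbs, bitSyms]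
    · simp [Mem.get, blocks, encodePart]
    · simp [isBit]
    · simp [applyAct, moved, edit, Mem.get, bitSyms]
    · simp [applyAct, moved, edit, Mem.get]
    · simp [applyAct, moved, edit, Mem.get]
    · simp [applyAct, moved, edit, Mem.get]
    · simp [hv]
    · simp
    · simp
    · rintro ⟨⟩ <;> simp [applyAct, drained, moved, edit, Mem.get]
      simp [hp, List.replicate_succ]
    · rintro ⟨⟩ <;> simp [Mem.get, rowFlags, cellMark]
      rw [← List.append_assoc, List.replicate_append_replicate,
        show (rowFlags μ (i + 1) n).length + μ i = μ i - 1 + ((rowFlags μ (i + 1) n).length + 1) by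
          omega]
    · simp only [rowFlags, List.length_append, List.length_replicate, List.length_cons, hv, bitSyms,
        List.length_map]
      omega

theorem runs_readSecond (μ : YoungDiagram) (rest : List Γ') (M : Mem) :
    Runs readSecond
      { M with
        inp := encodePartition μ ++ rest
        tmp := []
        x := []
        y := []
        y' := []
        mu := []
        kk := [] }.get
      { M with
        inp := rest
        tmp := []
        x := []
        y := []
        y' := []
        mu := ((rowFlags μ.rowLen 0 (μ.colLen 0)).map cellMark).reverse
        kk := List.replicate (rowFlags μ.rowLen 0 (μ.colLen 0)).length tok }.get
      (21 * (rowFlags μ.rowLen 0 (μ.colLen 0)).length + 2) := by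
  have h1 := runs_readSecond_loop μ.rowLen rest (μ.colLen 0) 0 (fun j _ hj => by
    rw [zero_add] at hj
    exact YoungDiagram.mem_iff_lt_rowLen.1 (YoungDiagram.mem_iff_lt_colLen.2 hj))
    { M with mu := [], kk := [] }
  rw [encodePartition_eq]
  simp only [List.append_assoc, List.singleton_append]
  refine Runs.of_eq (Runs.seq' h1 (Runs.act _)) ?_ le_rfl
  rintro ⟨⟩ <;> simp [applyAct, edit, Mem.get]

theorem wordOf_zero (B n : ℕ) : wordOf B n 0 = List.replicate n 0 := by
  induction n with
  | zero => rfl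
  | succ n ih => simp [wordOf, ih, List.replicate_succ]

/-- The marks lie on `mu` in reverse order, so pushing them restores the reading order. The `k`
fillers before each mark encode the digit 0. -/
theorem runs_firstWord_loop (k : ℕ) (L : List Bool) : ∀ (fs : List Bool) (M : Mem),
    Runs firstWord
      { M with
        mu := L.map cellMark
        w := encodeWord k (List.replicate fs.length 0) fs
        kk := List.replicate k tok
        ku := [] }.get
      { M with
        mu := []
        w := encodeWord k (List.replicate (L.reverse ++ fs).length 0) (L.reverse ++ fs)
        kk := List.replicate k tok
        ku := [] }.get (L.length * (4 * k + 4) + 1) := by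
  induction L with
  | nil =>
    intro fs M
    refine Runs.of_eq (Runs.done ?_) (fun _ => rfl) (by simp)
    simp [tops, Mem.get]
  | cons f L ih =>
    intro fs M
    have h1 := ih (f :: fs) M
    unfold firstWord at h1
    refine Runs.of_eq (Runs.step ?_ (Runs.of_eq (Runs.seq' (Runs.act _) <|
      Runs.seq' (Runs.drained (List.replicate k tok) [] ?_ ?_ ?_)
        (Runs.movedAll (List.replicate k tok) ?_)) ?_ le_rfl) h1) ?_ ?_
    · simp [tops, Mem.get]
    · simp [applyAct, edit, Mem.get]
    · simp
    · simp
    · simp [applyAct, drained, edit, Mem.get]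
    · rintro ⟨⟩ <;> simp [applyAct, drained, moved, edit, tops, Mem.get, encodeWord,
        List.replicate_succ]
    · rintro ⟨⟩ <;> simp [Mem.get]
    · simp only [List.length_replicate, List.length_cons]
      rw [add_one_mul]
      omega

theorem runs_firstWord (k : ℕ) (fs : List Bool) (M : Mem) :
    Runs firstWord
      { M with
        mu := (fs.map cellMark).reverse
        w := []
        kk := List.replicate k tok
        ku := [] }.get
      { M with
        mu := []
        w := encodeWord k (wordOf (k + 1) fs.length 0) fs
        kk := List.replicate k tok
        ku := [] }.get (fs.length * (4 * k + 4) + 1) := by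
  have := runs_firstWord_loop k fs.reverse [] M
  simpa [wordOf_zero, encodeWord] using this

/-! ### Subtracting partitions -/

/-- The borrow in binary subtraction. -/
def borrowBit (x y c : Bool) : Bool := (!x && (y || c)) || (y && c)

/-- The bits of a difference, given a borrow. -/
def subBits : List Bool → List Bool → Bool → List Bool
  | [], _, _ => []
  | x :: xs, ys, c =>
    (x ^^ (ys.headD false ^^ c)) :: subBits xs ys.tail (borrowBit x (ys.headD false) c)

/-- The final borrow. -/
def subBorrow : List Bool → List Bool → Bool → Bool
  | [], _, c => c
  | x :: xs, ys, c => subBorrow xs ys.tail (borrowBit x (ys.headD false) c)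

theorem length_subBits (xs : List Bool) : ∀ ys c, (subBits xs ys c).length = xs.length := by
  induction xs with
  | nil => simp [subBits]
  | cons x xs ih => simp [subBits, ih]

/-- Schoolbook subtraction: the final borrow weighs `2 ^ xs.length`. Bits of `ys` beyond the length
of `xs` are never looked at, whence `take`. -/
theorem bitsVal_subBits (xs : List Bool) : ∀ ys c,
    bitsVal (subBits xs ys c) + bitsVal (ys.take xs.length) + c.toNat =
      bitsVal xs + 2 ^ xs.length * (subBorrow xs ys c).toNat := by
  induction xs with
  | nil => simp [subBits, subBorrow, bitsVal]
  | cons x xs ih =>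
    intro ys c
    have h := ih ys.tail (borrowBit x (ys.headD false) c)
    rw [subBits, subBorrow, bitsVal_cons, bitsVal_cons, List.length_cons, pow_succ]
    have h2 : bitsVal (ys.take (xs.length + 1)) =
        2 * bitsVal (ys.tail.take xs.length) + (ys.headD false).toNat := by
      cases ys with
      | nil => simp [bitsVal]
      | cons y ys => simp [bitsVal_cons]
    have h3 : (x ^^ (ys.headD false ^^ c)).toNat + (ys.headD false).toNat + c.toNat =
        x.toNat + 2 * (borrowBit x (ys.headD false) c).toNat := by
      cases x <;> cases ys.headD false <;> cases c <;> rfl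
    rw [h2, mul_right_comm]
    omega

theorem bitsVal_lt (l : List Bool) : bitsVal l < 2 ^ l.length := by
  induction l with
  | nil => simp [bitsVal]
  | cons b l ih =>
    rw [bitsVal_cons, List.length_cons, pow_succ]
    have := Bool.toNat_lt b
    omega

/-- Binary codes have no leading zeros, so surplus bits mean that `n` is larger; without them the
final borrow decides. Both are visible after `l.bits.length` steps, hence the cost is governed by
`l` alone. -/
theorem le_iff_subBorrow (l n : ℕ) :
    n ≤ l ↔ n.bits.drop l.bits.length = [] ∧ subBorrow l.bits n.bits false = false := by
  have h := bitsVal_subBits l.bits n.bits false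
  have h1 := bitsVal_lt (subBits l.bits n.bits false)
  rw [length_subBits] at h1
  rw [bitsVal_bits] at h
  by_cases hlen : n.bits.length ≤ l.bits.length
  · rw [List.take_of_length_le hlen, bitsVal_bits] at h
    rw [List.drop_of_length_le hlen]
    cases hb : subBorrow l.bits n.bits false
    · simp [hb] at h ⊢
      omega
    · simp [hb] at h ⊢
      omega
  · have h2 : ¬ n ≤ l := fun hle => hlen (by
      rw [Nat.size_eq_bits_len, Nat.size_eq_bits_len]
      exact Nat.size_le_size hle)
    simp only [h2, false_iff, List.drop_eq_nil_iff, not_and]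
    exact fun h3 => absurd h3 hlen

theorem bitsVal_subBits_bits {l n : ℕ} (h : n ≤ l) :
    bitsVal (subBits l.bits n.bits false) = l - n := by
  have h1 := bitsVal_subBits l.bits n.bits false
  have h2 : n.bits.length ≤ l.bits.length := by
    rw [Nat.size_eq_bits_len, Nat.size_eq_bits_len]
    exact Nat.size_le_size h
  rw [((le_iff_subBorrow l n).1 h).2, List.take_of_length_le h2, bitsVal_bits, bitsVal_bits] at h1
  simp at h1
  omega

/-- The bit on top of a stack. -/
def bitOf : Option Γ' → Bool
  | some (.bit b) => b
  | _ => false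

theorem bitOf_of_not_isBit {o : Option Γ'} (h : o.any isBit = false) : bitOf o = false := by
  rcases o with _ | o
  · rfl
  · cases o <;> simp_all [bitOf, isBit]

theorem filter_isBit_of_not {o : Option Γ'} (h : o.any isBit = false) : o.filter isBit = none := by
  rcases o with _ | o
  · rfl
  · cases o <;> simp_all [isBit]

@[simp] theorem bitOf_bit (b : Bool) : bitOf (some (.bit b)) = b := rfl

@[simp] theorem isBit_bit (b : Bool) : isBit (.bit b) = true := rfl

@[simp] theorem isBit_comma : isBit .comma = false := rfl

@[simp] theorem isBit_ket : isBit .ket = false := rfl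

namespace StackProg

/-- Subtract one bit, with borrow. -/
def subStep : StackProg Reg :=
  act fun t k => match k with
    | .lam => (true, none)
    | .inp => ((t .inp).any isBit, none)
    | .prev => ((t .prev).any isBit, none)
    | .prev' => (false, (t .inp).filter isBit)
    | .f₁ => (true, some (.bit (borrowBit (bitOf (t .lam)) (bitOf (t .inp)) (bitOf (t .f₁)))))
    | .f₂ => (true, some (.bit (borrowBit (bitOf (t .lam)) (bitOf (t .prev)) (bitOf (t .f₂)))))
    | .qd => (false, some (.bit (bitOf (t .lam) ^^ (bitOf (t .inp) ^^ bitOf (t .f₁)))))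
    | .qo => (false, some (.bit (bitOf (t .lam) ^^ (bitOf (t .prev) ^^ bitOf (t .f₂)))))
    | _ => (false, none)

/-- Report that the skew shape is empty. -/
def setFail : StackProg Reg :=
  act fun _ k => match k with | .fail => (false, some tok) | _ => (false, none)

/-- Finish the subtraction for a row. -/
def finishRow : StackProg Reg :=
  seq (ite (fun t => (t .prev).any isBit || (t .prev = some Γ'.ket || bitOf (t .f₂)))
    (moveTo .qo isBit []) skip) <|
  seq (moveAll .prev []) <| seq (moveAll .prev' [.prev]) <|
  act fun t k => match k with
    | .lam => (true, none)
    | .inp => (t .inp = some Γ'.comma, none)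
    | .f₁ => (true, some off)
    | .f₂ => (true, some off)
    | _ => (false, none)

/-- Subtract a row, and the previous row. -/
def subRow : StackProg Reg :=
  seq (act fun _ k => match k with
    | .qd => (false, some Γ'.comma) | .qo => (false, some Γ'.comma) | _ => (false, none)) <|
  seq (loop (fun t => (t .lam).any isBit) subStep) <|
  ite (fun t => (t .inp).any isBit || bitOf (t .f₁)) setFail finishRow

/-- Subtract all rows. -/
def subRows : StackProg Reg :=
  seq (act fun _ k => match k with
    | .f₁ => (false, some off) | .f₂ => (false, some off) | .prev => (false, some Γ'.ket)
    | _ => (false, none)) <|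
  seq (loop (fun t => t .lam ≠ some Γ'.ket && t .fail = none) subRow) <|
  ite (fun t => t .inp = some Γ'.ket) skip setFail

end StackProg

/-- The bits of `λ_i` drive two subtractions at once, of `ν_i` and of `ν_{i-1}`; a punctuation mark
on a subtrahend reads as the bit 0. The bits of `ν_i` are saved on `prev'`, and the differences end
with the most significant bit on top, as `toUnary` requires. -/
theorem runs_subStep_loop {lrest irest prest : List Γ'} (hl : lrest.head?.any isBit = false)
    (hi : irest.head?.any isBit = false) (hp : prest.head?.any isBit = false) (xs : List Bool) :
    ∀ (ys ps : List Bool) (c c' : Bool) (M : Mem),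
    Runs (loop (fun t => (t .lam).any isBit) subStep)
      { M with
        lam := bitSyms xs ++ lrest
        inp := bitSyms ys ++ irest
        prev := bitSyms ps ++ prest
        f₁ := [Γ'.bit c]
        f₂ := [Γ'.bit c'] }.get
      { M with
        lam := lrest
        inp := bitSyms (ys.drop xs.length) ++ irest
        prev := bitSyms (ps.drop xs.length) ++ prest
        prev' := (bitSyms (ys.take xs.length)).reverse ++ M.prev'
        f₁ := [Γ'.bit (subBorrow xs ys c)]
        f₂ := [Γ'.bit (subBorrow xs ps c')]
        qd := (bitSyms (subBits xs ys c)).reverse ++ M.qd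
        qo := (bitSyms (subBits xs ps c')).reverse ++ M.qo }.get (2 * xs.length + 1) := by
  induction xs with
  | nil =>
    intro ys ps c c' M
    refine Runs.of_eq (Runs.done ?_) ?_ (by simp)
    · simpa [tops, Mem.get, bitSyms] using hl
    · rintro ⟨⟩ <;> simp [Mem.get, bitSyms, subBits, subBorrow]
  | cons x xs ih =>
    intro ys ps c c' M
    have h1 := ih ys.tail ps.tail (borrowBit x (ys.headD false) c) (borrowBit x (ps.headD false) c')
      { M with
        prev' := bitSyms (ys.take 1) ++ M.prev'
        qd := Γ'.bit (x ^^ (ys.headD false ^^ c)) :: M.qd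
        qo := Γ'.bit (x ^^ (ps.headD false ^^ c')) :: M.qo }
    refine Runs.of_eq (Runs.step ?_ (Runs.act' ?_) h1) ?_ ?_
    · simp [tops, Mem.get, bitSyms]
    · have b1 := bitOf_of_not_isBit hi
      have b2 := bitOf_of_not_isBit hp
      have b3 := filter_isBit_of_not hi
      cases ys <;> cases ps <;> rintro ⟨⟩ <;>
        simp [edit, tops, Mem.get, bitSyms, hi, hp, b1, b2, b3, Option.filter_some]
    · cases ys <;> cases ps <;> rintro ⟨⟩ <;> simp [Mem.get, bitSyms, subBits, subBorrow]
    · simp only [List.length_cons]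
      omega

/-- What is known of the previous row. -/
def prevSyms (ν : ℕ → ℕ) : ℕ → List Γ'
  | 0 => [Γ'.ket]
  | i + 1 => bitSyms (ν i).bits

/-- The bits of `lam i - ν (i - 1)`, as a truncated difference. -/
def overBits (lam ν : ℕ → ℕ) : ℕ → List Bool
  | 0 => []
  | i + 1 => if ν i ≤ lam (i + 1) then subBits (lam (i + 1)).bits (ν i).bits false else []

/-- The stacks before the subtraction of row `i`, if `n` and `m` rows remain. -/
def rowState (M : Mem) (lam ν : ℕ → ℕ) (i n m : ℕ) : Mem :=
  { M with
    lam := blocks (fun j => encodePart (lam j)) i n ++ [Γ'.ket]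
    inp := blocks (fun j => encodePart (ν j)) i m ++ [Γ'.ket]
    prev := prevSyms ν i
    prev' := []
    f₁ := [off]
    f₂ := [off]
    fail := []
    qd := revBlocks (fun j => Γ'.comma :: bitSyms (subBits (lam j).bits (ν j).bits false)) i
    qo := revBlocks (fun j => Γ'.comma :: bitSyms (overBits lam ν j)) i }

theorem encodePart_append (n : ℕ) (l : List Γ') :
    encodePart n ++ l = bitSyms n.bits ++ Γ'.comma :: l := by
  simp [encodePart]

section subRow

variable {lam ν : ℕ → ℕ} {i n m L : ℕ}

/-- Surplus bits of `ν_i` or a final borrow mean `ν_i > λ_i` and stop the machine. For the overlap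
the same signs, or the absence of a previous row, only erase the difference, which makes that
subtraction a truncated one. -/
theorem runs_subRow (hν : ∀ j, i + m ≤ j → ν j = 0) (hL : ∀ j, (lam j).bits.length ≤ L)
    (hle : ∀ j, j < i → ν j ≤ lam j) (M : Mem) :
    if ν i ≤ lam i then
      Runs subRow (rowState M lam ν i (n + 1) m).get (rowState M lam ν (i + 1) n (m - 1)).get
        (8 * L + 12)
    else ∃ M' : Mem, Runs subRow (rowState M lam ν i (n + 1) m).get M'.get (8 * L + 12) ∧
      M'.fail ≠ [] ∧ M'.out = M.out := by
  -- When `ν` has run out, its end mark stays on `inp` and stands for a row of length zero.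
  obtain ⟨irest, hinp, hirest⟩ : ∃ irest, blocks (fun j => encodePart (ν j)) i m ++ [Γ'.ket] =
      bitSyms (ν i).bits ++ irest ∧
      (irest = [Γ'.ket] ∧ m = 0 ∨
        irest = Γ'.comma :: (blocks (fun j => encodePart (ν j)) (i + 1) (m - 1) ++ [Γ'.ket]) ∧
        0 < m) := by
    cases m with
    | zero => exact ⟨[Γ'.ket], by simp [blocks, hν i (by omega), bitSyms], Or.inl ⟨rfl, rfl⟩⟩
    | succ m =>
      exact ⟨Γ'.comma :: (blocks (fun j => encodePart (ν j)) (i + 1) m ++ [Γ'.ket]),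
        by simp [blocks, encodePart], Or.inr ⟨rfl, by omega⟩⟩
  obtain ⟨ps, prest, hprev, hps, hprest⟩ : ∃ ps prest, prevSyms ν i = bitSyms ps ++ prest ∧
      ps.length ≤ L ∧ ((i = 0 ∧ ps = [] ∧ prest = [Γ'.ket]) ∨
        (0 < i ∧ ps = (ν (i - 1)).bits ∧ prest = [])) := by
    cases i with
    | zero => exact ⟨[], [Γ'.ket], rfl, by simp, Or.inl ⟨rfl, rfl, rfl⟩⟩
    | succ i =>
      refine ⟨(ν i).bits, [], by simp [prevSyms], le_trans ?_ (hL i), Or.inr ⟨by omega, rfl, rfl⟩⟩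
      rw [Nat.size_eq_bits_len, Nat.size_eq_bits_len]
      exact Nat.size_le_size (hle i (by omega))
  have hi : irest.head?.any isBit = false := by
    rcases hirest with ⟨rfl, -⟩ | ⟨rfl, -⟩ <;> simp
  have hp : prest.head?.any isBit = false := by
    rcases hprest with ⟨-, -, rfl⟩ | ⟨-, -, rfl⟩ <;> simp
  have hloop := runs_subStep_loop (lrest := Γ'.comma :: (blocks (fun j => encodePart (lam j)) (i + 1) n
    ++ [Γ'.ket])) (by simp) hi hp (lam i).bits (ν i).bits ps false false
    { rowState M lam ν i (n + 1) m with
      qd := Γ'.comma :: (rowState M lam ν i (n + 1) m).qd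
      qo := Γ'.comma :: (rowState M lam ν i (n + 1) m).qo }
  have hcmp := le_iff_subBorrow (lam i) (ν i)
  have hlen := hL i
  split_ifs with hc
  · obtain ⟨hd, hb⟩ := hcmp.1 hc
    have htake : (ν i).bits.take (lam i).bits.length = (ν i).bits :=
      List.take_of_length_le (List.drop_eq_nil_iff.1 hd)
    have hfin : Runs finishRow
        { rowState M lam ν i (n + 1) m with
          lam := Γ'.comma :: (blocks (fun j => encodePart (lam j)) (i + 1) n ++ [Γ'.ket])
          inp := irest
          prev := bitSyms (ps.drop (lam i).bits.length) ++ prest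
          prev' := (bitSyms (ν i).bits).reverse
          f₁ := [off]
          f₂ := [Γ'.bit (subBorrow (lam i).bits ps false)]
          qd := (bitSyms (subBits (lam i).bits (ν i).bits false)).reverse ++
            Γ'.comma :: (rowState M lam ν i (n + 1) m).qd
          qo := (bitSyms (subBits (lam i).bits ps false)).reverse ++
            Γ'.comma :: (rowState M lam ν i (n + 1) m).qo }.get
        (rowState M lam ν (i + 1) n (m - 1)).get (6 * L + 9) := by
      have hover : Runs (StackProg.ite
          (fun t => (t Reg.prev).any isBit || (t .prev = some Γ'.ket || bitOf (t .f₂)))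
          (moveTo .qo isBit []) skip)
        { rowState M lam ν i (n + 1) m with
          lam := Γ'.comma :: (blocks (fun j => encodePart (lam j)) (i + 1) n ++ [Γ'.ket])
          inp := irest
          prev := bitSyms (ps.drop (lam i).bits.length) ++ prest
          prev' := (bitSyms (ν i).bits).reverse
          f₁ := [off]
          f₂ := [Γ'.bit (subBorrow (lam i).bits ps false)]
          qd := (bitSyms (subBits (lam i).bits (ν i).bits false)).reverse ++
            Γ'.comma :: (rowState M lam ν i (n + 1) m).qd
          qo := (bitSyms (subBits (lam i).bits ps false)).reverse ++
            Γ'.comma :: (rowState M lam ν i (n + 1) m).qo }.get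
        { rowState M lam ν i (n + 1) m with
          lam := Γ'.comma :: (blocks (fun j => encodePart (lam j)) (i + 1) n ++ [Γ'.ket])
          inp := irest
          prev := bitSyms (ps.drop (lam i).bits.length) ++ prest
          prev' := (bitSyms (ν i).bits).reverse
          f₁ := [off]
          f₂ := [Γ'.bit (subBorrow (lam i).bits ps false)]
          qd := (bitSyms (subBits (lam i).bits (ν i).bits false)).reverse ++
            Γ'.comma :: (rowState M lam ν i (n + 1) m).qd
          qo := (bitSyms (overBits lam ν i)).reverse ++
            Γ'.comma :: (rowState M lam ν i (n + 1) m).qo }.get (2 * L + 2) := by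
        have hdel : overBits lam ν i = [] →
            Runs (moveTo .qo isBit [])
              { rowState M lam ν i (n + 1) m with
                lam := Γ'.comma :: (blocks (fun j => encodePart (lam j)) (i + 1) n ++ [Γ'.ket])
                inp := irest
                prev := bitSyms (ps.drop (lam i).bits.length) ++ prest
                prev' := (bitSyms (ν i).bits).reverse
                f₁ := [off]
                f₂ := [Γ'.bit (subBorrow (lam i).bits ps false)]
                qd := (bitSyms (subBits (lam i).bits (ν i).bits false)).reverse ++
                  Γ'.comma :: (rowState M lam ν i (n + 1) m).qd
                qo := (bitSyms (subBits (lam i).bits ps false)).reverse ++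
                  Γ'.comma :: (rowState M lam ν i (n + 1) m).qo }.get
              { rowState M lam ν i (n + 1) m with
                lam := Γ'.comma :: (blocks (fun j => encodePart (lam j)) (i + 1) n ++ [Γ'.ket])
                inp := irest
                prev := bitSyms (ps.drop (lam i).bits.length) ++ prest
                prev' := (bitSyms (ν i).bits).reverse
                f₁ := [off]
                f₂ := [Γ'.bit (subBorrow (lam i).bits ps false)]
                qd := (bitSyms (subBits (lam i).bits (ν i).bits false)).reverse ++
                  Γ'.comma :: (rowState M lam ν i (n + 1) m).qd
                qo := (bitSyms (overBits lam ν i)).reverse ++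
                  Γ'.comma :: (rowState M lam ν i (n + 1) m).qo }.get (2 * L + 1) := by
          intro ho
          refine Runs.of_eq (Runs.moved (bitSyms (subBits (lam i).bits ps false)).reverse
            (Γ'.comma :: (rowState M lam ν i (n + 1) m).qo) ?_ ?_ ?_) ?_ ?_
          · simp [Mem.get]
          · exact fun x hx => isBit_of_mem_bitSyms x (List.mem_reverse.1 hx)
          · simp
          · rintro ⟨⟩ <;> simp [moved, Mem.get, ho, bitSyms]
          · simp only [List.length_reverse, bitSyms, List.length_map, length_subBits]
            omega
        rcases hprest with ⟨rfl, rfl, rfl⟩ | ⟨hi0, rfl, rfl⟩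
        · refine Runs.iteT ?_ (hdel rfl)
          simp [tops, Mem.get, bitSyms]
        · obtain ⟨i, rfl⟩ : ∃ i', i = i' + 1 := ⟨i - 1, by omega⟩
          have hcmp' := le_iff_subBorrow (lam (i + 1)) (ν i)
          simp only [Nat.add_sub_cancel] at *
          by_cases ho : ν i ≤ lam (i + 1)
          · obtain ⟨h1, h2⟩ := hcmp'.1 ho
            refine Runs.of_eq (Runs.iteF ?_ Runs.skip) ?_ (by omega)
            · simp [tops, Mem.get, h1, h2, bitSyms]
            · rintro ⟨⟩ <;> simp [Mem.get, overBits, ho]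
          · refine Runs.iteT ?_ (hdel (by simp [overBits, ho]))
            rw [hcmp'] at ho
            rcases hdr : (ν i).bits.drop (lam (i + 1)).bits.length with _ | ⟨b, bs⟩
            · have : subBorrow (lam (i + 1)).bits (ν i).bits false = true := by
                cases hh : subBorrow (lam (i + 1)).bits (ν i).bits false
                · exact absurd ⟨hdr, hh⟩ ho
                · rfl
              simp [tops, Mem.get, hdr, this, bitSyms]
            · simp [tops, Mem.get, hdr, bitSyms]
      refine Runs.of_eq (Runs.seq' hover <| Runs.seq' (Runs.movedAll
        (bitSyms (ps.drop (lam i).bits.length) ++ prest) ?_) <|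
        Runs.seq' (Runs.movedAll (bitSyms (ν i).bits).reverse ?_) (Runs.act _)) ?_ ?_
      · simp [Mem.get]
      · simp [moved, Mem.get]
      · rcases hirest with ⟨rfl, rfl⟩ | ⟨rfl, hm⟩ <;>
        rintro ⟨⟩ <;> simp [applyAct, moved, edit, tops, Mem.get, rowState, prevSyms, revBlocks, blocks]
      · have h1 : prest.length ≤ 1 := by
          rcases hprest with ⟨-, -, rfl⟩ | ⟨-, -, rfl⟩ <;> simp
        have h2 : (ν i).bits.length ≤ (lam i).bits.length := List.drop_eq_nil_iff.1 hd
        simp only [List.length_append, List.length_reverse, bitSyms, List.length_map, List.length_drop]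
        omega
    rw [hd, hb, htake] at hloop
    refine Runs.mono (Runs.seq' (Runs.act' ?_) (Runs.seq' hloop
      (Runs.iteF ?_ (hfin.of_start ?_)))) ?_
    · rintro ⟨⟩ <;> simp [edit, Mem.get, rowState, blocks, encodePart_append, hinp, hprev]
    · simp [tops, Mem.get, bitSyms, hi]
    · rintro ⟨⟩ <;> simp [Mem.get, rowState, bitSyms]
    · omega
  · refine ⟨{ { rowState M lam ν i (n + 1) m with
          lam := Γ'.comma :: (blocks (fun j => encodePart (lam j)) (i + 1) n ++ [Γ'.ket])
          inp := bitSyms ((ν i).bits.drop (lam i).bits.length) ++ irest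
          prev := bitSyms (ps.drop (lam i).bits.length) ++ prest
          prev' := (bitSyms ((ν i).bits.take (lam i).bits.length)).reverse
          f₁ := [Γ'.bit (subBorrow (lam i).bits (ν i).bits false)]
          f₂ := [Γ'.bit (subBorrow (lam i).bits ps false)]
          qd := (bitSyms (subBits (lam i).bits (ν i).bits false)).reverse ++
            Γ'.comma :: (rowState M lam ν i (n + 1) m).qd
          qo := (bitSyms (subBits (lam i).bits ps false)).reverse ++
            Γ'.comma :: (rowState M lam ν i (n + 1) m).qo } with fail := [tok] },
      Runs.mono (Runs.seq' (Runs.act' ?_) (Runs.seq' hloop (Runs.iteT ?_ (Runs.act' ?_)))) ?_,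
      by simp, rfl⟩
    · rintro ⟨⟩ <;> simp [edit, Mem.get, rowState, blocks, encodePart_append, hinp, hprev]
    · rw [hcmp] at hc
      rcases hdr : (ν i).bits.drop (lam i).bits.length with _ | ⟨b, bs⟩
      · have : subBorrow (lam i).bits (ν i).bits false = true := by
          cases hh : subBorrow (lam i).bits (ν i).bits false
          · exact absurd ⟨hdr, hh⟩ hc
          · rfl
        simp [tops, Mem.get, this]
      · simp [tops, Mem.get, hdr, bitSyms]
    · rintro ⟨⟩ <;> simp [edit, Mem.get, rowState]
    · omega

/-- The subtraction of the rows from row `i` on either reports a failure or computes all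
differences. -/
theorem runs_subRow_loop (hL : ∀ j, (lam j).bits.length ≤ L) (M : Mem) : ∀ {i m : ℕ},
    (∀ j, i + m ≤ j → ν j = 0) → (∀ j, j < i → ν j ≤ lam j) →
    ((∀ j, j < i + n → ν j ≤ lam j) ∧
      Runs (loop (fun t => t .lam ≠ some Γ'.ket && t .fail = none) subRow)
        (rowState M lam ν i n m).get (rowState M lam ν (i + n) 0 (m - n)).get
        (n * (8 * L + 13) + 1)) ∨
    ((∃ j, lam j < ν j) ∧ ∃ M' : Mem,
      Runs (loop (fun t => t .lam ≠ some Γ'.ket && t .fail = none) subRow)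
        (rowState M lam ν i n m).get M'.get (n * (8 * L + 13) + 1) ∧
        M'.fail ≠ [] ∧ M'.out = M.out) := by
  induction n with
  | zero =>
    intro i m hν hle
    refine Or.inl ⟨hle, Runs.of_eq (Runs.done ?_) (fun _ => rfl) (by omega)⟩
    simp [tops, Mem.get, rowState, blocks]
  | succ n ih =>
    intro i m hν hle
    have htest : ((tops (rowState M lam ν i (n + 1) m).get .lam ≠ some Γ'.ket &&
        tops (rowState M lam ν i (n + 1) m).get .fail = none : Bool)) = true := by
      rcases h : (lam i).bits with _ | ⟨b, bs⟩ <;>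
        simp [tops, Mem.get, rowState, blocks, encodePart, h, bitSyms]
    have hrow := runs_subRow (n := n) hν hL hle M
    split_ifs at hrow with hc
    · rcases ih (i := i + 1) (m := m - 1) (fun j hj => hν j (by omega)) (fun j hj => by
        rcases Nat.lt_succ_iff_lt_or_eq.1 hj with h | rfl
        · exact hle j h
        · exact hc) with ⟨h1, h2⟩ | ⟨h1, M', h2, h3⟩
      · rw [show i + 1 + n = i + (n + 1) by omega, show m - 1 - n = m - (n + 1) by omega] at h2
        refine Or.inl ⟨fun j hj => h1 j (by omega), Runs.mono (Runs.step htest hrow h2) ?_⟩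
        rw [add_one_mul]
        omega
      · refine Or.inr ⟨h1, M', Runs.mono (Runs.step htest hrow h2) ?_, h3⟩
        rw [add_one_mul]
        omega
    · obtain ⟨M', h1, h2, h3⟩ := hrow
      refine Or.inr ⟨⟨i, by omega⟩, M', Runs.mono (Runs.step htest h1 (Runs.done ?_)) ?_, h2, h3⟩
      · simp [tops, Mem.get, h2]
      · rw [add_one_mul]
        have := Nat.zero_le (n * (8 * L + 13))
        omega

/-- At most as many rows of `ν` are read as `λ` has, so the cost does not depend on `ν`. If no row
fails but the end mark of `ν` is not reached, `ν` has a positive part in row `l`, below all rows of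
`λ`. -/
theorem runs_subRows {l l' : ℕ} (hL : ∀ j, (lam j).bits.length ≤ L) (hlam : ∀ j, l ≤ j → lam j = 0)
    (hν : ∀ j, l' ≤ j → ν j = 0) (hν' : ∀ j, j < l' → 0 < ν j) (M : Mem) :
    ((∀ j, ν j ≤ lam j) ∧
      Runs subRows
        { M with
          lam := blocks (fun j => encodePart (lam j)) 0 l ++ [Γ'.ket]
          inp := blocks (fun j => encodePart (ν j)) 0 l' ++ [Γ'.ket]
          prev := []
          prev' := []
          f₁ := []
          f₂ := []
          fail := []
          qd := []
          qo := [] }.get (rowState M lam ν l 0 0).get (l * (8 * L + 13) + 4)) ∨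
    ((∃ j, lam j < ν j) ∧ ∃ M' : Mem, Runs subRows
        { M with
          lam := blocks (fun j => encodePart (lam j)) 0 l ++ [Γ'.ket]
          inp := blocks (fun j => encodePart (ν j)) 0 l' ++ [Γ'.ket]
          prev := []
          prev' := []
          f₁ := []
          f₂ := []
          fail := []
          qd := []
          qo := [] }.get M'.get (l * (8 * L + 13) + 4) ∧ M'.fail ≠ [] ∧ M'.out = M.out) := by
  have hinit : Runs (StackProg.act fun _ k => match k with
      | .f₁ => (false, some off) | .f₂ => (false, some off) | .prev => (false, some Γ'.ket)
      | _ => (false, none))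
      { M with
          lam := blocks (fun j => encodePart (lam j)) 0 l ++ [Γ'.ket]
          inp := blocks (fun j => encodePart (ν j)) 0 l' ++ [Γ'.ket]
          prev := []
          prev' := []
          f₁ := []
          f₂ := []
          fail := []
          qd := []
          qo := [] }.get (rowState M lam ν 0 l l').get 1 := by
    refine Runs.act' ?_
    rintro ⟨⟩ <;> simp [edit, Mem.get, rowState, prevSyms, revBlocks]
  have hskip : Runs StackProg.setFail (rowState M lam ν l 0 (l' - l)).get
      { rowState M lam ν l 0 (l' - l) with fail := [tok] }.get 1 := by
    refine Runs.act' ?_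
    rintro ⟨⟩ <;> simp [edit, Mem.get, rowState]
  rcases runs_subRow_loop (n := l) hL M (i := 0) (m := l') (fun j hj => hν j (by omega))
    (fun j hj => absurd hj (Nat.not_lt_zero _)) with ⟨h1, h2⟩ | ⟨h1, M', h2, h3, h4⟩
  · rw [zero_add] at h1 h2
    rcases Nat.eq_zero_or_pos (l' - l) with h0 | h0
    · rw [h0] at h2
      refine Or.inl ⟨fun j => ?_, Runs.mono (Runs.seq' hinit (Runs.seq' h2 (Runs.iteT ?_ Runs.skip))) ?_⟩
      · rcases lt_or_ge j l with hj | hj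
        · exact h1 j hj
        · rw [hν j (by omega)]
          exact Nat.zero_le _
      · simp [tops, Mem.get, rowState, blocks]
      · omega
    · refine Or.inr ⟨⟨l, by rw [hlam l le_rfl]; exact hν' l (by omega)⟩, _,
        Runs.mono (Runs.seq' hinit (Runs.seq' h2 (Runs.iteF ?_ hskip))) ?_, by simp, rfl⟩
      · obtain ⟨x, hx⟩ : ∃ x, l' - l = x + 1 := ⟨l' - l - 1, by omega⟩
        rcases h : (ν l).bits with _ | ⟨b, bs⟩ <;>
          simp [tops, Mem.get, rowState, hx, blocks, encodePart, h, bitSyms]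
      · omega
  · by_cases hk : tops M'.get Reg.inp = some Γ'.ket
    · exact Or.inr ⟨h1, M', Runs.mono (Runs.seq' hinit (Runs.seq' h2
        (Runs.iteT (by simp [hk]) Runs.skip))) (by omega), h3, h4⟩
    · refine Or.inr ⟨h1, { M' with fail := tok :: M'.fail }, Runs.mono (Runs.seq' hinit (Runs.seq' h2
        (Runs.iteF (by simp [hk]) (Runs.act' ?_)))) (by omega), by simp, h4⟩
      rintro ⟨⟩ <;> simp [edit, Mem.get]

end subRow

/-! ### Conversion to unary -/

namespace StackProg

/-- Record the two unary numbers of a row. -/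
def keepRow : StackProg Reg :=
  seq (act fun _ k => match k with
    | .ge => (false, some Γ'.comma) | .gs => (false, some Γ'.comma) | _ => (false, none)) <|
  seq (loop (fun t => (t .x').isSome) <| act fun _ k => match k with
    | .x' => (true, none) | .x => (true, none) | .ge => (false, some tok) | _ => (false, none)) <|
  moveAll .x [.ge, .gs]

/-- Convert the two numbers of a row to unary; drop empty rows. -/
def convertRow : StackProg Reg :=
  seq (toUnary .qd .x) <| seq (toUnary .qo .x') <|
  seq (act fun _ k => match k with | .qd => (true, none) | .qo => (true, none) | _ => (false, none)) <|
  ite (fun t => (t .x).isSome) keepRow skip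

/-- Convert all rows. -/
def convertRows : StackProg Reg := loop (fun t => (t .qd).isSome) convertRow

end StackProg

theorem runs_keepRow (a b : ℕ) (M : Mem) :
    Runs keepRow
      { M with x := List.replicate (a + b) tok, x' := List.replicate b tok }.get
      { M with x := [], x' := [], ge := unary (a + b) ++ M.ge, gs := unary a ++ M.gs }.get
      (2 * a + 2 * b + 3) := by
  have hloop : ∀ (b : ℕ) (M : Mem), Runs (loop (fun t => (t Reg.x').isSome) <| act fun _ k => match k with
      | .x' => (true, none) | .x => (true, none) | .ge => (false, some tok) | _ => (false, none))
      { M with x := List.replicate (a + b) tok, x' := List.replicate b tok }.get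
      { M with
        x := List.replicate a tok, x' := [], ge := List.replicate b tok ++ M.ge }.get (2 * b + 1) := by
    intro b
    induction b with
    | zero =>
      intro M
      refine Runs.of_eq (Runs.done ?_) ?_ le_rfl
      · simp [tops, Mem.get]
      · rintro ⟨⟩ <;> simp [Mem.get]
    | succ b ih =>
      intro M
      refine Runs.of_eq (Runs.step ?_ (Runs.act' ?_) (ih { M with ge := tok :: M.ge })) ?_ (by omega)
      · simp [tops, Mem.get, List.replicate_succ]
      · rintro ⟨⟩ <;> simp [edit, Mem.get, List.replicate_succ, ← Nat.add_assoc]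
      · rintro ⟨⟩ <;> simp [Mem.get, List.replicate_succ']
  refine Runs.of_eq (Runs.seq' (Runs.act' ?_) (Runs.seq' (hloop b
    { M with ge := Γ'.comma :: M.ge, gs := Γ'.comma :: M.gs })
    (Runs.movedAll (List.replicate a tok) ?_))) ?_ ?_
  · rintro ⟨⟩ <;> simp [edit, Mem.get]
  · simp [Mem.get]
  · rintro ⟨⟩ <;> simp [moved, Mem.get, unary_append]
    rw [← List.append_assoc, List.replicate_append_replicate]
  · simp
    omega

/-- Concatenation of the `f j` with `d j ≠ 0`. -/
def keptBlocks (f : ℕ → List Γ') (d : ℕ → ℕ) : ℕ → ℕ → List Γ'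
  | _, 0 => []
  | i, n + 1 => (if d i = 0 then [] else f i) ++ keptBlocks f d (i + 1) n

theorem keptBlocks_succ_right (f : ℕ → List Γ') (d : ℕ → ℕ) (i n : ℕ) :
    keptBlocks f d i (n + 1) = keptBlocks f d i n ++ if d (i + n) = 0 then [] else f (i + n) := by
  induction n generalizing i with
  | zero => simp [keptBlocks]
  | succ n ih =>
    rw [keptBlocks, ih, keptBlocks, List.append_assoc, Nat.add_right_comm i 1 n, Nat.add_assoc i n 1]

/-- Dropping the empty rows during the conversion is the reindexing by `Nat.nth` used in
`ncard_lrMat_compress`. -/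
theorem keptBlocks_eq (f : ℕ → List Γ') (d : ℕ → ℕ) (n : ℕ) :
    keptBlocks f d 0 n =
      blocks (fun j => f (Nat.nth (fun m => d m ≠ 0) j)) 0 (Nat.count (fun m => d m ≠ 0) n) := by
  induction n with
  | zero => simp [keptBlocks, blocks]
  | succ n ih =>
    rw [keptBlocks_succ_right, ih, Nat.count_succ, zero_add]
    by_cases h : d n = 0
    · simp [h]
    · rw [if_neg h, if_pos h, blocks_succ_right, zero_add, Nat.nth_count (p := fun m => d m ≠ 0) h]

/-- The rows are treated from the last to the first, as they lie on the stacks, so `ge` and `gs` end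
with the first row on top. Since `toUnary` is linear in the value, the unary work is charged to the
sum of the `d j`. -/
theorem runs_convertRows {D O : ℕ → List Bool} {d o : ℕ → ℕ} {L : ℕ}
    (hD : ∀ j, bitsVal (D j) = d j) (hO : ∀ j, bitsVal (O j) = o j) (hod : ∀ j, o j ≤ d j)
    (hDL : ∀ j, (D j).length ≤ L) (hOL : ∀ j, (O j).length ≤ L) (i : ℕ) : ∀ (n : ℕ) (M : Mem),
    Runs convertRows
      { M with
        qd := revBlocks (fun j => Γ'.comma :: bitSyms (D j)) i
        qo := revBlocks (fun j => Γ'.comma :: bitSyms (O j)) i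
        x := []
        x' := []
        y := []
        y' := []
        ge := keptBlocks (fun j => unary (d j)) d i n
        gs := keptBlocks (fun j => unary (d j - o j)) d i n }.get
      { M with
        qd := []
        qo := []
        x := []
        x' := []
        y := []
        y' := []
        ge := keptBlocks (fun j => unary (d j)) d 0 (i + n)
        gs := keptBlocks (fun j => unary (d j - o j)) d 0 (i + n) }.get
      (16 * (∑ j ∈ range i, d j) + i * (10 * L + 10) + 1) := by
  induction i with
  | zero =>
    intro n M
    refine Runs.of_eq (Runs.done ?_) ?_ (by simp)
    · simp [tops, Mem.get, revBlocks]
    · rintro ⟨⟩ <;> simp [Mem.get, revBlocks]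
  | succ i ih =>
    intro n M
    have h1 := ih (n + 1) M
    have hd := hod i
    have hDi := hDL i
    have hOi := hOL i
    have hrow : Runs convertRow
        { M with
          qd := revBlocks (fun j => Γ'.comma :: bitSyms (D j)) (i + 1)
          qo := revBlocks (fun j => Γ'.comma :: bitSyms (O j)) (i + 1)
          x := []
          x' := []
          y := []
          y' := []
          ge := keptBlocks (fun j => unary (d j)) d (i + 1) n
          gs := keptBlocks (fun j => unary (d j - o j)) d (i + 1) n }.get
        { M with
          qd := revBlocks (fun j => Γ'.comma :: bitSyms (D j)) i
          qo := revBlocks (fun j => Γ'.comma :: bitSyms (O j)) i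
          x := []
          x' := []
          y := []
          y' := []
          ge := keptBlocks (fun j => unary (d j)) d i (n + 1)
          gs := keptBlocks (fun j => unary (d j - o j)) d i (n + 1) }.get
        (16 * d i + (10 * L + 9)) := by
      have hend : Runs (StackProg.ite (fun t => (t Reg.x).isSome) keepRow skip)
          { M with
            qd := revBlocks (fun j => Γ'.comma :: bitSyms (D j)) i
            qo := revBlocks (fun j => Γ'.comma :: bitSyms (O j)) i
            x := List.replicate (d i) tok
            x' := List.replicate (o i) tok
            y := []
            y' := []
            ge := keptBlocks (fun j => unary (d j)) d (i + 1) n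
            gs := keptBlocks (fun j => unary (d j - o j)) d (i + 1) n }.get
          { M with
            qd := revBlocks (fun j => Γ'.comma :: bitSyms (D j)) i
            qo := revBlocks (fun j => Γ'.comma :: bitSyms (O j)) i
            x := []
            x' := []
            y := []
            y' := []
            ge := keptBlocks (fun j => unary (d j)) d i (n + 1)
            gs := keptBlocks (fun j => unary (d j - o j)) d i (n + 1) }.get (2 * d i + 4) := by
        rcases Nat.eq_zero_or_pos (d i) with h0 | h0
        · refine Runs.of_eq (Runs.iteF ?_ Runs.skip) ?_ (by omega)
          · simp [tops, Mem.get, h0]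
          · rintro ⟨⟩ <;> simp [Mem.get, keptBlocks, h0, show o i = 0 by omega]
        · have := runs_keepRow (d i - o i) (o i) { M with
            qd := revBlocks (fun j => Γ'.comma :: bitSyms (D j)) i
            qo := revBlocks (fun j => Γ'.comma :: bitSyms (O j)) i
            y := []
            y' := []
            ge := keptBlocks (fun j => unary (d j)) d (i + 1) n
            gs := keptBlocks (fun j => unary (d j - o j)) d (i + 1) n }
          rw [Nat.sub_add_cancel hd] at this
          refine Runs.of_eq (Runs.iteT ?_ this) ?_ (by omega)
          · obtain ⟨x, hx⟩ : ∃ x, d i = x + 1 := ⟨d i - 1, by omega⟩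
            simp [tops, Mem.get, hx, List.replicate_succ]
          · rintro ⟨⟩ <;> simp [Mem.get, keptBlocks, h0.ne']
      refine Runs.mono (Runs.seq' (runs_toUnary_bitsVal (by decide) (D i)
          (rest := Γ'.comma :: revBlocks (fun j => Γ'.comma :: bitSyms (D j)) i) ?_ ?_ ?_ ?_ ?_) <|
        Runs.seq' (runs_toUnary_bitsVal (by decide) (O i)
          (rest := Γ'.comma :: revBlocks (fun j => Γ'.comma :: bitSyms (O j)) i) ?_ ?_ ?_ ?_ ?_) <|
        Runs.seq' (Runs.act _) (Runs.of_start hend ?_)) ?_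
      case refine_12 =>
        rw [hD, hO]
        omega
      case refine_11 =>
        rintro ⟨⟩ <;> simp [applyAct, edit, Mem.get, hD, hO]
      all_goals simp [Mem.get, revBlocks, bitSyms]
    unfold convertRows at h1
    refine Runs.of_eq (Runs.step ?_ hrow h1) ?_ ?_
    · simp [tops, Mem.get, revBlocks, List.isSome_head?]
    · rintro ⟨⟩ <;> simp [Mem.get, Nat.add_right_comm i 1 n, Nat.add_assoc i n 1]
    · rw [sum_range_succ, add_one_mul]
      omega

/-! ### The machine for Littlewood-Richardson coefficients -/

namespace StackProg

/-- The machine for Littlewood-Richardson coefficients. -/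
def lrProg : StackProg Reg :=
  seq readFirst <| seq readSecond <| seq subRows <|
  ite (fun t => t .fail = none) (seq convertRows <| seq firstWord checkAll) skip

end StackProg

/-- The stacks at the start. -/
def Mem.start (w : List Γ') : Mem where
  inp := w
  lam := []
  tmp := []
  prev := []
  prev' := []
  qd := []
  qo := []
  f₁ := []
  f₂ := []
  fail := []
  mu := []
  kk := []
  ku := []
  x := []
  x' := []
  y := []
  y' := []
  ge := []
  gs := []
  w := []
  w' := []
  out := []
  quit := []
  z := ⟨[], [], [], [], [], [], [], [], []⟩

theorem bitsVal_overBits (lam ν : YoungDiagram) (j : ℕ) :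
    bitsVal (overBits lam.rowLen ν.rowLen j) = skewOverlap lam ν j := by
  cases j with
  | zero => rfl
  | succ j =>
    rw [overBits, skewOverlap]
    split_ifs with h
    · exact bitsVal_subBits_bits h
    · simp [bitsVal]
      omega

/-- A row that is not empty has at least one cell; this yields at most `k` letters after
compression. -/
theorem count_le_sum (d : ℕ → ℕ) (n : ℕ) :
    Nat.count (fun m => d m ≠ 0) n ≤ ∑ j ∈ range n, d j := by
  induction n with
  | zero => simp
  | succ n ih =>
    rw [Nat.count_succ, sum_range_succ]
    split_ifs <;> omega

section correct

variable {lam μ ν : YoungDiagram}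

theorem rowLen_pos_of_lt (h : YoungDiagram) {j : ℕ} (hj : j < h.colLen 0) : 0 < h.rowLen j :=
  YoungDiagram.mem_iff_lt_rowLen.1 (YoungDiagram.mem_iff_lt_colLen.2 hj)

theorem length_rowFlags_eq_card (μ : YoungDiagram) :
    (rowFlags μ.rowLen 0 (μ.colLen 0)).length = μ.card := by
  rw [length_rowFlags _ _ fun j _ hj => rowLen_pos_of_lt μ (by omega), μ.card_eq_sum le_rfl]
  simp

theorem sum_skewLen (hle : ∀ m, ν.rowLen m ≤ lam.rowLen m) (hcard : ν.card + μ.card = lam.card) :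
    ∑ m ∈ range (lam.colLen 0), skewLen lam ν m = μ.card := by
  have hνr : ν.colLen 0 ≤ lam.colLen 0 := by
    refine ν.colLen_le ?_
    have := hle (lam.colLen 0)
    rw [lam.rowLen_eq_zero le_rfl] at this
    omega
  have : ∑ m ∈ range (lam.colLen 0), skewLen lam ν m + ν.card = lam.card := by
    rw [ν.card_eq_sum hνr, lam.card_eq_sum le_rfl, ← sum_add_distrib]
    refine sum_congr rfl fun m _ => ?_
    have := hle m
    simp only [skewLen]
    omega
  omega

/-- The indices of the non-empty rows of a skew shape. -/
noncomputable def skewRow (lam ν : YoungDiagram) (j : ℕ) : ℕ := Nat.nth (fun m => skewLen lam ν m ≠ 0) j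

/-- The number of non-empty rows of a skew shape. -/
def skewRows (lam ν : YoungDiagram) : ℕ := Nat.count (fun m => skewLen lam ν m ≠ 0) (lam.colLen 0)

theorem validCount_eq_lrCoeff (hle : ∀ m, ν.rowLen m ≤ lam.rowLen m)
    (hcard : ν.card + μ.card = lam.card) :
    validCount μ.card (skewRows lam ν) (fun j => skewGap lam ν (skewRow lam ν j))
      (fun j => skewLen lam ν (skewRow lam ν j)) (rowFlags μ.rowLen 0 (μ.colLen 0))
      ((μ.card + 1) ^ μ.card) = lrCoeff lam μ ν := by
  classical
  have hr : skewRows lam ν ≤ μ.card := (count_le_sum _ _).trans (sum_skewLen hle hcard).le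
  have hdzero : ∀ m, lam.colLen 0 ≤ m → skewLen lam ν m = 0 := fun m hm => by
    rw [skewLen, lam.rowLen_eq_zero hm, Nat.zero_sub]
  rw [lrCoeff_eq_card, ncard_gtPatterns_eq_lrMat hle hcard,
    ncard_lrMat_compress hdzero (skewGap_zero lam ν) fun m hm => skewGap_succ_of_skewLen_eq_zero hm]
  have h1 := wordSum_eq_sum_range (Nat.succ_pos μ.card) (rowFlags μ.rowLen 0 (μ.colLen 0)).length
    (fun w => if WordValid μ.card (skewRows lam ν) (fun j => skewGap lam ν (skewRow lam ν j))
      (fun j => skewLen lam ν (skewRow lam ν j)) (fun _ _ => 0) 0 0 w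
      (rowFlags μ.rowLen 0 (μ.colLen 0)) then 1 else 0)
  have h2 : (rowFlags μ.rowLen 0 (μ.colLen 0)).length = μ.card := length_rowFlags_eq_card μ
  have h3 : validCount μ.card (skewRows lam ν) (fun j => skewGap lam ν (skewRow lam ν j))
      (fun j => skewLen lam ν (skewRow lam ν j)) (rowFlags μ.rowLen 0 (μ.colLen 0))
      ((μ.card + 1) ^ (rowFlags μ.rowLen 0 (μ.colLen 0)).length) =
      wordSum (μ.card + 1) (rowFlags μ.rowLen 0 (μ.colLen 0)).length (fun w =>
        if WordValid μ.card (skewRows lam ν) (fun j => skewGap lam ν (skewRow lam ν j))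
          (fun j => skewLen lam ν (skewRow lam ν j)) (fun _ _ => 0) 0 0 w
          (rowFlags μ.rowLen 0 (μ.colLen 0)) then 1 else 0) := by
    rw [h1, validCount]
  have h4 : (μ.card + 1) ^ μ.card = (μ.card + 1) ^ (rowFlags μ.rowLen 0 (μ.colLen 0)).length := by
    rw [h2]
  rw [h4, h3]
  -- `Fits` presupposes a cell, so the empty `μ` is treated apart: its only word is the empty one,
  -- which is valid.
  rcases Nat.eq_zero_or_pos (μ.colLen 0) with h0 | h0
  · rw [h0, ncard_lrMat_zero]
    simp [rowFlags, wordSum, WordValid]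
  · obtain ⟨l, hl⟩ : ∃ l, μ.colLen 0 = l + 1 := ⟨μ.colLen 0 - 1, by omega⟩
    have hf := fits_rowFlags (μ := μ.rowLen) (l := μ.colLen 0) l 0 (by omega)
      fun j hj => rowLen_pos_of_lt μ hj
    rw [← hl] at hf
    have hk : μ.rowLen 0 ≤ μ.card := by
      rw [μ.card_eq_sum le_rfl]
      exact single_le_sum (f := μ.rowLen) (fun _ _ => Nat.zero_le _) (mem_range.2 h0)
    exact wordSum_eq_ncard_lrMat hr hk (fun j hj => rowLen_pos_of_lt μ hj) h0 hf

theorem length_bits_rowLen_le (lam : YoungDiagram) (j : ℕ) :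
    (lam.rowLen j).bits.length ≤ Nat.log 2 (lam.rowLen 0) + 1 := by
  rw [Nat.size_eq_bits_len, Nat.size_le]
  exact (lam.rowLen_antitone (Nat.zero_le j)).trans_lt (Nat.lt_pow_succ_log_self (by omega) _)

theorem length_encodePartition_le (lam : YoungDiagram) : (encodePartition lam).length ≤
    lam.colLen 0 * (Nat.log 2 (lam.rowLen 0) + 2) + 1 := by
  rw [encodePartition_eq, List.length_append]
  refine Nat.add_le_add (length_blocks_le fun x _ _ => ?_) le_rfl
  have := length_bits_rowLen_le lam x
  simp only [encodePart, bitSyms, List.length_append, List.length_map, List.length_singleton]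
  omega

theorem runs_lrProg (hcard : ν.card + μ.card = lam.card) :
    ∃ M' : Mem, Runs lrProg (Mem.start (encodeTriple lam μ ν)).get M'.get
      (100 * ((Nat.log 2 (lam.rowLen 0) + 1) * lam.colLen 0) + 50 +
        1500 * ((μ.card + 1) ^ μ.card * (μ.card + 1) ^ 3)) ∧
      M'.out = encodingNatΓ'.encode (lrCoeff lam μ ν) := by
  set L := Nat.log 2 (lam.rowLen 0) + 1 with hLdef
  set l := lam.colLen 0 with hl
  set k := μ.card with hk
  set fs := rowFlags μ.rowLen 0 (μ.colLen 0) with hfs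
  have hfsk : fs.length = k := length_rowFlags_eq_card μ
  have hL : ∀ j, (lam.rowLen j).bits.length ≤ L := length_bits_rowLen_le lam
  have hlen := length_encodePartition_le lam
  have h1 := runs_readFirst (Mem.start []) lam (encodePartition μ ++ encodePartition ν)
  have h2 := runs_readSecond μ (encodePartition ν) { Mem.start [] with lam := encodePartition lam }
  rw [← hfs, hfsk] at h2
  have h3 := runs_subRows (lam := lam.rowLen) (ν := ν.rowLen) hL
    (fun j hj => lam.rowLen_eq_zero hj) (fun j hj => ν.rowLen_eq_zero hj)
    (fun j hj => rowLen_pos_of_lt ν hj) { Mem.start [] with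
      mu := (fs.map cellMark).reverse
      kk := List.replicate k tok }
  rw [← encodePartition_eq, ← encodePartition_eq, ← hl] at h3
  have hpow : 1 ≤ (k + 1) ^ k := Nat.one_le_pow _ _ (Nat.succ_pos k)
  have e1 : lam.colLen 0 * (Nat.log 2 (lam.rowLen 0) + 2) = L * l + l := by
    rw [hLdef, ← hl]
    ring
  have e2 : l * (8 * L + 13) = 8 * (L * l) + 13 * l := by ring
  have e3 : l * (10 * L + 10) = 10 * (L * l) + 10 * l := by ring
  -- As `L ≥ 1`, terms linear in the number of rows are absorbed by `L * l`.
  have e4 : l ≤ L * l := Nat.le_mul_of_pos_left _ (by omega)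
  have e5 : (k + 1) ^ 3 ≤ (k + 1) ^ k * (k + 1) ^ 3 := Nat.le_mul_of_pos_left _ (by omega)
  have e6 : (k + 1) ^ 3 = k * k * k + 3 * (k * k) + 3 * k + 1 := by ring
  rcases h3 with ⟨hle, h3⟩ | ⟨⟨j, hj⟩, M', h3, h4, h5⟩
  · have hsum := sum_skewLen hle hcard
    rw [← hl, ← hk] at hsum
    have hr : skewRows lam ν ≤ k := (count_le_sum _ _).trans hsum.le
    have hd : ∀ m, m < skewRows lam ν → skewLen lam ν (skewRow lam ν m) ≤ k := fun m hm => by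
      rw [← hsum]
      exact single_le_sum (f := skewLen lam ν) (fun _ _ => Nat.zero_le _)
        (mem_range.2 (Nat.nth_lt_of_lt_count hm))
    have hg : ∀ m, m < skewRows lam ν → skewGap lam ν (skewRow lam ν m) ≤ k := fun m hm =>
      (Nat.sub_le _ _).trans (hd m hm)
    have h4 := runs_convertRows (D := fun j => subBits (lam.rowLen j).bits (ν.rowLen j).bits false)
      (O := overBits lam.rowLen ν.rowLen) (d := skewLen lam ν) (o := skewOverlap lam ν) (L := L)
      (fun j => bitsVal_subBits_bits (hle j)) (bitsVal_overBits lam ν) (fun j => by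
        cases j with
        | zero => exact Nat.zero_le _
        | succ j =>
          have := ν.rowLen_antitone (Nat.le_succ j)
          simp only [skewOverlap, skewLen, Nat.succ_eq_add_one] at *
          omega)
      (fun j => by rw [length_subBits]; exact hL j) (fun j => by
        cases j with
        | zero => exact Nat.zero_le _
        | succ j =>
          rw [overBits]
          split_ifs
          · rw [length_subBits]
            exact hL _
          · exact Nat.zero_le _) l 0 (rowState { Mem.start [] with
      mu := (fs.map cellMark).reverse
      kk := List.replicate k tok } lam.rowLen ν.rowLen l 0 0)
    rw [hsum, add_zero, keptBlocks_eq, keptBlocks_eq] at h4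
    set ge := blocks (fun x => unary (skewLen lam ν (skewRow lam ν x))) 0 (skewRows lam ν) with hge
    set gs := blocks (fun x => unary (skewGap lam ν (skewRow lam ν x))) 0 (skewRows lam ν) with hgs
    have h5 := runs_firstWord k fs { rowState (Mem.start []) lam.rowLen ν.rowLen l 0 0 with
      qd := []
      qo := []
      ge := ge
      gs := gs }
    rw [hfsk] at h5
    obtain ⟨M', h6, h7⟩ := runs_checkAll (r := skewRows lam ν)
      (g := fun j => skewGap lam ν (skewRow lam ν j)) (d := fun j => skewLen lam ν (skewRow lam ν j))
      hr hd hg hfsk (M := { rowState (Mem.start []) lam.rowLen ν.rowLen l 0 0 with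
        qd := []
        qo := []
        kk := List.replicate k tok
        ge := ge
        gs := gs }) ⟨hge, hgs, rfl, rfl, rfl⟩ ((k + 1) ^ k - 1) 0 (by omega)
      ⟨[], [], [], [], [], [], [], [], []⟩ (fun q hq => by fin_cases hq <;> exact Nat.zero_le _)
    refine ⟨M', ?_, ?_⟩
    · refine Runs.mono (Runs.seq' (h1.of_start ?_) <| Runs.seq' (h2.of_start ?_) <|
        Runs.seq' (h3.of_start ?_) <| Runs.iteT ?_ <| Runs.seq' (h4.of_start ?_) <|
        Runs.seq' (h5.of_start ?_) (h6.of_start ?_)) ?_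
      · rintro ⟨⟩ <;> simp [Mem.get, Mem.start, encodeTriple]
      · rintro ⟨⟩ <;> rfl
      · rintro ⟨⟩ <;> rfl
      · rfl
      · rintro ⟨⟩ <;> rfl
      · rintro ⟨⟩ <;> rfl
      · rintro ⟨⟩ <;> rfl
      · have e7 : ((k + 1) ^ k - 1 + 1) * (1400 * (k + 1) ^ 3 + 1) =
            1400 * ((k + 1) ^ k * (k + 1) ^ 3) + (k + 1) ^ k := by
          rw [Nat.sub_add_cancel hpow]
          ring
        have e8 : (k + 1) ^ k ≤ (k + 1) ^ k * (k + 1) ^ 3 :=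
          Nat.le_mul_of_pos_right _ (by positivity)
        have e9 : k * (4 * k + 4) = 4 * (k * k) + 4 * k := by ring
        rw [e7, e2, e3, e9]
        omega
    · rw [h7, validCount_eq_lrCoeff hle hcard, encodingNatΓ'_encode]
  · refine ⟨M', ?_, ?_⟩
    · refine Runs.mono (Runs.seq' (h1.of_start ?_) <| Runs.seq' (h2.of_start ?_) <|
        Runs.seq' (h3.of_start ?_) <| Runs.iteF ?_ Runs.skip) ?_
      · rintro ⟨⟩ <;> simp [Mem.get, Mem.start, encodeTriple]
      · rintro ⟨⟩ <;> rfl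
      · rintro ⟨⟩ <;> rfl
      · simp [tops, Mem.get, h4]
      · rw [e2]
        omega
    -- A failure leaves the output stack empty, and the empty list is the binary code of 0.
    · rw [h5, lrCoeff_eq_zero ⟨j, hj⟩, encodingNatΓ'_encode]
      rfl

end correct

/-! ### The running time -/

theorem add_one_pow_le (k : ℕ) (hk : 0 < k) : (k + 1) ^ k ≤ 3 * k ^ k := by
  have hk' : (0 : ℝ) < k := by exact_mod_cast hk
  -- `(1 + 1/k)^k ≤ e < 3`.
  have h1 : (1 / (k : ℝ) + 1) ^ k ≤ 3 := by
    calc (1 / (k : ℝ) + 1) ^ k ≤ (Real.exp (1 / k)) ^ k :=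
          pow_le_pow_left₀ (by positivity) (Real.add_one_le_exp _) k
      _ = Real.exp 1 := by rw [← Real.exp_nat_mul, mul_one_div_cancel hk'.ne']
      _ ≤ 3 := by linarith [Real.exp_one_lt_d9]
  have h2 : ((k : ℝ) + 1) ^ k ≤ 3 * (k : ℝ) ^ k := by
    have : (k : ℝ) + 1 = (1 / (k : ℝ) + 1) * k := by
      field_simp
      ring
    rw [this, mul_pow]
    exact mul_le_mul_of_nonneg_right h1 (by positivity)
  exact_mod_cast h2

/-- For `k > 0`, `(k + 1)^3 ≤ 8 k^3 ≤ 8 k^2 2^k` and `(k + 1)^k ≤ 3 k^k`, whence the factor `3 * 8`.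
The summand 1 is there for `k = 0`. -/
theorem add_one_pow_mul_le (k : ℕ) :
    (k + 1) ^ k * (k + 1) ^ 3 ≤ 24 * (1 + 2 ^ k * k ^ (k + 2)) := by
  rcases Nat.eq_zero_or_pos k with rfl | hk
  · simp
  · have h1 := add_one_pow_le k hk
    have h2 : (k + 1) ^ 3 ≤ 8 * (k ^ 2 * 2 ^ k) := by
      calc (k + 1) ^ 3 ≤ (2 * k) ^ 3 := Nat.pow_le_pow_left (by omega) 3
        _ = 8 * (k ^ 2 * k) := by ring
        _ ≤ 8 * (k ^ 2 * 2 ^ k) := by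
          have := (Nat.lt_two_pow_self (n := k)).le
          gcongr
    calc (k + 1) ^ k * (k + 1) ^ 3 ≤ (3 * k ^ k) * (8 * (k ^ 2 * 2 ^ k)) := Nat.mul_le_mul h1 h2
      _ = 24 * (2 ^ k * k ^ (k + 2)) := by ring
      _ ≤ 24 * (1 + 2 ^ k * k ^ (k + 2)) := by omega

theorem proposition4p2 :
    (∀ mu nu : YoungDiagram,
      ∃! c : YoungDiagram →₀ ℕ, IsSchurExpansion (schur mu * schur nu) c) ∧
    ∃ (M : Turing.TM2ComputableAux Computability.Γ' Computability.Γ') (C : ℕ),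
      ∀ (n k : ℕ) (lam mu nu : YoungDiagram), 0 < n → k ≤ n →
        lam.card = n → mu.card = k → nu.card = n - k →
        ComputesWithin M (encodeTriple lam mu nu)
          (Computability.encodingNatΓ'.encode (lrCoeff lam mu nu))
          (C * ((Nat.log 2 (lam.rowLen 0) + 1) * lam.colLen 0 + 2 ^ k * k ^ (k + 2))) := by
  -- The enumeration contributes `1500 * 24 = 36000`. The margin, together with `(log λ_1 + 1) ℓ(λ)
  -- ≥ 1` for nonempty `λ`, absorbs the constant terms and the coefficient 100.
  refine ⟨fun mu nu => existsUnique_schurExpansion mu nu, lrProg.machine .inp .out, 40000, ?_⟩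
  rintro n k lam mu nu hn hk rfl rfl hnu
  obtain ⟨M', h1, h2⟩ := runs_lrProg (lam := lam) (μ := mu) (ν := nu) (by omega)
  have h3 : Function.update (fun _ => []) .inp (encodeTriple lam mu nu) =
      (Mem.start (encodeTriple lam mu nu)).get := by
    funext q
    cases q <;> rfl
  rw [← h3] at h1
  obtain ⟨c, ⟨h4⟩, h5⟩ := h1.computesWithin (out := Reg.out) (o := _) (show M'.get Reg.out = _ from h2)
  refine ⟨c, ⟨⟨h4.toEvalsTo, h4.steps_le_m.trans ?_⟩⟩, h5⟩
  have hl : 0 < lam.colLen 0 := by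
    by_contra hc
    rw [lam.card_eq_sum (show lam.colLen 0 ≤ 0 by omega)] at hn
    simp at hn
  have e1 : 0 < (Nat.log 2 (lam.rowLen 0) + 1) * lam.colLen 0 := Nat.mul_pos (Nat.succ_pos _) hl
  have e2 := add_one_pow_mul_le mu.card
  omega
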